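/- Let $h>0$, $\varepsilon>0$, $m\in\mathbb R$, let $X=\mathbb R^2$, $Y=(0,\infty)\times(0,\infty)$, and for $s>0$, $x=(x_1,x_2)\in X$ put $$R(s,x)=\sqrt{(x_1-s)^2+x_2^2+h^2}+\sqrt{(x_1+s)^2+x_2^2+h^2}.$$ Let $a=a(s,t,x,\omega)$ be a smooth complex-valued function on $Y\times X\times\mathbb R$ that is a symbol of order $m+\frac12$ (for all $\alpha,\beta_1,\beta_2\in\mathbb N$, every multi-index $\gamma$ and every compact $L\subset Y\times X$ there is $c$ with $|\partial_\omega^\alpha\partial_s^{\beta_1}\partial_t^{\beta_2}\partial_x^\gamma a|\le c(1+|\omega|)^{m+\frac12-\alpha}$ on $L\times\mathbb R$), that vanishes for $(s,t)$ outside some compact subset of $Y$, and that vanishes whenever $|t-2\sqrt{s^2+h^2}|<20\varepsilon^2/h$. For $V\in C_c^\infty(X)$ let $$FV(s,t)=\int e^{-i\omega(t-R(s,x))}\,a(s,t,x,\omega)\,V(x)\,dx\,d\omega,\qquad (s,t)\in Y,$$ as an oscillatory integral, i.e. as the limit for $\delta\to0^+$ of the absolutely convergent integrals with the additional factor $e^{-\delta\omega^2}$.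 These limits exist at every point of $Y$, and $FV\in L^2(Y)$. Let $F^*$ be the $L^2$ adjoint of $F$, and let $K\in\mathcal D'(X\times X)$ be the Schwartz kernel of $F^*F$, so that $\langle K,\overline U\otimes V\rangle=\langle FV,FU\rangle_{L^2(Y)}$ for all $U,V\in C_c^\infty(X)$. Then the twisted wavefront set $WF(K)'=\{(x,\xi;y,\eta):(x,y;\xi,-\eta)\in WF(K)\}$ satisfies $$WF(K)'\subset\Delta\cup C_1\cup C_2\cup C_3,$$ where $\Delta=\{(x,\xi;x,\xi):\xi\ne0\}$ is the diagonal of $T^*X\setminus0$ and $C_i=\{(x,\xi;\chi_i(x,\xi)):\xi\neq0\}$ is the graph over $T^*X\setminus 0$ of $$\chi_1(x,\xi)=(x_1,-x_2,\xi_1,-\xi_2),\qquad \chi_2(x,\xi)=(-x_1,x_2,-\xi_1,\xi_2),\qquad \chi_3=\chi_1\circ\chi_2 .$$ The sets $\Delta,C_1,C_2,C_3$ are Lagrangian submanifolds of $T^*X\times T^*X$ for the difference of the symplectic forms of the two factors. Furthermore: (a) each of the pairs $(\Delta,C_1)$, $(\Delta,C_2)$, $(C_1,C_3)$, $(C_2,C_3)$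 intersects cleanly in codimension $2$: the intersection is a nonempty submanifold, of codimension $2$ in each of the two, and its tangent space at each of its points is the intersection of the two tangent spaces; (b) $\Delta\cap C_3=C_1\cap C_2=\emptyset$. -/

import Mathlib

open scoped Distributions ContDiff Topology RealInnerProductSpace
open MeasureTheory Filter Set

noncomputable section

namespace CommonMidpoint

/-! ### Test functions, distributions, wavefront sets -/

section Distributions

variable {E : Type*} [NormedAddCommGroup E] [NormedSpace ℝ E]
variable {E' : Type*} [NormedAddCommGroup E'] [NormedSpace ℝ E']

/-- Complex-valued test functions `C_c^∞(E)`. -/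
abbrev Test (E : Type*) [NormedAddCommGroup E] [NormedSpace ℝ E] : Type _ :=
  𝓓((⊤ : TopologicalSpace.Opens E), ℂ)

/-- Complex distributions on `E`: continuous `ℂ`-linear forms on `C_c^∞(E)`. -/
abbrev Distr (E : Type*) [NormedAddCommGroup E] [NormedSpace ℝ E] : Type _ :=
  Test E →L[ℂ] ℂ

/-- The test function `x ↦ χ x * exp (-i ⟨ζ, x⟩)`, for a covector `ζ`. -/
def modulate (χ : Test E) (ζ : E →L[ℝ] ℝ) : Test E where
  toFun x := χ x * Complex.exp (-Complex.I * (ζ x : ℂ))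
  contDiff' := by
    refine χ.contDiff.mul (ContDiff.cexp (contDiff_const.mul ?_))
    exact Complex.ofRealCLM.contDiff.comp ζ.contDiff
  hasCompactSupport' := χ.hasCompactSupport.mul_right
  tsupport_subset' := fun _ _ => trivial

/-- The complex conjugate of a test function. -/
def conjTest (φ : Test E) : Test E where
  toFun x := (starRingEnd ℂ) (φ x)
  contDiff' := Complex.conjCLE.contDiff.comp φ.contDiff
  hasCompactSupport' := φ.hasCompactSupport.comp_left (map_zero _)
  tsupport_subset' := fun _ _ => trivial

/-- The tensor product `(φ ⊗ ψ)(x, y) = φ x * ψ y` of two test functions. -/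
def tensor (φ : Test E) (ψ : Test E') : Test (E × E') where
  toFun z := φ z.1 * ψ z.2
  contDiff' := (φ.contDiff.comp contDiff_fst).mul (ψ.contDiff.comp contDiff_snd)
  hasCompactSupport' := by
    refine HasCompactSupport.of_support_subset_isCompact
      (IsCompact.prod φ.hasCompactSupport ψ.hasCompactSupport) ?_
    intro z hz
    exact ⟨subset_tsupport _ (left_ne_zero_of_mul hz), subset_tsupport _ (right_ne_zero_of_mul hz)⟩
  tsupport_subset' := fun _ _ => trivial

/-- `u` is microlocally smooth at `(z, ζ)`: for some cutoff `χ` with `χ z ≠ 0` the localized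
Fourier transform `ζ' ↦ u (χ e^{-i ⟨ζ', ·⟩})` is rapidly decreasing in a conic neighbourhood of
the covector `ζ`. -/
def MicrolocallySmoothAt (u : Distr E) (z : E) (ζ : E →L[ℝ] ℝ) : Prop :=
  ∃ χ : Test E, χ z ≠ 0 ∧ ∃ Γ ∈ 𝓝 ζ, (∀ ζ' ∈ Γ, ∀ r : ℝ, 0 < r → r • ζ' ∈ Γ) ∧
    ∀ N : ℕ, ∃ C : ℝ, ∀ ζ' ∈ Γ, (1 + ‖ζ'‖) ^ N * ‖u (modulate χ ζ')‖ ≤ C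

/-- The wavefront set of a distribution, a subset of the cotangent bundle minus its zero section. -/
def wavefrontSet (u : Distr E) : Set (E × (E →L[ℝ] ℝ)) :=
  {q | q.2 ≠ 0 ∧ ¬ MicrolocallySmoothAt u q.1 q.2}

end Distributions

/-! ### The operator `F` and the kernel of `F* F` -/

/-- The plane `X = ℝ²` of ground points. -/
abbrev Plane : Type := EuclideanSpace ℝ (Fin 2)

/-- The data space `Y = (0, ∞) × (0, ∞)` of pairs `(s, t)`. -/
def dataSpace : Set (ℝ × ℝ) := Ioi 0 ×ˢ Ioi 0

/-- The bistatic distance `R(s, x) = |γ_T(s) - x| + |x - γ_R(s)|`, with the transmitter at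
`γ_T(s) = (s, 0, h)` and the receiver at `γ_R(s) = (-s, 0, h)`. -/
def bistaticDist (h s : ℝ) (x : Plane) : ℝ :=
  √((x 0 - s) ^ 2 + x 1 ^ 2 + h ^ 2) + √((x 0 + s) ^ 2 + x 1 ^ 2 + h ^ 2)

/-- The amplitudes `a(s, t, x, w)` (`w` is the frequency variable), written `a ((s, t), x) w`,
after multiplication by the two cutoffs: smooth, supported in `(s, t)` in a compact subset of `Y`
(and extended by `0` outside `Y`), zero for `|t - 2 √(s² + h²)| < 20 ε² / h`, and symbols of order
`m + 1/2`. The mixed partial derivatives in `(s, t, x)` of total order `k` are bounded together,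
through the `k`-th Fréchet derivative of `∂_w^α a`. -/
structure IsAmplitude (h ε m : ℝ) (a : (ℝ × ℝ) × Plane → ℝ → ℂ) : Prop where
  smooth : ContDiff ℝ ∞ (fun q : ((ℝ × ℝ) × Plane) × ℝ => a q.1 q.2)
  symbol : ∀ (α k : ℕ) (L : Set ((ℝ × ℝ) × Plane)), IsCompact L → L ⊆ dataSpace ×ˢ univ →
    ∃ c : ℝ, ∀ z ∈ L, ∀ w : ℝ,
      ‖iteratedFDeriv ℝ k (fun z' => iteratedDeriv α (a z') w) z‖
        ≤ c * (1 + |w|) ^ (m + 1 / 2 - (α : ℝ))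
  support : ∃ L : Set (ℝ × ℝ), IsCompact L ∧ L ⊆ dataSpace ∧
    ∀ p, p ∉ L → ∀ x w, a (p, x) w = 0
  vanish : ∀ s t : ℝ, |t - 2 * √(s ^ 2 + h ^ 2)| < 20 * ε ^ 2 / h →
    ∀ x w, a ((s, t), x) w = 0

/-- The absolutely convergent integral
`∫∫ e^{-δ w²} e^{-i w (t - R(s, x))} a(s, t, x, w) V(x) dx dw` at `p = (s, t)`. -/
def regularizedF (h : ℝ) (a : (ℝ × ℝ) × Plane → ℝ → ℂ) (V : Test Plane) (p : ℝ × ℝ) (δ : ℝ) : ℂ :=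
  ∫ w : ℝ, ∫ x : Plane,
    Complex.exp ((-δ * w ^ 2 : ℝ) : ℂ) *
      Complex.exp (-Complex.I * ((w * (p.2 - bistaticDist h p.1 x) : ℝ) : ℂ)) * a (p, x) w * V x

/-- The operator `F V(s, t) = ∫ e^{-i w (t - R(s, x))} a(s, t, x, w) V(x) dx dw`, the integral
being an oscillatory integral: the limit as `δ → 0+` of the integrals regularized by the factor
`e^{-δ w²}`. -/
def opF (h : ℝ) (a : (ℝ × ℝ) × Plane → ℝ → ℂ) (V : Test Plane) (p : ℝ × ℝ) : ℂ :=
  limUnder (𝓝[>] (0 : ℝ)) (regularizedF h a V p)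

/-- `K` is the Schwartz kernel of `F* F`, where `F*` is the `L²` adjoint of `F`: for test functions
`U, V`,  `∫∫ K(x, y) V(y) conj (U x) dx dy = ⟨F* F V, U⟩_{L²(X)} = ⟨F V, F U⟩_{L²(Y)}`. -/
def IsNormalKernel (h : ℝ) (a : (ℝ × ℝ) × Plane → ℝ → ℂ) (K : Distr (Plane × Plane)) : Prop :=
  ∀ U V : Test Plane, K (tensor (conjTest U) V) =
    ∫ p in dataSpace, opF h a V p * (starRingEnd ℂ) (opF h a U p)

/-! ### The canonical relations -/

/-- `T*X`, with points `(x, ξ)`. -/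
abbrev Cot : Type := Plane × Plane

/-- The covector `(ξ, η)` on `X × X`, acting by `(x, y) ↦ ξ · x + η · y`. -/
def covector (ξ η : Plane) : (Plane × Plane) →L[ℝ] ℝ :=
  (innerSL ℝ ξ).coprod (innerSL ℝ η)

/-- The twisted wavefront set
`WF(K)' = {(x, ξ; y, η) : (x, y; ξ, -η) ∈ WF(K)} ⊆ T*X × T*X`. -/
def twistedWavefrontSet (K : Distr (Plane × Plane)) : Set (Cot × Cot) :=
  {q | ((q.1.1, q.2.1), covector q.1.2 (-q.2.2)) ∈ wavefrontSet K}

/-- `χ₁(x, ξ) = (x₁, -x₂, ξ₁, -ξ₂)`. -/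
def chi1 (q : Cot) : Cot := (!₂[q.1 0, -q.1 1], !₂[q.2 0, -q.2 1])

/-- `χ₂(x, ξ) = (-x₁, x₂, -ξ₁, ξ₂)`. -/
def chi2 (q : Cot) : Cot := (!₂[-q.1 0, q.1 1], !₂[-q.2 0, q.2 1])

/-- `χ₃ = χ₁ ∘ χ₂`. -/
def chi3 : Cot → Cot := chi1 ∘ chi2

/-- The graph `{(x, ξ; χ(x, ξ)) : ξ ≠ 0}` of a map `χ` on `T*X` minus its zero section. -/
def canonicalGraph (χ : Cot → Cot) : Set (Cot × Cot) := {q | q.1.2 ≠ 0 ∧ q.2 = χ q.1}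

/-- The diagonal `Δ` of `T*X × T*X` (off the zero section). -/
def relDelta : Set (Cot × Cot) := canonicalGraph id

/-- The graph `C₁` of `χ₁`. -/
def relC1 : Set (Cot × Cot) := canonicalGraph chi1

/-- The graph `C₂` of `χ₂`. -/
def relC2 : Set (Cot × Cot) := canonicalGraph chi2

/-- The graph `C₃` of `χ₃`. -/
def relC3 : Set (Cot × Cot) := canonicalGraph chi3

/-! ### Submanifolds, Lagrangians, clean intersections -/

section Submanifolds

variable {E : Type*} [NormedAddCommGroup E] [NormedSpace ℝ E]

/-- `M` is a smooth embedded `d`-dimensional submanifold of `E` (slice charts). -/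
def IsSubmanifold (d : ℕ) (M : Set E) : Prop :=
  ∀ p ∈ M, ∃ (φ : OpenPartialHomeomorph E E) (S : Submodule ℝ E),
    p ∈ φ.source ∧ ContDiffOn ℝ ∞ φ φ.source ∧ ContDiffOn ℝ ∞ φ.symm φ.target ∧
      Module.finrank ℝ S = d ∧ ∀ q ∈ φ.source, q ∈ M ↔ φ q ∈ S

/-- The tangent space of `M` at `p`: the velocities at `p` of smooth curves in `M`. -/
def tangentVectors (M : Set E) (p : E) : Set E :=
  {v | ∃ γ : ℝ → E, ContDiff ℝ ∞ γ ∧ γ 0 = p ∧ (∀ᶠ τ in 𝓝 (0 : ℝ), γ τ ∈ M) ∧ HasDerivAt γ v 0}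

/-- The submanifolds `M`, `N` (of equal dimension) intersect cleanly in codimension `k`: their
intersection is a submanifold, of codimension `k` in each of them, and
`T(M ∩ N) = TM ∩ TN` along it. -/
def IntersectCleanlyInCodim (k : ℕ) (M N : Set E) : Prop :=
  (M ∩ N).Nonempty ∧
    (∃ d : ℕ, IsSubmanifold (d + k) M ∧ IsSubmanifold (d + k) N ∧ IsSubmanifold d (M ∩ N)) ∧
    ∀ p ∈ M ∩ N, tangentVectors (M ∩ N) p = tangentVectors M p ∩ tangentVectors N p

end Submanifolds

/-- The canonical symplectic form `dξ ∧ dx` of `T*X`. -/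
def symplecticForm (u v : Cot) : ℝ := ⟪u.2, v.1⟫ - ⟪v.2, u.1⟫

/-- Lagrangian submanifolds of `T*X × T*X` for the difference of the symplectic forms of the two
factors: submanifolds of half the dimension, `4`, on which the form vanishes. -/
def IsLagrangian (M : Set (Cot × Cot)) : Prop :=
  IsSubmanifold 4 M ∧ ∀ p ∈ M, ∀ u ∈ tangentVectors M p, ∀ v ∈ tangentVectors M p,
    symplecticForm u.1 v.1 - symplecticForm u.2 v.2 = 0

end CommonMidpoint

end

open CommonMidpoint

/-!
The wavefront set of the kernel `K` of `F* F` is computed directly from its definition. For a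
product cutoff `χ = φ ⊗ ψ`, the localized Fourier transform of `K` at `ζ` is
`⟨F V, F U⟩` with `V = ψ e^{-i ζ(0, ·)}` and `conj U = φ e^{-i ζ(·, 0)}`, that is, an oscillatory
integral over `(s, t, w, y, w', x)` with phase
`Φ = -w (t - R(s, y)) + w' (t - R(s, x)) - ζ (x, y)` (`setIntegral_regularizedF`).

All integrations by parts are done with the fields `∂_s, ∂_t, ∂_x, ∂_y, w ∂_w, w' ∂_w'`. Since the
frequencies only occur through `w ∂_w` and `w' ∂_w'`, the amplitude and its derivatives keep the
same size, and the sum `N` of the squares of the derivatives of `Φ` is a polynomial, homogeneous of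
degree two, in `(w, w', ζ)`. The operator `(1 - i ∑ (X Φ) X) / (1 + N)` fixes `e^{i Φ}`, is smooth
everywhere, and its transpose gains a factor `(1 + |w| + |w'| + ‖ζ‖)⁻¹` wherever
`N ≥ c (w² + w'² + ‖ζ‖²)` (`IsNonstationary`, `exists_amplitude_gain`). Instead of iterated Fréchet
derivatives the estimates use symbols for a family of such fields (`IsSymbol`), a class closed under
products, inverses and differentiation. Parameters, including the regularization parameter `δ`, are
coordinates of one ambient space that no field differentiates.

By homogeneity and compactness, the lower bound for `N` near a point holds as soon as `N` has no
zero there (`exists_conic_neighbourhood`). At a zero, `w = w'`, `t = R(s, x) = R(s, y)`,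
`∂_s R(s, x) = ∂_s R(s, y)`, and `ζ` is given by the gradients of `R(s, ·)` at `x` and `y`. As the
support of the amplitude avoids the minimal travel time `R(s, 0)`, and the gradient of `R(s, ·)`
vanishes only at `0`, such a zero has `w ≠ 0`. Finally `R` and `∂_s R` determine the point up to
the signs of its two coordinates (`sq_eq_of_bistatic_eq`), and `R` is even in both, so that the
covectors are related by `Δ`, `C₁`, `C₂` or `C₃` (`mem_relations_of_critical`).

The same integration by parts in `(w, y)` alone turns the regularized integral defining `F V` into
an absolutely convergent one with a majorant independent of `δ`, whence the limit exists and is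
bounded (`regularizedF_bounded_and_converges`). The four relations are the intersections of an open
set with the graphs of linear maps, which gives the statements about Lagrangian submanifolds and
clean intersections (`canonical_relations_geometry`).
-/

noncomputable section

namespace CommonMidpoint

/-! ### Lagrangian graphs and clean intersections -/

section LinearSubmanifolds

variable {E : Type*} [NormedAddCommGroup E] [NormedSpace ℝ E]

theorem isSubmanifold_inter_submodule {U : Set E} (hU : IsOpen U) (S : Submodule ℝ E) {d : ℕ}
    (hd : Module.finrank ℝ S = d) : IsSubmanifold d (U ∩ S) := by
  rintro p ⟨hpU, -⟩
  refine ⟨OpenPartialHomeomorph.ofSet U hU, S, hpU, contDiffOn_id, contDiffOn_id, hd, ?_⟩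
  intro q hq
  exact ⟨fun h => h.2, fun h => ⟨hq, h⟩⟩

theorem tangentVectors_inter_submodule [FiniteDimensional ℝ E] {U : Set E} (hU : IsOpen U)
    (S : Submodule ℝ E) {p : E} (hp : p ∈ U ∩ S) : tangentVectors (U ∩ S) p = S := by
  ext v
  constructor
  · rintro ⟨γ, -, h0, hM, hd⟩
    have hcl : IsClosed (S : Set E) := S.closed_of_finiteDimensional
    refine hcl.mem_of_tendsto (hasDerivAt_iff_tendsto_slope.1 hd) ?_
    filter_upwards [hM.filter_mono nhdsWithin_le_nhds] with τ hτ
    rw [slope_def_module, h0]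
    exact S.smul_mem _ (S.sub_mem hτ.2 hp.2)
  · intro hv
    have hγ : ContDiff ℝ ∞ (fun τ : ℝ => p + τ • v) :=
      contDiff_const.add (contDiff_id.smul contDiff_const)
    refine ⟨fun τ => p + τ • v, hγ, by simp, ?_, ?_⟩
    · have : ∀ᶠ τ : ℝ in 𝓝 0, p + τ • v ∈ U :=
        hγ.continuous.continuousAt.eventually_mem (by simpa using hU.mem_nhds hp.1)
      filter_upwards [this] with τ hτ
      exact ⟨hτ, S.add_mem hp.2 (S.smul_mem _ hv)⟩
    · simpa using ((hasDerivAt_id (0 : ℝ)).smul_const v).const_add p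

theorem intersectCleanly_inter_submodule [FiniteDimensional ℝ E] {U : Set E} (hU : IsOpen U)
    (S T : Submodule ℝ E) {d k : ℕ} (hS : Module.finrank ℝ S = d + k)
    (hT : Module.finrank ℝ T = d + k) (hST : Module.finrank ℝ (S ⊓ T : Submodule ℝ E) = d)
    (hne : ((U ∩ S) ∩ (U ∩ T)).Nonempty) :
    IntersectCleanlyInCodim k (U ∩ S) (U ∩ T) := by
  have hinter : (U ∩ S) ∩ (U ∩ T) = U ∩ ((S ⊓ T : Submodule ℝ E) : Set E) := by
    rw [Submodule.coe_inf]; ext q; simp only [mem_inter_iff]; tauto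
  refine ⟨hne, ⟨d, isSubmanifold_inter_submodule hU S hS, isSubmanifold_inter_submodule hU T hT,
    ?_⟩, ?_⟩
  · rw [hinter]; exact isSubmanifold_inter_submodule hU _ hST
  · rintro p ⟨hpS, hpT⟩
    rw [hinter, tangentVectors_inter_submodule hU S hpS, tangentVectors_inter_submodule hU T hpT,
      tangentVectors_inter_submodule hU (S ⊓ T) ⟨hpS.1, hpS.2, hpT.2⟩, Submodule.coe_inf]

end LinearSubmanifolds

/-- The diagonal map `x ↦ (σ x₁, τ x₂)` of the plane. -/
def diagMap (σ τ : ℝ) : Plane →ₗ[ℝ] Plane where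
  toFun x := !₂[σ * x 0, τ * x 1]
  map_add' x y := by ext i; fin_cases i <;> simp [mul_add]
  map_smul' c x := by ext i; fin_cases i <;> simp [mul_left_comm]

/-- The action of `diagMap σ τ` on both components of `T*X`; for signs `σ, τ` these are the
identity and the maps `χ₁, χ₂, χ₃`. -/
def signMap (σ τ : ℝ) : Cot →ₗ[ℝ] Cot := (diagMap σ τ).prodMap (diagMap σ τ)

theorem signMap_apply (σ τ : ℝ) (q : Cot) :
    signMap σ τ q = (!₂[σ * q.1 0, τ * q.1 1], !₂[σ * q.2 0, τ * q.2 1]) := rfl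

theorem id_eq_signMap : (id : Cot → Cot) = signMap 1 1 := by
  funext q
  rw [signMap_apply]
  ext i <;> fin_cases i <;> simp

theorem chi1_eq_signMap : chi1 = signMap 1 (-1) := by
  funext q
  rw [signMap_apply]
  ext i <;> fin_cases i <;> simp [chi1]

theorem chi2_eq_signMap : chi2 = signMap (-1) 1 := by
  funext q
  rw [signMap_apply]
  ext i <;> fin_cases i <;> simp [chi2]

theorem chi3_eq_signMap : chi3 = signMap (-1) (-1) := by
  funext q
  rw [signMap_apply]
  ext i <;> fin_cases i <;> simp [chi3, chi1, chi2]

/-- The pairs of points of `T*X` the first of which has nonzero covector. -/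
def nonzeroCovector : Set (Cot × Cot) := {q | q.1.2 ≠ 0}

theorem isOpen_nonzeroCovector : IsOpen nonzeroCovector :=
  isOpen_ne_fun (by fun_prop) continuous_const

theorem canonicalGraph_signMap (σ τ : ℝ) :
    canonicalGraph (signMap σ τ) = nonzeroCovector ∩ ((signMap σ τ).graph : Set (Cot × Cot)) := by
  ext q
  simp [canonicalGraph, nonzeroCovector, LinearMap.mem_graph_iff]

theorem finrank_graph_signMap (σ τ : ℝ) : Module.finrank ℝ (signMap σ τ).graph = 4 := by
  rw [LinearMap.graph_eq_range_prod, LinearMap.finrank_range_of_inj]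
  · simp
  · intro x y hxy
    exact congrArg Prod.fst hxy

theorem isLagrangian_signMap {σ τ : ℝ} (hσ : σ ^ 2 = 1) (hτ : τ ^ 2 = 1) :
    IsLagrangian (canonicalGraph (signMap σ τ)) := by
  rw [canonicalGraph_signMap]
  refine ⟨isSubmanifold_inter_submodule isOpen_nonzeroCovector _ (finrank_graph_signMap σ τ), ?_⟩
  intro p hp u hu v hv
  rw [tangentVectors_inter_submodule isOpen_nonzeroCovector _ hp] at hu hv
  have hu' : u.2 = signMap σ τ u.1 := hu
  have hv' : v.2 = signMap σ τ v.1 := hv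
  rw [hu', hv', signMap_apply, signMap_apply]
  simp only [symplecticForm, PiLp.inner_apply, Fin.sum_univ_two, RCLike.inner_apply, conj_trivial]
  simp only [Fin.isValue, Matrix.cons_val_zero, Matrix.cons_val_one]
  linear_combination (-(v.1.1 0 * u.1.2 0) + u.1.1 0 * v.1.2 0) * hσ +
    (-(v.1.1 1 * u.1.2 1) + u.1.1 1 * v.1.2 1) * hτ

/-- The embedding of `{x, ξ ∈ span e}` into the graph of `signMap σ τ`. -/
def axisGraphMap (σ τ : ℝ) (e : Plane) : (ℝ × ℝ) →ₗ[ℝ] Cot × Cot :=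
  (LinearMap.id.prod (signMap σ τ)) ∘ₗ
    ((LinearMap.toSpanSingleton ℝ Plane e).prodMap (LinearMap.toSpanSingleton ℝ Plane e))

theorem axisGraphMap_apply (σ τ : ℝ) (e : Plane) (u : ℝ × ℝ) :
    axisGraphMap σ τ e u = ((u.1 • e, u.2 • e), signMap σ τ (u.1 • e, u.2 • e)) := rfl

theorem finrank_range_axisGraphMap (σ τ : ℝ) {e : Plane} (he : e ≠ 0) :
    Module.finrank ℝ (LinearMap.range (axisGraphMap σ τ e)) = 2 := by
  rw [LinearMap.finrank_range_of_inj]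
  · simp
  · intro u v huv
    rw [axisGraphMap_apply, axisGraphMap_apply] at huv
    have h1 := congrArg Prod.fst huv
    simp only [Prod.mk.injEq] at h1
    exact Prod.ext (smul_left_injective ℝ he h1.1) (smul_left_injective ℝ he h1.2)

theorem graph_inf_graph_eq_range {σ τ σ' τ' : ℝ} {e : Plane}
    (h1 : ∀ t : ℝ, diagMap σ τ (t • e) = diagMap σ' τ' (t • e))
    (h2 : ∀ x, diagMap σ τ x = diagMap σ' τ' x → ∃ t : ℝ, x = t • e) :
    (signMap σ τ).graph ⊓ (signMap σ' τ').graph = LinearMap.range (axisGraphMap σ τ e) := by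
  ext q
  simp only [Submodule.mem_inf, LinearMap.mem_graph_iff, LinearMap.mem_range, axisGraphMap_apply]
  constructor
  · rintro ⟨hq, hq'⟩
    have h3 : signMap σ τ q.1 = signMap σ' τ' q.1 := hq.symm.trans hq'
    obtain ⟨u, hu⟩ := h2 q.1.1 (congrArg Prod.fst h3)
    obtain ⟨v, hv⟩ := h2 q.1.2 (congrArg Prod.snd h3)
    refine ⟨(u, v), ?_⟩
    have : q.1 = (u • e, v • e) := Prod.ext hu hv
    exact Prod.ext this.symm (by rw [hq, this])
  · rintro ⟨u, rfl⟩
    exact ⟨rfl, Prod.ext (h1 _) (h1 _)⟩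

theorem intersectCleanly_signMap {σ τ σ' τ' : ℝ} {e : Plane} (he : e ≠ 0)
    (h1 : ∀ t : ℝ, diagMap σ τ (t • e) = diagMap σ' τ' (t • e))
    (h2 : ∀ x, diagMap σ τ x = diagMap σ' τ' x → ∃ t : ℝ, x = t • e) :
    IntersectCleanlyInCodim 2 (canonicalGraph (signMap σ τ)) (canonicalGraph (signMap σ' τ')) := by
  have hinf := graph_inf_graph_eq_range h1 h2
  have h3 : diagMap σ τ e = diagMap σ' τ' e := by simpa using h1 1
  have hne : (canonicalGraph (signMap σ τ) ∩ canonicalGraph (signMap σ' τ')).Nonempty :=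
    ⟨((e, e), signMap σ τ (e, e)), ⟨he, rfl⟩, he,
      Prod.ext h3 h3⟩
  rw [canonicalGraph_signMap, canonicalGraph_signMap] at hne ⊢
  refine intersectCleanly_inter_submodule (d := 2) isOpen_nonzeroCovector _ _
    (finrank_graph_signMap _ _) (finrank_graph_signMap _ _) ?_ hne
  rw [hinf, finrank_range_axisGraphMap σ τ he]

theorem intersectCleanly_signMap_snd (σ : ℝ) {τ τ' : ℝ} (hτ : τ ≠ τ') :
    IntersectCleanlyInCodim 2 (canonicalGraph (signMap σ τ)) (canonicalGraph (signMap σ τ')) := by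
  refine intersectCleanly_signMap (e := !₂[1, 0]) ?_ ?_ ?_
  · intro h; simpa using congrArg (fun x : Plane => x 0) h
  · intro t; ext i; fin_cases i <;> simp [diagMap]
  · intro x hx
    have h1 : τ * x 1 = τ' * x 1 := congrArg (fun x : Plane => x 1) hx
    have h2 : x 1 = 0 := by
      by_contra h
      exact hτ (mul_right_cancel₀ h h1)
    exact ⟨x 0, by ext i; fin_cases i <;> simp [h2]⟩

theorem intersectCleanly_signMap_fst {σ σ' : ℝ} (τ : ℝ) (hσ : σ ≠ σ') :
    IntersectCleanlyInCodim 2 (canonicalGraph (signMap σ τ)) (canonicalGraph (signMap σ' τ)) := by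
  refine intersectCleanly_signMap (e := !₂[0, 1]) ?_ ?_ ?_
  · intro h; simpa using congrArg (fun x : Plane => x 1) h
  · intro t; ext i; fin_cases i <;> simp [diagMap]
  · intro x hx
    have h1 : σ * x 0 = σ' * x 0 := congrArg (fun x : Plane => x 0) hx
    have h2 : x 0 = 0 := by
      by_contra h
      exact hσ (mul_right_cancel₀ h h1)
    exact ⟨x 1, by ext i; fin_cases i <;> simp [h2]⟩

theorem signMap_graph_disjoint {σ τ σ' τ' : ℝ} (hσ : σ ≠ σ') (hτ : τ ≠ τ') :
    canonicalGraph (signMap σ τ) ∩ canonicalGraph (signMap σ' τ') = ∅ := by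
  rw [eq_empty_iff_forall_notMem]
  rintro q ⟨⟨hq, h1⟩, -, h2⟩
  have h3 : signMap σ τ q.1 = signMap σ' τ' q.1 := h1.symm.trans h2
  have h4 : diagMap σ τ q.1.2 = diagMap σ' τ' q.1.2 := congrArg Prod.snd h3
  have h5 : σ * q.1.2 0 = σ' * q.1.2 0 := congrArg (fun x : Plane => x 0) h4
  have h6 : τ * q.1.2 1 = τ' * q.1.2 1 := congrArg (fun x : Plane => x 1) h4
  apply hq
  ext i
  fin_cases i
  · by_contra h
    exact hσ (mul_right_cancel₀ h h5)
  · by_contra h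
    exact hτ (mul_right_cancel₀ h h6)

theorem canonical_relations_geometry :
    (IsLagrangian relDelta ∧ IsLagrangian relC1 ∧ IsLagrangian relC2 ∧ IsLagrangian relC3) ∧
    (IntersectCleanlyInCodim 2 relDelta relC1 ∧ IntersectCleanlyInCodim 2 relDelta relC2 ∧
      IntersectCleanlyInCodim 2 relC1 relC3 ∧ IntersectCleanlyInCodim 2 relC2 relC3) ∧
    (relDelta ∩ relC3 = ∅ ∧ relC1 ∩ relC2 = ∅) := by
  rw [relDelta, relC1, relC2, relC3, id_eq_signMap, chi1_eq_signMap, chi2_eq_signMap,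
    chi3_eq_signMap]
  have h : (1 : ℝ) ≠ -1 := by norm_num
  refine ⟨⟨isLagrangian_signMap ?_ ?_, isLagrangian_signMap ?_ ?_, isLagrangian_signMap ?_ ?_,
    isLagrangian_signMap ?_ ?_⟩, ⟨intersectCleanly_signMap_snd _ h,
    intersectCleanly_signMap_fst _ h, intersectCleanly_signMap_fst _ h,
    intersectCleanly_signMap_snd _ h⟩, signMap_graph_disjoint h h, signMap_graph_disjoint h h.symm⟩
    <;> norm_num

/-! ### Symbols with respect to a family of weighted derivatives -/

section Symbols

/-- A vector field `wt • dir` with constant direction and constant divergence, such as `∂_v`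
(`wt = 1`) or `w ∂_w`. -/
structure WeightedField (E : Type*) [NormedAddCommGroup E] [NormedSpace ℝ E] where
  dir : E
  wt : E → ℝ
  wt_smooth : ContDiff ℝ ∞ wt
  div : ℝ
  fderiv_wt : ∀ z, fderiv ℝ wt z dir = div

variable {E : Type*} [NormedAddCommGroup E] [NormedSpace ℝ E]

/-- The derivative of a function along a weighted field. -/
def WeightedField.deriv (X : WeightedField E) (f : E → ℂ) : E → ℂ :=
  fun z => (X.wt z : ℂ) * fderiv ℝ f z X.dir

namespace WeightedField

variable (X : WeightedField E) {f g : E → ℂ}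

theorem deriv_smooth (hf : ContDiff ℝ ∞ f) : ContDiff ℝ ∞ (X.deriv f) := by
  have h1 : ContDiff ℝ ∞ (fun z => fderiv ℝ f z X.dir) :=
    (hf.fderiv_right (m := ∞) (by simp)).clm_apply contDiff_const
  exact (Complex.ofRealCLM.contDiff.comp X.wt_smooth).mul h1

theorem deriv_add (hf : ContDiff ℝ ∞ f) (hg : ContDiff ℝ ∞ g) :
    X.deriv (fun z => f z + g z) = fun z => X.deriv f z + X.deriv g z := by
  funext z
  have h1 := (hf.differentiable (by simp)) z
  have h2 := (hg.differentiable (by simp)) z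
  simp only [deriv, fderiv_fun_add h1 h2, add_apply, mul_add]

theorem deriv_mul (hf : ContDiff ℝ ∞ f) (hg : ContDiff ℝ ∞ g) :
    X.deriv (fun z => f z * g z) = fun z => f z * X.deriv g z + X.deriv f z * g z := by
  funext z
  have h1 := (hf.differentiable (by simp)) z
  have h2 := (hg.differentiable (by simp)) z
  simp only [deriv, fderiv_fun_mul h1 h2, add_apply,
    smul_apply, smul_eq_mul]
  ring

theorem deriv_const (c : ℂ) : X.deriv (fun _ => c) = fun _ => 0 := by
  funext z
  simp [deriv]

theorem deriv_const_mul (c : ℂ) (hf : ContDiff ℝ ∞ f) :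
    X.deriv (fun z => c * f z) = fun z => c * X.deriv f z := by
  rw [X.deriv_mul contDiff_const hf, X.deriv_const]
  simp

theorem deriv_inv (hf : ContDiff ℝ ∞ f) (h0 : ∀ z, f z ≠ 0) :
    X.deriv (fun z => (f z)⁻¹) = fun z => -1 * (X.deriv f z * ((f z)⁻¹ * (f z)⁻¹)) := by
  have hi : ContDiff ℝ ∞ (fun z => (f z)⁻¹) := hf.inv h0
  have h1 := X.deriv_mul hf hi
  have h2 : (fun z => f z * (f z)⁻¹) = fun _ => (1 : ℂ) := by
    funext z
    exact mul_inv_cancel₀ (h0 z)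
  rw [h2, X.deriv_const] at h1
  funext z
  have h3 := congrFun h1 z
  have h4 := h0 z
  field_simp at h3 ⊢
  linear_combination -h3

theorem deriv_conj (hf : ContDiff ℝ ∞ f) :
    X.deriv (fun z => (starRingEnd ℂ) (f z)) = fun z => (starRingEnd ℂ) (X.deriv f z) := by
  funext z
  have h1 := ((hf.differentiable (by simp)) z).hasFDerivAt
  have h2 : HasFDerivAt (fun z => (starRingEnd ℂ) (f z))
      ((Complex.conjCLE : ℂ →L[ℝ] ℂ).comp (fderiv ℝ f z)) z :=
    (Complex.conjCLE : ℂ →L[ℝ] ℂ).hasFDerivAt.comp z h1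
  simp [deriv, h2.fderiv]

theorem deriv_ofReal {φ : E → ℝ} (hφ : ContDiff ℝ ∞ φ) :
    X.deriv (fun z => (φ z : ℂ)) = fun z => ((X.wt z * fderiv ℝ φ z X.dir : ℝ) : ℂ) := by
  funext z
  have h1 := ((hφ.differentiable (by simp)) z).hasFDerivAt
  have h2 : HasFDerivAt (fun z => (φ z : ℂ)) (Complex.ofRealCLM.comp (fderiv ℝ φ z)) z :=
    Complex.ofRealCLM.hasFDerivAt.comp z h1
  simp [deriv, h2.fderiv]

theorem deriv_cexp (hf : ContDiff ℝ ∞ f) :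
    X.deriv (fun z => Complex.exp (f z)) = fun z => Complex.exp (f z) * X.deriv f z := by
  funext z
  have h1 := ((hf.differentiable (by simp)) z).hasFDerivAt.cexp
  simp only [deriv, h1.fderiv, smul_apply, smul_eq_mul]
  ring

theorem support_deriv_subset {W : Set E} (hW : IsClosed W) (h : Function.support f ⊆ W) :
    Function.support (X.deriv f) ⊆ W := by
  intro z hz
  have h1 : fderiv ℝ f z ≠ 0 := fun h0 => hz (by simp [deriv, h0])
  exact closure_minimal h hW (support_fderiv_subset ℝ h1)

end WeightedField

variable {ι : Type*} (X : ι → WeightedField E) (Z : Set E) (ρ : E → ℝ)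

/-- All derivatives of `f` of order at most `n` along the fields `X i` are `O(ρ)` on `Z`. -/
def SymbolBound : ℕ → (E → ℂ) → Prop
  | 0, f => ∃ C : ℝ, ∀ z ∈ Z, ‖f z‖ ≤ C * ρ z
  | n + 1, f => (∃ C : ℝ, ∀ z ∈ Z, ‖f z‖ ≤ C * ρ z) ∧ ∀ i, SymbolBound n ((X i).deriv f)

/-- `f` is smooth, and all its iterated derivatives along the fields `X i` are `O(ρ)` on `Z`. The
bounds are only required at the points of `Z`, which need not be open. -/
structure IsSymbol (f : E → ℂ) : Prop where
  smooth : ContDiff ℝ ∞ f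
  bound : ∀ n, SymbolBound X Z ρ n f

variable {X Z ρ} {Z' : Set E} {ρ' : E → ℝ} {f g : E → ℂ} {n : ℕ}

theorem SymbolBound.of_succ (h : SymbolBound X Z ρ (n + 1) f) : SymbolBound X Z ρ n f := by
  induction n generalizing f with
  | zero => exact h.1
  | succ n ih => exact ⟨h.1, fun i => ih (h.2 i)⟩

theorem SymbolBound.mono (h : SymbolBound X Z ρ n f) (hZ : Z' ⊆ Z) {K : ℝ}
    (hρ : ∀ z ∈ Z', 0 ≤ ρ z ∧ ρ z ≤ K * ρ' z) : SymbolBound X Z' ρ' n f := by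
  have base : ∀ {f : E → ℂ}, (∃ C : ℝ, ∀ z ∈ Z, ‖f z‖ ≤ C * ρ z) →
      ∃ C : ℝ, ∀ z ∈ Z', ‖f z‖ ≤ C * ρ' z := by
    rintro f ⟨C, hC⟩
    refine ⟨|C| * K, fun z hz => (hC z (hZ hz)).trans ?_⟩
    calc C * ρ z ≤ |C| * ρ z := mul_le_mul_of_nonneg_right (le_abs_self C) (hρ z hz).1
      _ ≤ |C| * (K * ρ' z) := mul_le_mul_of_nonneg_left (hρ z hz).2 (abs_nonneg C)
      _ = |C| * K * ρ' z := by ring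
  induction n generalizing f with
  | zero => exact base h
  | succ n ih => exact ⟨base h.1, fun i => ih (h.2 i)⟩

theorem SymbolBound.add (hf : ContDiff ℝ ∞ f) (hg : ContDiff ℝ ∞ g)
    (h : SymbolBound X Z ρ n f) (h' : SymbolBound X Z ρ n g) :
    SymbolBound X Z ρ n (fun z => f z + g z) := by
  have base : ∀ {f g : E → ℂ}, (∃ C : ℝ, ∀ z ∈ Z, ‖f z‖ ≤ C * ρ z) →
      (∃ C : ℝ, ∀ z ∈ Z, ‖g z‖ ≤ C * ρ z) → ∃ C : ℝ, ∀ z ∈ Z, ‖f z + g z‖ ≤ C * ρ z := by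
    rintro f g ⟨C, hC⟩ ⟨C', hC'⟩
    refine ⟨C + C', fun z hz => (norm_add_le _ _).trans ?_⟩
    rw [add_mul]
    exact add_le_add (hC z hz) (hC' z hz)
  induction n generalizing f g with
  | zero => exact base h h'
  | succ n ih =>
    refine ⟨base h.1 h'.1, fun i => ?_⟩
    rw [(X i).deriv_add hf hg]
    exact ih ((X i).deriv_smooth hf) ((X i).deriv_smooth hg) (h.2 i) (h'.2 i)

theorem SymbolBound.mul (hf : ContDiff ℝ ∞ f) (hg : ContDiff ℝ ∞ g)
    (h : SymbolBound X Z ρ n f) (h' : SymbolBound X Z ρ' n g) :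
    SymbolBound X Z (fun z => ρ z * ρ' z) n (fun z => f z * g z) := by
  have base : ∀ {f g : E → ℂ}, (∃ C : ℝ, ∀ z ∈ Z, ‖f z‖ ≤ C * ρ z) →
      (∃ C : ℝ, ∀ z ∈ Z, ‖g z‖ ≤ C * ρ' z) →
      ∃ C : ℝ, ∀ z ∈ Z, ‖f z * g z‖ ≤ C * (ρ z * ρ' z) := by
    rintro f g ⟨C, hC⟩ ⟨C', hC'⟩
    refine ⟨C * C', fun z hz => ?_⟩
    rw [norm_mul]
    calc ‖f z‖ * ‖g z‖ ≤ (C * ρ z) * (C' * ρ' z) :=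
          mul_le_mul (hC z hz) (hC' z hz) (norm_nonneg _) ((norm_nonneg _).trans (hC z hz))
      _ = C * C' * (ρ z * ρ' z) := by ring
  induction n generalizing f g with
  | zero => exact base h h'
  | succ n ih =>
    refine ⟨base h.1 h'.1, fun i => ?_⟩
    rw [(X i).deriv_mul hf hg]
    exact SymbolBound.add (hf.mul ((X i).deriv_smooth hg)) (((X i).deriv_smooth hf).mul hg)
      (ih hf ((X i).deriv_smooth hg) h.of_succ (h'.2 i))
      (ih ((X i).deriv_smooth hf) hg (h.2 i) h'.of_succ)

theorem SymbolBound.const_mul (c : ℂ) (hf : ContDiff ℝ ∞ f) (h : SymbolBound X Z ρ n f) :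
    SymbolBound X Z ρ n (fun z => c * f z) := by
  have base : ∀ {f : E → ℂ}, (∃ C : ℝ, ∀ z ∈ Z, ‖f z‖ ≤ C * ρ z) →
      ∃ C : ℝ, ∀ z ∈ Z, ‖c * f z‖ ≤ C * ρ z := by
    rintro f ⟨C, hC⟩
    refine ⟨‖c‖ * C, fun z hz => ?_⟩
    rw [norm_mul, mul_assoc]
    exact mul_le_mul_of_nonneg_left (hC z hz) (norm_nonneg c)
  induction n generalizing f with
  | zero => exact base h
  | succ n ih =>
    refine ⟨base h.1, fun i => ?_⟩
    rw [(X i).deriv_const_mul c hf]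
    exact ih ((X i).deriv_smooth hf) (h.2 i)

theorem SymbolBound.inv (hf : ContDiff ℝ ∞ f) (h0 : ∀ z, f z ≠ 0) (hρ : ∀ z ∈ Z, 0 < ρ z)
    {c : ℝ} (hc : 0 < c) (hlow : ∀ z ∈ Z, c * ρ z ≤ ‖f z‖) (h : SymbolBound X Z ρ n f) :
    SymbolBound X Z (fun z => (ρ z)⁻¹) n (fun z => (f z)⁻¹) := by
  have base : ∃ C : ℝ, ∀ z ∈ Z, ‖(f z)⁻¹‖ ≤ C * (ρ z)⁻¹ := by
    refine ⟨c⁻¹, fun z hz => ?_⟩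
    rw [norm_inv, ← mul_inv]
    exact inv_anti₀ (mul_pos hc (hρ z hz)) (hlow z hz)
  induction n with
  | zero => exact base
  | succ n ih =>
    refine ⟨base, fun i => ?_⟩
    rw [(X i).deriv_inv hf h0]
    have hi : ContDiff ℝ ∞ (fun z => (f z)⁻¹) := hf.inv h0
    have hin := ih h.of_succ
    have := ((h.2 i).mul ((X i).deriv_smooth hf) (hi.mul hi) (hin.mul hi hi hin)).const_mul (-1)
      (((X i).deriv_smooth hf).mul (hi.mul hi))
    refine this.mono subset_rfl (K := 1) fun z hz => ?_
    have := hρ z hz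
    refine ⟨by positivity, le_of_eq ?_⟩
    field_simp

theorem SymbolBound.conj (hf : ContDiff ℝ ∞ f) (h : SymbolBound X Z ρ n f) :
    SymbolBound X Z ρ n (fun z => (starRingEnd ℂ) (f z)) := by
  induction n generalizing f with
  | zero => simpa [SymbolBound] using h
  | succ n ih =>
    refine ⟨by simpa using h.1, fun i => ?_⟩
    rw [(X i).deriv_conj hf]
    exact ih ((X i).deriv_smooth hf) (h.2 i)

theorem SymbolBound.zero : SymbolBound X Z ρ n (fun _ => 0) := by
  induction n with
  | zero => exact ⟨0, by simp⟩
  | succ n ih => exact ⟨⟨0, by simp⟩, fun i => by rwa [(X i).deriv_const]⟩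

namespace IsSymbol

theorem exists_bound (h : IsSymbol X Z ρ f) : ∃ C : ℝ, ∀ z ∈ Z, ‖f z‖ ≤ C * ρ z := h.bound 0

theorem deriv (h : IsSymbol X Z ρ f) (i : ι) : IsSymbol X Z ρ ((X i).deriv f) :=
  ⟨(X i).deriv_smooth h.smooth, fun n => (h.bound (n + 1)).2 i⟩

theorem mono (h : IsSymbol X Z ρ f) (hZ : Z' ⊆ Z) {K : ℝ}
    (hρ : ∀ z ∈ Z', 0 ≤ ρ z ∧ ρ z ≤ K * ρ' z) : IsSymbol X Z' ρ' f :=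
  ⟨h.smooth, fun n => (h.bound n).mono hZ hρ⟩

theorem mono_set (h : IsSymbol X Z ρ f) (hZ : Z' ⊆ Z) (hρ : ∀ z, 0 ≤ ρ z) :
    IsSymbol X Z' ρ f :=
  h.mono hZ (K := 1) fun z _ => ⟨hρ z, by simp⟩

theorem add (h : IsSymbol X Z ρ f) (h' : IsSymbol X Z ρ g) :
    IsSymbol X Z ρ (fun z => f z + g z) :=
  ⟨h.smooth.add h'.smooth, fun n => (h.bound n).add h.smooth h'.smooth (h'.bound n)⟩

theorem mul (h : IsSymbol X Z ρ f) (h' : IsSymbol X Z ρ' g) :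
    IsSymbol X Z (fun z => ρ z * ρ' z) (fun z => f z * g z) :=
  ⟨h.smooth.mul h'.smooth, fun n => (h.bound n).mul h.smooth h'.smooth (h'.bound n)⟩

theorem const_mul (c : ℂ) (h : IsSymbol X Z ρ f) : IsSymbol X Z ρ (fun z => c * f z) :=
  ⟨contDiff_const.mul h.smooth, fun n => (h.bound n).const_mul c h.smooth⟩

theorem neg (h : IsSymbol X Z ρ f) : IsSymbol X Z ρ (fun z => -f z) := by
  simpa using h.const_mul (-1)

theorem sub (h : IsSymbol X Z ρ f) (h' : IsSymbol X Z ρ g) :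
    IsSymbol X Z ρ (fun z => f z - g z) := by
  simpa [sub_eq_add_neg] using h.add h'.neg

theorem zero : IsSymbol X Z ρ (fun _ => 0) := ⟨contDiff_const, fun _ => SymbolBound.zero⟩

theorem sum {κ : Type*} (s : Finset κ) {F : κ → E → ℂ} (h : ∀ i ∈ s, IsSymbol X Z ρ (F i)) :
    IsSymbol X Z ρ (fun z => ∑ i ∈ s, F i z) := by
  classical
  induction s using Finset.induction_on with
  | empty => simpa using zero
  | insert i s hi ih =>
    simp only [Finset.sum_insert hi]
    exact (h i (Finset.mem_insert_self i s)).add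
      (ih fun j hj => h j (Finset.mem_insert_of_mem hj))

theorem inv (h : IsSymbol X Z ρ f) (h0 : ∀ z, f z ≠ 0) (hρ : ∀ z ∈ Z, 0 < ρ z)
    {c : ℝ} (hc : 0 < c) (hlow : ∀ z ∈ Z, c * ρ z ≤ ‖f z‖) :
    IsSymbol X Z (fun z => (ρ z)⁻¹) (fun z => (f z)⁻¹) :=
  ⟨h.smooth.inv h0, fun n => (h.bound n).inv h.smooth h0 hρ hc hlow⟩

theorem conj (h : IsSymbol X Z ρ f) : IsSymbol X Z ρ (fun z => (starRingEnd ℂ) (f z)) :=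
  ⟨Complex.conjCLE.contDiff.comp h.smooth, fun n => (h.bound n).conj h.smooth⟩

/-- A family of functions that is bounded by `ρ` and whose derivatives are finite linear
combinations of members of the family consists of symbols. -/
theorem of_family {κ : Type*} {F : κ → E → ℂ} (hs : ∀ k, ContDiff ℝ ∞ (F k))
    (hb : ∀ k, ∃ C : ℝ, ∀ z ∈ Z, ‖F k z‖ ≤ C * ρ z)
    (hd : ∀ k i, ∃ (c₁ c₂ : ℂ) (k₁ k₂ : κ),
      (X i).deriv (F k) = fun z => c₁ * F k₁ z + c₂ * F k₂ z) (k : κ) :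
    IsSymbol X Z ρ (F k) := by
  refine ⟨hs k, fun n => ?_⟩
  induction n generalizing k with
  | zero => exact hb k
  | succ n ih =>
    refine ⟨hb k, fun i => ?_⟩
    obtain ⟨c₁, c₂, k₁, k₂, h⟩ := hd k i
    rw [h]
    exact ((ih k₁).const_mul c₁ (hs k₁)).add (contDiff_const.mul (hs k₁))
      (contDiff_const.mul (hs k₂)) ((ih k₂).const_mul c₂ (hs k₂))

theorem const (c : ℂ) : IsSymbol X Z (fun _ => 1) (fun _ => c) :=
  ⟨contDiff_const, fun n => by
    cases n with
    | zero => exact ⟨‖c‖, by simp⟩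
    | succ n => exact ⟨⟨‖c‖, by simp⟩, fun i => by
        rw [(X i).deriv_const]
        exact SymbolBound.zero⟩⟩

end IsSymbol

end Symbols

/-! ### Integration by parts away from the critical points of a phase -/

section NonstationaryPhase

variable {E : Type*} [NormedAddCommGroup E] [NormedSpace ℝ E]

/-- The derivative of a real phase along a weighted field. -/
def WeightedField.phaseDeriv (X : WeightedField E) (Φ : E → ℝ) (z : E) : ℝ :=
  X.wt z * fderiv ℝ Φ z X.dir

variable {ι : Type*} (X : ι → WeightedField E) (S : Finset ι)

/-- The sum of the squares of the derivatives of the phase along the fields in `S`, plus one. -/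
def phaseWeight (Φ : E → ℝ) (z : E) : ℝ := 1 + ∑ i ∈ S, (X i).phaseDeriv Φ z ^ 2

theorem phaseWeight_pos (Φ : E → ℝ) (z : E) : 0 < phaseWeight X S Φ z := by
  have : 0 ≤ ∑ i ∈ S, (X i).phaseDeriv Φ z ^ 2 := Finset.sum_nonneg fun i _ => sq_nonneg _
  unfold phaseWeight
  linarith

/-- The hypotheses on a phase `Φ` under which integration by parts along the fields in `S` gains a
factor `Λ⁻¹`: on `Z`, its derivatives are symbols of size `Λ`, and the sum of their squares plus
one is at least `c Λ²`. -/
structure IsNonstationary (Λ : E → ℝ) (Z : Set E) (Φ : E → ℝ) : Prop where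
  smooth : ContDiff ℝ ∞ Φ
  one_le : ∀ z, 1 ≤ Λ z
  wt_le : ∀ i ∈ S, ∀ z, |(X i).wt z| ≤ Λ z
  symbol : ∀ i ∈ S, IsSymbol X Z Λ (fun z => (((X i).phaseDeriv Φ z : ℝ) : ℂ))
  lower : ∃ c : ℝ, 0 < c ∧ ∀ z ∈ Z, c * Λ z ^ 2 ≤ phaseWeight X S Φ z

/-- The coefficient `(X i Φ) A / (1 + ∑ (X i Φ)²)` in the transposed operator. -/
def phaseCoeff (Φ : E → ℝ) (A : E → ℂ) (i : ι) (z : E) : ℂ :=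
  ((phaseWeight X S Φ z : ℝ) : ℂ)⁻¹ * (((X i).phaseDeriv Φ z : ℝ) : ℂ) * A z

/-- The amplitude obtained by one integration by parts with the operator
`(1 - i ∑ (X i Φ) X i) / (1 + ∑ (X i Φ)²)`, which fixes `exp (i Φ)`. Adding `1` to the sum of
squares makes the operator smooth everywhere. -/
def transposedStep (Φ : E → ℝ) (A : E → ℂ) (z : E) : ℂ :=
  ((phaseWeight X S Φ z : ℝ) : ℂ)⁻¹ * A z +
    ∑ i ∈ S, Complex.I * ((X i).deriv (phaseCoeff X S Φ A i) z +
      (X i).div * phaseCoeff X S Φ A i z)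

variable {X S} {Λ : E → ℝ} {Z Z' W : Set E} {Φ : E → ℝ} {A : E → ℂ} {ρ : E → ℝ}

theorem IsNonstationary.mono (h : IsNonstationary X S Λ Z Φ) (hZ : Z' ⊆ Z) :
    IsNonstationary X S Λ Z' Φ where
  smooth := h.smooth
  one_le := h.one_le
  wt_le := h.wt_le
  symbol i hi := (h.symbol i hi).mono_set hZ fun z => zero_le_one.trans (h.one_le z)
  lower := by
    obtain ⟨c, hc, hl⟩ := h.lower
    exact ⟨c, hc, fun z hz => hl z (hZ hz)⟩

theorem IsNonstationary.symbol_inv (h : IsNonstationary X S Λ Z Φ) :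
    IsSymbol X Z (fun z => (Λ z ^ 2)⁻¹) (fun z => ((phaseWeight X S Φ z : ℝ) : ℂ)⁻¹) := by
  have hpos : ∀ z, 0 < Λ z := fun z => zero_lt_one.trans_le (h.one_le z)
  obtain ⟨c, hc, hl⟩ := h.lower
  have h1 : IsSymbol X Z (fun z => Λ z ^ 2) (fun z => ((phaseWeight X S Φ z : ℝ) : ℂ)) := by
    have h2 : IsSymbol X Z (fun z => Λ z ^ 2)
        (fun z => ∑ i ∈ S, (((X i).phaseDeriv Φ z : ℝ) : ℂ) * (((X i).phaseDeriv Φ z : ℝ) : ℂ)) :=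
      IsSymbol.sum S fun i hi => by
        simpa only [sq] using (h.symbol i hi).mul (h.symbol i hi)
    have h3 : IsSymbol X Z (fun z => Λ z ^ 2) (fun _ => (1 : ℂ)) :=
      (IsSymbol.const 1).mono subset_rfl (K := 1) fun z _ =>
        ⟨zero_le_one, by rw [one_mul]; exact one_le_pow₀ (h.one_le z)⟩
    convert h3.add h2 using 2 with z
    simp [phaseWeight, sq]
  refine h1.inv (fun z => ?_) (fun z _ => pow_pos (hpos z) 2) hc fun z hz => ?_
  · exact_mod_cast (phaseWeight_pos X S Φ z).ne'
  · rw [Complex.norm_real, Real.norm_of_nonneg (phaseWeight_pos X S Φ z).le]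
    exact hl z hz

theorem IsNonstationary.symbol_coeff (h : IsNonstationary X S Λ Z Φ) (hρ : ∀ z, 0 ≤ ρ z)
    (hA : IsSymbol X Z ρ A) {i : ι} (hi : i ∈ S) :
    IsSymbol X Z (fun z => ρ z * (Λ z)⁻¹) (phaseCoeff X S Φ A i) := by
  refine ((h.symbol_inv.mul (h.symbol i hi)).mul hA).mono subset_rfl (K := 1) fun z _ => ?_
  have hpos : 0 < Λ z := zero_lt_one.trans_le (h.one_le z)
  have := hρ z
  refine ⟨by positivity, le_of_eq ?_⟩
  field_simp

theorem IsNonstationary.symbol_step (h : IsNonstationary X S Λ Z Φ) (hρ : ∀ z, 0 ≤ ρ z)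
    (hA : IsSymbol X Z ρ A) :
    IsSymbol X Z (fun z => ρ z * (Λ z)⁻¹) (transposedStep X S Φ A) := by
  have h1 : IsSymbol X Z (fun z => ρ z * (Λ z)⁻¹)
      (fun z => ((phaseWeight X S Φ z : ℝ) : ℂ)⁻¹ * A z) := by
    refine (h.symbol_inv.mul hA).mono subset_rfl (K := 1) fun z _ => ?_
    have h1 := h.one_le z
    have hpos : 0 < Λ z := zero_lt_one.trans_le h1
    have h2 := hρ z
    refine ⟨by positivity, ?_⟩
    rw [one_mul, mul_comm]
    refine mul_le_mul_of_nonneg_left (inv_anti₀ hpos ?_) h2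
    nlinarith
  refine h1.add (IsSymbol.sum S fun i hi => ?_)
  have h2 := h.symbol_coeff hρ hA hi
  exact ((h2.deriv i).add (h2.const_mul _)).const_mul _

theorem support_phaseCoeff_subset (hA : Function.support A ⊆ W) (i : ι) :
    Function.support (phaseCoeff X S Φ A i) ⊆ W :=
  (Function.support_mul_subset_right _ _).trans hA

theorem support_transposedStep_subset (hW : IsClosed W) (hA : Function.support A ⊆ W) :
    Function.support (transposedStep X S Φ A) ⊆ W := by
  intro z hz
  by_contra hzW
  refine hz ?_
  have h1 : A z = 0 := by by_contra h0; exact hzW (hA h0)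
  have h2 : ∀ i, phaseCoeff X S Φ A i z = 0 := fun i => by
    by_contra h0; exact hzW (support_phaseCoeff_subset hA i h0)
  have h3 : ∀ i, (X i).deriv (phaseCoeff X S Φ A i) z = 0 := fun i => by
    by_contra h0
    exact hzW ((X i).support_deriv_subset hW (support_phaseCoeff_subset hA i) h0)
  simp [transposedStep, h1, h2, h3]

/-- The oscillating factor `exp (i Φ)`. -/
def oscillation {α : Type*} (Φ : α → ℝ) (z : α) : ℂ := Complex.exp (Complex.I * (Φ z : ℂ))

theorem norm_oscillation {α : Type*} (Φ : α → ℝ) (z : α) : ‖oscillation Φ z‖ = 1 := by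
  rw [oscillation, mul_comm, Complex.norm_exp_ofReal_mul_I]

theorem oscillation_smooth (hΦ : ContDiff ℝ ∞ Φ) : ContDiff ℝ ∞ (oscillation Φ) :=
  (contDiff_const.mul (Complex.ofRealCLM.contDiff.comp hΦ)).cexp

theorem deriv_oscillation (hΦ : ContDiff ℝ ∞ Φ) (Y : WeightedField E) :
    Y.deriv (oscillation Φ) =
      fun z => Complex.I * ((Y.phaseDeriv Φ z : ℝ) : ℂ) * oscillation Φ z := by
  have h1 : ContDiff ℝ ∞ (fun z => (Φ z : ℂ)) := Complex.ofRealCLM.contDiff.comp hΦ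
  have h2 := Y.deriv_cexp (contDiff_const.mul h1 : ContDiff ℝ ∞ fun z => Complex.I * (Φ z : ℂ))
  rw [Y.deriv_const_mul _ h1, Y.deriv_ofReal hΦ] at h2
  unfold oscillation WeightedField.phaseDeriv
  rw [h2]
  funext z
  ring

/-! #### Integrals over affine slices -/

variable {E' : Type*} [NormedAddCommGroup E'] [NormedSpace ℝ E'] (L : E' →L[ℝ] E)

/-- The part of `W` in the affine subspace `c + range L`. -/
def affineSlice (W : Set E) (c : E) : Set E := {z ∈ W | ∃ u, z = c + L u}

/-- `A` and its derivatives decrease faster than any power of `Λ` on the slice through `c`. -/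
def RapidOnSlice (X : ι → WeightedField E) (Λ : E → ℝ) (W : Set E) (c : E) (A : E → ℂ) : Prop :=
  ∀ k : ℕ, IsSymbol X (affineSlice L W c) (fun z => (Λ z ^ k)⁻¹) A

variable {L} {c : E}

theorem RapidOnSlice.step (hΦ : IsNonstationary X S Λ (affineSlice L W c) Φ)
    (hA : RapidOnSlice L X Λ W c A) : RapidOnSlice L X Λ W c (transposedStep X S Φ A) := by
  intro k
  have h1 : ∀ z, 0 < Λ z := fun z => zero_lt_one.trans_le (hΦ.one_le z)
  refine (hΦ.symbol_step (fun z => ?_) (hA k)).mono subset_rfl (K := 1) fun z _ => ?_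
  · have := h1 z
    positivity
  · have := h1 z
    refine ⟨by positivity, ?_⟩
    rw [one_mul]
    exact mul_le_of_le_one_right (by positivity) (inv_le_one_of_one_le₀ (hΦ.one_le z))

variable [MeasurableSpace E'] (μ : Measure E')

theorem integrable_slice [BorelSpace E'] [SecondCountableTopology E'] {r : ℕ} {G : E → ℂ}
    (hG : Continuous G) (hs : Function.support G ⊆ W)
    (hb : ∃ C : ℝ, ∀ z ∈ affineSlice L W c, ‖G z‖ ≤ C * (Λ z ^ r)⁻¹)
    (hr : Integrable (fun u => W.indicator (fun z => (Λ z ^ r)⁻¹) (c + L u)) μ) :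
    Integrable (fun u => G (c + L u)) μ := by
  obtain ⟨C, hC⟩ := hb
  refine (hr.const_mul C).mono' (hG.comp (by fun_prop)).aestronglyMeasurable
    (Eventually.of_forall fun u => ?_)
  by_cases hu : c + L u ∈ W
  · rw [indicator_of_mem hu]
    exact hC _ ⟨hu, u, rfl⟩
  · rw [indicator_of_notMem hu, mul_zero]
    have : G (c + L u) = 0 := by by_contra h0; exact hu (hs h0)
    simp [this]

variable [BorelSpace E'] [FiniteDimensional ℝ E'] [μ.IsAddHaarMeasure]

/-- Integration by parts along a weighted field tangent to the slice. -/
theorem integral_slice_mul_deriv (Y : WeightedField E)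
    (hY : Y.dir ∈ LinearMap.range (L : E' →ₗ[ℝ] E))
    {f g : E → ℂ} (hf : ContDiff ℝ ∞ f) (hg : ContDiff ℝ ∞ g)
    (h1 : Integrable (fun u => (Y.deriv f (c + L u) + Y.div * f (c + L u)) * g (c + L u)) μ)
    (h2 : Integrable (fun u => f (c + L u) * Y.deriv g (c + L u)) μ)
    (h3 : Integrable (fun u => Y.wt (c + L u) * f (c + L u) * g (c + L u)) μ) :
    ∫ u, f (c + L u) * Y.deriv g (c + L u) ∂μ =
      -∫ u, (Y.deriv f (c + L u) + Y.div * f (c + L u)) * g (c + L u) ∂μ := by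
  obtain ⟨v, hv⟩ := hY
  have hv' : L v = Y.dir := hv
  have haff : ∀ u, HasFDerivAt (fun u => c + L u) L u := fun u => L.hasFDerivAt.const_add c
  have hwf : ContDiff ℝ ∞ (fun z => (Y.wt z : ℂ) * f z) :=
    (Complex.ofRealCLM.contDiff.comp Y.wt_smooth).mul hf
  have hd1 : ∀ u, fderiv ℝ (fun u => (Y.wt (c + L u) : ℂ) * f (c + L u)) u v =
      Y.deriv f (c + L u) + Y.div * f (c + L u) := by
    intro u
    have h4 : HasFDerivAt (fun u => (Y.wt (c + L u) : ℂ) * f (c + L u)) _ u :=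
      HasFDerivAt.comp (g := fun z => (Y.wt z : ℂ) * f z) u
        ((hwf.differentiable (by simp) (c + L u)).hasFDerivAt) (haff u)
    have h5 : HasFDerivAt (fun z => (Y.wt z : ℂ))
        (Complex.ofRealCLM.comp (fderiv ℝ Y.wt (c + L u))) (c + L u) :=
      Complex.ofRealCLM.hasFDerivAt.comp _
        ((Y.wt_smooth.differentiable (by simp) (c + L u)).hasFDerivAt)
    have h6 := h5.mul ((hf.differentiable (by simp) (c + L u)).hasFDerivAt)
    have h7 : fderiv ℝ (fun z => (Y.wt z : ℂ) * f z) (c + L u) = _ := h6.fderiv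
    rw [h4.fderiv, h7]
    simp only [ContinuousLinearMap.comp_apply, add_apply, smul_apply, smul_eq_mul, hv',
      Complex.ofRealCLM_apply, Y.fderiv_wt, WeightedField.deriv]
    ring
  have hd2 : ∀ u, fderiv ℝ (fun u => g (c + L u)) u v = fderiv ℝ g (c + L u) Y.dir := by
    intro u
    have h4 : HasFDerivAt (fun u => g (c + L u)) _ u :=
      ((hg.differentiable (by simp) (c + L u)).hasFDerivAt).comp u (haff u)
    rw [h4.fderiv, ContinuousLinearMap.comp_apply, hv']
  have e1 : ∀ u, f (c + L u) * Y.deriv g (c + L u) =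
      ((Y.wt (c + L u) : ℂ) * f (c + L u)) * fderiv ℝ (fun u => g (c + L u)) u v := by
    intro u
    rw [hd2, WeightedField.deriv]
    ring
  simp only [e1, ← hd1] at h1 h2 ⊢
  have hdiff : ∀ {k : E → ℂ}, ContDiff ℝ ∞ k → Differentiable ℝ (fun u => k (c + L u)) := by
    intro k hk u
    exact ((hk.differentiable (by simp) (c + L u)).hasFDerivAt.comp u (haff u)).differentiableAt
  exact integral_mul_fderiv_eq_neg_fderiv_mul_of_integrable h1 h2 h3
    (fun u _ => hdiff hwf u) (fun u _ => hdiff hg u)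

theorem integral_oscillation_step (hΦ : IsNonstationary X S Λ (affineSlice L W c) Φ)
    (hS : ∀ i ∈ S, (X i).dir ∈ LinearMap.range (L : E' →ₗ[ℝ] E)) (hW : IsClosed W)
    (hsupp : Function.support A ⊆ W) (hA : RapidOnSlice L X Λ W c A) {r : ℕ}
    (hr : Integrable (fun u => W.indicator (fun z => (Λ z ^ r)⁻¹) (c + L u)) μ) :
    ∫ u, oscillation Φ (c + L u) * A (c + L u) ∂μ =
      ∫ u, oscillation Φ (c + L u) * transposedStep X S Φ A (c + L u) ∂μ := by
  have hpos : ∀ z, 0 < Λ z := fun z => zero_lt_one.trans_le (hΦ.one_le z)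
  have hosc : Continuous (oscillation Φ) := (oscillation_smooth hΦ.smooth).continuous
  -- `G` is integrable on the slice, even after multiplication by one factor of size `Λ`.
  have hint : ∀ {G H : E → ℂ}, RapidOnSlice L X Λ W c G → Function.support G ⊆ W →
      Continuous H → (∃ C : ℝ, ∀ z ∈ affineSlice L W c, ‖H z‖ ≤ C * Λ z) →
      Integrable (fun u => G (c + L u) * H (c + L u)) μ := by
    rintro G H hG hsG hH ⟨C, hC⟩
    obtain ⟨K, hK⟩ := (hG (r + 1)).exists_bound
    refine integrable_slice (W := W) (Λ := Λ) (r := r) μ (G := fun z => G z * H z)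
      ((hG 0).smooth.continuous.mul hH) ((Function.support_mul_subset_left _ _).trans hsG)
      ⟨K * C, fun z hz => ?_⟩ hr
    rw [norm_mul]
    have h1 := hpos z
    calc ‖G z‖ * ‖H z‖ ≤ (K * (Λ z ^ (r + 1))⁻¹) * (C * Λ z) :=
          mul_le_mul (hK z hz) (hC z hz) (norm_nonneg _) ((norm_nonneg _).trans (hK z hz))
      _ = K * C * (Λ z ^ r)⁻¹ := by field_simp; ring
  have hosc_bound : ∃ C : ℝ, ∀ z ∈ affineSlice L W c, ‖oscillation Φ z‖ ≤ C * Λ z :=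
    ⟨1, fun z _ => by rw [norm_oscillation, one_mul]; exact hΦ.one_le z⟩
  have hcoeff : ∀ i ∈ S, RapidOnSlice L X Λ W c (phaseCoeff X S Φ A i) := by
    intro i hi k
    refine (hΦ.symbol_coeff (fun z => ?_) (hA k) hi).mono subset_rfl (K := 1) fun z _ => ?_
    · have := hpos z
      positivity
    · have := hpos z
      refine ⟨by positivity, ?_⟩
      rw [one_mul]
      exact mul_le_of_le_one_right (by positivity) (inv_le_one_of_one_le₀ (hΦ.one_le z))
  have hcs : ∀ i, Function.support (phaseCoeff X S Φ A i) ⊆ W := support_phaseCoeff_subset hsupp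
  have hcd : ∀ i ∈ S, RapidOnSlice L X Λ W c (fun z => (X i).deriv (phaseCoeff X S Φ A i) z +
      (X i).div * phaseCoeff X S Φ A i z) := fun i hi k =>
    ((hcoeff i hi k).deriv i).add ((hcoeff i hi k).const_mul _)
  have hcds : ∀ i, Function.support (fun z => (X i).deriv (phaseCoeff X S Φ A i) z +
      (X i).div * phaseCoeff X S Φ A i z) ⊆ W := fun i =>
    (Function.support_add _ _).trans (union_subset
      ((X i).support_deriv_subset hW (hcs i))
      ((Function.support_mul_subset_right _ _).trans (hcs i)))
  have hq : RapidOnSlice L X Λ W c (fun z => ((phaseWeight X S Φ z : ℝ) : ℂ)⁻¹ * A z) := by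
    intro k
    refine (hΦ.symbol_inv.mul (hA k)).mono subset_rfl (K := 1) fun z _ => ?_
    have := hpos z
    refine ⟨by positivity, ?_⟩
    rw [one_mul]
    exact mul_le_of_le_one_left (by positivity)
      (inv_le_one_of_one_le₀ (one_le_pow₀ (hΦ.one_le z)))
  have hqs : Function.support (fun z => ((phaseWeight X S Φ z : ℝ) : ℂ)⁻¹ * A z) ⊆ W :=
    (Function.support_mul_subset_right _ _).trans hsupp
  have iq := hint hq hqs hosc hosc_bound
  have icd : ∀ i ∈ S, Integrable (fun u => ((X i).deriv (phaseCoeff X S Φ A i) (c + L u) +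
      (X i).div * phaseCoeff X S Φ A i (c + L u)) * oscillation Φ (c + L u)) μ :=
    fun i hi => hint (hcd i hi) (hcds i) hosc hosc_bound
  have icX : ∀ i ∈ S, Integrable (fun u => phaseCoeff X S Φ A i (c + L u) *
      (X i).deriv (oscillation Φ) (c + L u)) μ := by
    intro i hi
    refine hint (hcoeff i hi) (hcs i)
      ((X i).deriv_smooth (oscillation_smooth hΦ.smooth)).continuous ?_
    obtain ⟨K, hK⟩ := (hΦ.symbol i hi).exists_bound
    refine ⟨K, fun z hz => ?_⟩
    rw [deriv_oscillation hΦ.smooth]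
    simpa [norm_oscillation] using hK z hz
  have hibp : ∀ i ∈ S, ∫ u, phaseCoeff X S Φ A i (c + L u) *
      (X i).deriv (oscillation Φ) (c + L u) ∂μ = -∫ u, ((X i).deriv (phaseCoeff X S Φ A i)
        (c + L u) + (X i).div * phaseCoeff X S Φ A i (c + L u)) * oscillation Φ (c + L u) ∂μ := by
    intro i hi
    refine integral_slice_mul_deriv μ (X i) (hS i hi) (hcoeff i hi 0).smooth
      (oscillation_smooth hΦ.smooth) (icd i hi) (icX i hi) ?_
    have := hint (H := fun z => ((X i).wt z : ℂ) * oscillation Φ z) (hcoeff i hi) (hcs i)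
      ((Complex.continuous_ofReal.comp (X i).wt_smooth.continuous).mul hosc)
      ⟨1, fun z _ => by
        rw [norm_mul, norm_oscillation, mul_one, one_mul, Complex.norm_real]
        exact hΦ.wt_le i hi z⟩
    refine this.congr (Eventually.of_forall fun u => ?_)
    ring
  calc ∫ u, oscillation Φ (c + L u) * A (c + L u) ∂μ
      = ∫ u, (((phaseWeight X S Φ (c + L u) : ℝ) : ℂ)⁻¹ * A (c + L u) * oscillation Φ (c + L u) +
          ∑ i ∈ S, -Complex.I * (phaseCoeff X S Φ A i (c + L u) *
            (X i).deriv (oscillation Φ) (c + L u))) ∂μ := by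
        congr 1
        funext u
        have h1 : ((phaseWeight X S Φ (c + L u) : ℝ) : ℂ) ≠ 0 := by
          exact_mod_cast (phaseWeight_pos X S Φ (c + L u)).ne'
        have h2 : ∀ i ∈ S, -Complex.I * (phaseCoeff X S Φ A i (c + L u) *
            (X i).deriv (oscillation Φ) (c + L u)) =
            ((phaseWeight X S Φ (c + L u) : ℝ) : ℂ)⁻¹ * A (c + L u) * oscillation Φ (c + L u) *
              (((X i).phaseDeriv Φ (c + L u) : ℝ) : ℂ) ^ 2 := by
          intro i _
          rw [deriv_oscillation hΦ.smooth, phaseCoeff]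
          linear_combination (-(((phaseWeight X S Φ (c + L u) : ℝ) : ℂ)⁻¹ * A (c + L u) *
            oscillation Φ (c + L u) * (((X i).phaseDeriv Φ (c + L u) : ℝ) : ℂ) ^ 2)) *
              Complex.I_mul_I
        rw [Finset.sum_congr rfl h2, ← Finset.mul_sum]
        have h3 : ((phaseWeight X S Φ (c + L u) : ℝ) : ℂ) =
            1 + ∑ i ∈ S, (((X i).phaseDeriv Φ (c + L u) : ℝ) : ℂ) ^ 2 := by
          simp [phaseWeight]
        generalize ((phaseWeight X S Φ (c + L u) : ℝ) : ℂ) = w at h1 h3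
        generalize ∑ i ∈ S, (((X i).phaseDeriv Φ (c + L u) : ℝ) : ℂ) ^ 2 = s at h3
        field_simp
        rw [h3]
    _ = (∫ u, ((phaseWeight X S Φ (c + L u) : ℝ) : ℂ)⁻¹ * A (c + L u) * oscillation Φ (c + L u) ∂μ)
          + ∑ i ∈ S, Complex.I * ∫ u, ((X i).deriv (phaseCoeff X S Φ A i)
        (c + L u) + (X i).div * phaseCoeff X S Φ A i (c + L u)) * oscillation Φ (c + L u) ∂μ := by
        rw [integral_add iq (integrable_finsetSum _ fun i hi => (icX i hi).const_mul _),
          integral_finsetSum _ fun i hi => (icX i hi).const_mul _]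
        congr 1
        refine Finset.sum_congr rfl fun i hi => ?_
        rw [integral_const_mul, hibp i hi]
        ring
    _ = ∫ u, oscillation Φ (c + L u) * transposedStep X S Φ A (c + L u) ∂μ := by
        simp only [← integral_const_mul]
        rw [← integral_finsetSum _ fun i hi => (icd i hi).const_mul _,
          ← integral_add iq (integrable_finsetSum _ fun i hi => (icd i hi).const_mul _)]
        congr 1
        funext u
        rw [transposedStep, mul_add, Finset.mul_sum]
        congr 1
        · ring
        · exact Finset.sum_congr rfl fun i _ => by ring

/-- Repeated integration by parts: an integral with nonstationary phase and amplitude of size `ρ`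
equals one with amplitude of size `ρ Λ⁻ⁿ`. -/
theorem exists_amplitude_gain (hΦ : IsNonstationary X S Λ Z Φ)
    (hS : ∀ i ∈ S, (X i).dir ∈ LinearMap.range (L : E' →ₗ[ℝ] E)) (hW : IsClosed W)
    (hρ : ∀ z, 0 ≤ ρ z) (hA : IsSymbol X Z ρ A) (hsupp : Function.support A ⊆ W) (n : ℕ) :
    ∃ B : E → ℂ, IsSymbol X Z (fun z => ρ z * (Λ z ^ n)⁻¹) B ∧ Function.support B ⊆ W ∧
      ∀ (c : E) (r : ℕ), affineSlice L W c ⊆ Z → RapidOnSlice L X Λ W c A →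
        Integrable (fun u => W.indicator (fun z => (Λ z ^ r)⁻¹) (c + L u)) μ →
        ∫ u, oscillation Φ (c + L u) * A (c + L u) ∂μ =
          ∫ u, oscillation Φ (c + L u) * B (c + L u) ∂μ := by
  induction n generalizing A ρ with
  | zero => exact ⟨A, by simpa using hA, hsupp, fun c r _ _ _ => rfl⟩
  | succ n ih =>
    have hpos : ∀ z, 0 < Λ z := fun z => zero_lt_one.trans_le (hΦ.one_le z)
    obtain ⟨B, hB, hBs, hBi⟩ := ih (fun z => mul_nonneg (hρ z) (inv_nonneg.2 (hpos z).le))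
      (hΦ.symbol_step hρ hA) (support_transposedStep_subset hW hsupp)
    refine ⟨B, ?_, hBs, fun c r hc hrap hr => ?_⟩
    · refine hB.mono subset_rfl (K := 1) fun z _ => ?_
      have := hpos z
      have := hρ z
      refine ⟨by positivity, le_of_eq ?_⟩
      field_simp
      ring
    · rw [integral_oscillation_step μ (hΦ.mono hc) hS hW hsupp hrap hr]
      exact hBi c r hc (hrap.step (hΦ.mono hc)) hr

end NonstationaryPhase

/-! ### Examples of symbols -/

section SymbolExamples

variable {E G : Type*} [NormedAddCommGroup E] [NormedSpace ℝ E] [NormedAddCommGroup G]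
  [NormedSpace ℝ G] {ι : Type*} {X : ι → WeightedField E} {Z : Set E}

theorem WeightedField.deriv_comp_clm (Y : WeightedField E) (π : E →L[ℝ] G) {g : G → ℂ}
    (hg : ContDiff ℝ ∞ g) :
    Y.deriv (fun z => g (π z)) = fun z => (Y.wt z : ℂ) * fderiv ℝ g (π z) (π Y.dir) := by
  funext z
  have h1 : HasFDerivAt (fun z => g (π z)) _ z :=
    HasFDerivAt.comp (g := g) z ((hg.differentiable (by simp) (π z)).hasFDerivAt) π.hasFDerivAt
  rw [WeightedField.deriv, h1.fderiv, ContinuousLinearMap.comp_apply]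

/-- The derivative of a function in a fixed direction. -/
def dirDeriv (v : G) (g : G → ℂ) : G → ℂ := fun q => fderiv ℝ g q v

theorem dirDeriv_smooth (v : G) {g : G → ℂ} (hg : ContDiff ℝ ∞ g) : ContDiff ℝ ∞ (dirDeriv v g) :=
  (hg.fderiv_right (m := ∞) (by simp)).clm_apply contDiff_const

theorem dirDeriv_comm (u v : G) {g : G → ℂ} (hg : ContDiff ℝ ∞ g) :
    dirDeriv u (dirDeriv v g) = dirDeriv v (dirDeriv u g) := by
  funext q
  have h1 : IsSymmSndFDerivAt ℝ g q := ((contDiff_infty.1 hg 2).contDiffAt).isSymmSndFDerivAt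
    (by simp)
  have h2 : DifferentiableAt ℝ (fderiv ℝ g) q :=
    (hg.fderiv_right (m := ∞) (by simp)).differentiable (by simp) q
  have h3 : ∀ a b : G, dirDeriv a (dirDeriv b g) q = fderiv ℝ (fderiv ℝ g) q a b := by
    intro a b
    have h4 := h2.hasFDerivAt.clm_apply (hasFDerivAt_const b q)
    change fderiv ℝ (fun y => (fderiv ℝ g y) b) q a = _
    rw [h4.fderiv]
    simp
  rw [h3, h3]
  exact h1 u v

/-- A smooth function of variables that stay in a compact set is a symbol of size `1`. -/
theorem isSymbol_of_compact (π : E →L[ℝ] G) {g : G → ℂ} (hg : ContDiff ℝ ∞ g) {K : Set G}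
    (hK : IsCompact K) (hZ : ∀ z ∈ Z, π z ∈ K)
    (hX : ∀ i, π (X i).dir = 0 ∨ ∀ z, (X i).wt z = 1) :
    IsSymbol X Z (fun _ => 1) (fun z => g (π z)) := by
  refine IsSymbol.of_family (κ := {g : G → ℂ // ContDiff ℝ ∞ g}) (F := fun g z => g.1 (π z))
    (fun g => g.2.comp π.contDiff) (fun g => ?_) (fun g i => ?_) ⟨g, hg⟩
  · obtain ⟨C, hC⟩ := hK.exists_bound_of_continuousOn g.2.continuous.continuousOn
    exact ⟨C, fun z hz => by rw [mul_one]; exact hC _ (hZ z hz)⟩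
  · rw [(X i).deriv_comp_clm π g.2]
    rcases hX i with h | h
    · exact ⟨0, 0, g, g, by simp [h]⟩
    · exact ⟨1, 0, ⟨dirDeriv (π (X i).dir) g.1, dirDeriv_smooth _ g.2⟩, g, by simp [h, dirDeriv]⟩

/-- A linear coordinate that every field either annihilates or reproduces. -/
theorem isSymbol_of_eigen {ρ : E → ℝ} (ℓ : E →L[ℝ] ℝ) (hb : ∃ C : ℝ, ∀ z ∈ Z, |ℓ z| ≤ C * ρ z)
    (hX : ∀ i, ℓ (X i).dir = 0 ∨ ∀ z, (X i).wt z * ℓ (X i).dir = ℓ z) :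
    IsSymbol X Z ρ (fun z => (ℓ z : ℂ)) := by
  refine IsSymbol.of_family (κ := Unit) (F := fun _ z => (ℓ z : ℂ))
    (fun _ => Complex.ofRealCLM.contDiff.comp ℓ.contDiff) (fun _ => ?_) (fun _ i => ?_) ()
  · simpa using hb
  · rw [(X i).deriv_ofReal ℓ.contDiff]
    simp only [ContinuousLinearMap.fderiv]
    rcases hX i with h | h
    · exact ⟨0, 0, (), (), by simp [h]⟩
    · exact ⟨1, 0, (), (), by simp [h]⟩

/-! #### Gaussian regularization -/

/-- The functions `(δ w²)ᵏ exp (-δ w²)`, a family stable under `w ∂_w`. -/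
def gaussFamily (δ w : E →L[ℝ] ℝ) (k : ℕ) (z : E) : ℂ :=
  (((δ z * w z ^ 2) ^ k * Real.exp (-(δ z * w z ^ 2)) : ℝ) : ℂ)

theorem gaussFamily_zero (δ w : E →L[ℝ] ℝ) (z : E) :
    gaussFamily δ w 0 z = Complex.exp ((-δ z * w z ^ 2 : ℝ) : ℂ) := by
  simp [gaussFamily]

theorem gaussFamily_smooth (δ w : E →L[ℝ] ℝ) (k : ℕ) : ContDiff ℝ ∞ (gaussFamily δ w k) := by
  refine Complex.ofRealCLM.contDiff.comp ?_
  have h1 : ContDiff ℝ ∞ (fun z => δ z * w z ^ 2) := δ.contDiff.mul (w.contDiff.pow 2)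
  exact (h1.pow k).mul h1.neg.exp

theorem isSymbol_gauss {ρ : E → ℝ} (δ w : E →L[ℝ] ℝ)
    (hb : ∀ k, ∃ C : ℝ, ∀ z ∈ Z, ‖gaussFamily δ w k z‖ ≤ C * ρ z) (hδ : ∀ i, δ (X i).dir = 0)
    (hX : ∀ i, w (X i).dir = 0 ∨ ∀ z, (X i).wt z * w (X i).dir = w z) :
    IsSymbol X Z ρ (gaussFamily δ w 0) := by
  refine IsSymbol.of_family (κ := ℕ) (gaussFamily_smooth δ w) hb (fun k i => ?_) 0
  have h1 : ∀ z, HasFDerivAt (fun z => δ z * w z ^ 2) _ z := fun z =>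
    δ.hasFDerivAt.mul (w.hasFDerivAt.pow 2)
  have h2 : ContDiff ℝ ∞
      (fun z => (δ z * w z ^ 2) ^ k * Real.exp (-(δ z * w z ^ 2))) := by
    have h1 : ContDiff ℝ ∞ (fun z => δ z * w z ^ 2) := δ.contDiff.mul (w.contDiff.pow 2)
    exact (h1.pow k).mul h1.neg.exp
  refine ⟨if w (X i).dir = 0 then 0 else 2 * k, if w (X i).dir = 0 then 0 else -2, k, k + 1, ?_⟩
  have h3 := (X i).deriv_ofReal h2
  change (X i).deriv (gaussFamily δ w k) = _ at h3
  rw [h3]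
  funext z
  have h4 := ((h1 z).pow k).mul (h1 z).neg.exp
  have h5 : fderiv ℝ (fun z => (δ z * w z ^ 2) ^ k * Real.exp (-(δ z * w z ^ 2))) z = _ :=
    h4.fderiv
  rw [h5]
  simp only [add_apply, smul_apply, neg_apply, hδ i, smul_eq_mul, gaussFamily, nsmul_eq_mul]
  by_cases hw : w (X i).dir = 0
  · simp [hw]
  · have h6 : (X i).wt z * w (X i).dir = w z := ((hX i).resolve_left hw) z
    simp only [hw, if_false]
    push_cast
    have h7 : ((X i).wt z : ℂ) * (w (X i).dir : ℂ) = (w z : ℂ) := by exact_mod_cast h6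
    rcases k with _ | k
    · simp
      linear_combination ((2 : ℂ) * δ z * w z * Complex.exp (-(δ z * w z ^ 2))) * h7
    · simp
      linear_combination (2 * (k + 1) * (δ z * w z ^ 2) ^ k * δ z * w z *
        Complex.exp (-(δ z * w z ^ 2)) - (δ z * w z ^ 2) ^ (k + 1) * 2 * δ z * w z *
        Complex.exp (-(δ z * w z ^ 2)) : ℂ) * h7

theorem norm_gaussFamily (δ w : E →L[ℝ] ℝ) (k : ℕ) {z : E} (hδ : 0 ≤ δ z) :
    ‖gaussFamily δ w k z‖ = (δ z * w z ^ 2) ^ k * Real.exp (-(δ z * w z ^ 2)) := by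
  rw [gaussFamily, Complex.norm_real, Real.norm_of_nonneg]
  have := sq_nonneg (w z)
  positivity

theorem pow_mul_exp_neg_le {u : ℝ} (hu : 0 ≤ u) (k : ℕ) : u ^ k * Real.exp (-u) ≤ k.factorial := by
  have h1 := Real.pow_div_factorial_le_exp u hu k
  rw [div_le_iff₀ (by positivity)] at h1
  rw [Real.exp_neg, ← div_eq_mul_inv, div_le_iff₀ (Real.exp_pos u)]
  linarith

theorem gaussFamily_bounded (δ w : E →L[ℝ] ℝ) (hδ : ∀ z ∈ Z, 0 ≤ δ z) (k : ℕ) :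
    ∃ C : ℝ, ∀ z ∈ Z, ‖gaussFamily δ w k z‖ ≤ C * 1 := by
  refine ⟨k.factorial, fun z hz => ?_⟩
  rw [norm_gaussFamily δ w k (hδ z hz), mul_one]
  exact pow_mul_exp_neg_le (mul_nonneg (hδ z hz) (sq_nonneg _)) k

theorem gaussFamily_rapid (δ w : E →L[ℝ] ℝ) {δ₀ : ℝ} (h0 : 0 < δ₀) (hδ : ∀ z ∈ Z, δ z = δ₀)
    (j k : ℕ) : ∃ C : ℝ, ∀ z ∈ Z, ‖gaussFamily δ w k z‖ ≤ C * ((1 + |w z|) ^ j)⁻¹ := by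
  refine ⟨(2 * (1 + δ₀⁻¹)) ^ j * ((k + j).factorial * Real.exp 1), fun z hz => ?_⟩
  rw [norm_gaussFamily δ w k (hδ z hz ▸ h0.le), hδ z hz]
  set u := δ₀ * w z ^ 2 with hu
  have hu0 : 0 ≤ u := by positivity
  have hw : 0 < 1 + |w z| := by positivity
  rw [← div_eq_mul_inv, le_div_iff₀ (pow_pos hw j)]
  have h1 : 1 + |w z| ≤ 2 * (1 + δ₀⁻¹) * (1 + u) := by
    have h2 : w z ^ 2 = δ₀⁻¹ * u := by rw [hu]; field_simp
    have h3 : 1 + |w z| ≤ 2 * (1 + w z ^ 2) := by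
      nlinarith [sq_abs (w z), sq_nonneg (|w z| - 1), abs_nonneg (w z)]
    have h4 : 0 < δ₀⁻¹ := by positivity
    nlinarith
  have h2 : (1 + |w z|) ^ j ≤ (2 * (1 + δ₀⁻¹)) ^ j * (1 + u) ^ j := by
    rw [← mul_pow]
    exact pow_le_pow_left₀ hw.le h1 j
  have h3 : u ^ k ≤ (1 + u) ^ k := pow_le_pow_left₀ hu0 (by linarith) k
  have h4 := pow_mul_exp_neg_le (u := 1 + u) (by linarith) (k + j)
  have h5 : Real.exp (-u) = Real.exp (-(1 + u)) * Real.exp 1 := by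
    rw [← Real.exp_add]; congr 1; ring
  calc u ^ k * Real.exp (-u) * (1 + |w z|) ^ j
      ≤ (1 + u) ^ k * Real.exp (-u) * ((2 * (1 + δ₀⁻¹)) ^ j * (1 + u) ^ j) := by gcongr
    _ = (2 * (1 + δ₀⁻¹)) ^ j * (((1 + u) ^ (k + j) * Real.exp (-(1 + u))) * Real.exp 1) := by
        rw [h5]; ring
    _ ≤ _ := by gcongr

/-! #### Amplitudes -/

/-- Iterated derivatives of a function on `G × ℝ` in directions of the first factor. -/
def fstDerivs (l : List G) (f : G × ℝ → ℂ) : G × ℝ → ℂ :=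
  l.foldr (fun v F => dirDeriv (v, 0) F) f

/-- Iterated derivative of a function on `G × ℝ` in the second variable. -/
def sndDerivs (α : ℕ) (f : G × ℝ → ℂ) : G × ℝ → ℂ := (dirDeriv ((0 : G), (1 : ℝ)))^[α] f

theorem fstDerivs_smooth (l : List G) {f : G × ℝ → ℂ} (hf : ContDiff ℝ ∞ f) :
    ContDiff ℝ ∞ (fstDerivs l f) := by
  induction l with
  | nil => exact hf
  | cons v l ih => exact dirDeriv_smooth _ ih

theorem sndDerivs_succ (α : ℕ) (f : G × ℝ → ℂ) :
    sndDerivs (α + 1) f = dirDeriv (0, 1) (sndDerivs α f) := Function.iterate_succ_apply' _ _ _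

theorem sndDerivs_smooth (α : ℕ) {f : G × ℝ → ℂ} (hf : ContDiff ℝ ∞ f) :
    ContDiff ℝ ∞ (sndDerivs α f) := by
  induction α with
  | zero => exact hf
  | succ α ih => rw [sndDerivs_succ]; exact dirDeriv_smooth _ ih

theorem dirDeriv_fstDerivs (l : List G) (u : G × ℝ) {f : G × ℝ → ℂ} (hf : ContDiff ℝ ∞ f) :
    dirDeriv u (fstDerivs l f) = fstDerivs l (dirDeriv u f) := by
  induction l with
  | nil => rfl
  | cons v l ih =>
    change dirDeriv u (dirDeriv (v, 0) (fstDerivs l f)) = dirDeriv (v, 0) (fstDerivs l _)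
    rw [dirDeriv_comm _ _ (fstDerivs_smooth l hf), ih]

theorem sndDerivs_apply (α : ℕ) {f : G × ℝ → ℂ} (hf : ContDiff ℝ ∞ f) (g : G) (w : ℝ) :
    sndDerivs α f (g, w) = iteratedDeriv α (fun w' => f (g, w')) w := by
  induction α generalizing w with
  | zero => simp [sndDerivs]
  | succ α ih =>
    rw [sndDerivs_succ, iteratedDeriv_succ, ← funext ih]
    have h1 : HasDerivAt (fun w' : ℝ => (g, w')) ((0 : G), (1 : ℝ)) w :=
      (hasDerivAt_const w g).prodMk (hasDerivAt_id w)
    exact ((((sndDerivs_smooth α hf).differentiable (by simp) (g, w)).hasFDerivAt).comp_hasDerivAt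
      w h1).deriv.symm

theorem exists_fstDerivs_eq (l : List G) : ∃ v : Fin l.length → G, ∀ (f : G × ℝ → ℂ),
    ContDiff ℝ ∞ f → ∀ g w,
      fstDerivs l f (g, w) = iteratedFDeriv ℝ l.length (fun g' => f (g', w)) g v := by
  induction l with
  | nil => exact ⟨Fin.elim0, fun f _ g w => by simp [fstDerivs]⟩
  | cons v₀ l ih =>
    obtain ⟨v, hv⟩ := ih
    refine ⟨Fin.cons v₀ v, fun f hf g w => ?_⟩
    have hfw : ContDiff ℝ ∞ (fun g' => f (g', w)) := hf.comp (contDiff_id.prodMk contDiff_const)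
    have h1 : HasFDerivAt (fun g' : G => (g', w)) (ContinuousLinearMap.inl ℝ G ℝ) g :=
      hasFDerivAt_prodMk_left g w
    have h2 : HasFDerivAt (fun g' => fstDerivs l f (g', w)) _ g :=
      HasFDerivAt.comp (g := fstDerivs l f) g
        (((fstDerivs_smooth l hf).differentiable (by simp) (g, w)).hasFDerivAt) h1
    have h3 : HasFDerivAt (iteratedFDeriv ℝ l.length (fun g' => f (g', w))) _ g :=
      ((hfw.differentiable_iteratedFDeriv (m := l.length)
        (by exact_mod_cast ENat.natCast_lt_top _)) g).hasFDerivAt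
    have h4 := (ContinuousMultilinearMap.apply ℝ (fun _ : Fin l.length => G) ℂ v).hasFDerivAt.comp
      g h3
    have h5 : (fun g' => fstDerivs l f (g', w)) =
        fun g' => iteratedFDeriv ℝ l.length (fun g' => f (g', w)) g' v :=
      funext fun g' => hv f hf g' w
    have h6 : fderiv ℝ (fun g' => fstDerivs l f (g', w)) g v₀ =
        fderiv ℝ (fun g' => iteratedFDeriv ℝ l.length (fun g' => f (g', w)) g' v) g v₀ := by
      rw [h5]
    have h7 : fderiv ℝ (fun g' => iteratedFDeriv ℝ l.length (fun g' => f (g', w)) g' v) g = _ :=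
      h4.fderiv
    rw [h2.fderiv, h7] at h6
    change fderiv ℝ (fstDerivs l f) (g, w) (v₀, 0) = iteratedFDeriv ℝ (l.length + 1) _ g _
    rw [iteratedFDeriv_succ_apply_left]
    simpa using h6

/-- Derivatives of a classical symbol in `w`, of order `μ ≤ M`, depending smoothly on `g`. -/
theorem isSymbol_of_classical {a : G → ℝ → ℂ} (ha : ContDiff ℝ ∞ (fun q : G × ℝ => a q.1 q.2))
    {K : Set G} {μ : ℝ} {M : ℕ} (hM : μ ≤ M)
    (hK : ∀ α k : ℕ, ∃ c : ℝ, ∀ g ∈ K, ∀ w : ℝ,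
      ‖iteratedFDeriv ℝ k (fun g' => iteratedDeriv α (a g') w) g‖ ≤ c * (1 + |w|) ^ (μ - α))
    (πg : E →L[ℝ] G) (πw : E →L[ℝ] ℝ) (hZ : ∀ z ∈ Z, πg z ∈ K)
    (hX : ∀ i, (πw (X i).dir = 0 ∧ (πg (X i).dir = 0 ∨ ∀ z, (X i).wt z = 1)) ∨
      (πg (X i).dir = 0 ∧ πw (X i).dir = 1 ∧ ∀ z, (X i).wt z = πw z)) :
    IsSymbol X Z (fun z => (1 + |πw z|) ^ M) (fun z => a (πg z) (πw z)) := by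
  set f : G × ℝ → ℂ := fun q => a q.1 q.2 with hf
  let π : E →L[ℝ] G × ℝ := πg.prod πw
  let F : List G × ℕ → E → ℂ := fun k z =>
    (πw z : ℂ) ^ k.2 * fstDerivs k.1 (sndDerivs k.2 f) (π z)
  have hsm : ∀ k : List G × ℕ, ContDiff ℝ ∞ (fstDerivs k.1 (sndDerivs k.2 f)) := fun k =>
    fstDerivs_smooth _ (sndDerivs_smooth _ ha)
  have hw : ∀ α : ℕ, ContDiff ℝ ∞ (fun z => (πw z : ℂ) ^ α) := fun α =>
    (Complex.ofRealCLM.contDiff.comp πw.contDiff).pow α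
  have key : IsSymbol X Z (fun z => (1 + |πw z|) ^ M) (F ([], 0)) := by
    refine IsSymbol.of_family (F := F) (fun k => (hw k.2).mul ((hsm k).comp π.contDiff)) ?_ ?_ _
    · rintro ⟨l, α⟩
      obtain ⟨v, hv⟩ := exists_fstDerivs_eq l
      obtain ⟨c, hc⟩ := hK α l.length
      refine ⟨|c| * ∏ i, ‖v i‖, fun z hz => ?_⟩
      have h0 : 0 < 1 + |πw z| := by positivity
      have h1 : (fun g' => sndDerivs α f (g', πw z)) = fun g' => iteratedDeriv α (a g') (πw z) :=
        funext fun g' => sndDerivs_apply α ha g' (πw z)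
      have h2 : ‖fstDerivs l (sndDerivs α f) (π z)‖ ≤
          |c| * (1 + |πw z|) ^ (μ - α) * ∏ i, ‖v i‖ := by
        change ‖fstDerivs l (sndDerivs α f) (πg z, πw z)‖ ≤ _
        rw [hv _ (sndDerivs_smooth α ha), h1]
        refine (ContinuousMultilinearMap.le_opNorm _ _).trans ?_
        refine mul_le_mul_of_nonneg_right ((hc _ (hZ z hz) _).trans ?_)
          (Finset.prod_nonneg fun i _ => norm_nonneg _)
        exact mul_le_mul_of_nonneg_right (le_abs_self c) (by positivity)
      have h3 : |πw z| ^ α * (1 + |πw z|) ^ (μ - α) ≤ (1 + |πw z|) ^ M := by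
        calc |πw z| ^ α * (1 + |πw z|) ^ (μ - α)
            ≤ (1 + |πw z|) ^ α * (1 + |πw z|) ^ (μ - α) := by
              gcongr; linarith
          _ = (1 + |πw z|) ^ μ := by
              rw [← Real.rpow_natCast, ← Real.rpow_add h0]; congr 1; ring
          _ ≤ (1 + |πw z|) ^ (M : ℝ) :=
              Real.rpow_le_rpow_of_exponent_le (by linarith [abs_nonneg (πw z)]) hM
          _ = (1 + |πw z|) ^ M := Real.rpow_natCast _ _
      have h4 : 0 ≤ ∏ i, ‖v i‖ := Finset.prod_nonneg fun i _ => norm_nonneg _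
      calc ‖F (l, α) z‖ = |πw z| ^ α * ‖fstDerivs l (sndDerivs α f) (π z)‖ := by
            simp [F]
        _ ≤ |πw z| ^ α * (|c| * (1 + |πw z|) ^ (μ - α) * ∏ i, ‖v i‖) := by gcongr
        _ = |c| * (∏ i, ‖v i‖) * (|πw z| ^ α * (1 + |πw z|) ^ (μ - α)) := by ring
        _ ≤ |c| * (∏ i, ‖v i‖) * (1 + |πw z|) ^ M := by gcongr
    · rintro ⟨l, α⟩ i
      have hd : (X i).deriv (F (l, α)) = fun z =>
          (πw z : ℂ) ^ α * ((X i).wt z * dirDeriv (π (X i).dir)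
            (fstDerivs l (sndDerivs α f)) (π z)) +
          ((X i).wt z * (α * (πw z : ℂ) ^ (α - 1) * πw (X i).dir)) *
            fstDerivs l (sndDerivs α f) (π z) := by
        have h1 := (X i).deriv_mul (hw α) ((hsm (l, α)).comp π.contDiff)
        refine h1.trans ?_
        funext z
        have h2 := congrFun ((X i).deriv_comp_clm π (hsm (l, α))) z
        have h3 : HasFDerivAt (fun z => (πw z : ℂ) ^ α) _ z :=
          (HasFDerivAt.comp z Complex.ofRealCLM.hasFDerivAt πw.hasFDerivAt).pow α
        have h4 : (X i).deriv (fun z => (πw z : ℂ) ^ α) z =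
            (X i).wt z * (α * (πw z : ℂ) ^ (α - 1) * πw (X i).dir) := by
          rw [WeightedField.deriv, h3.fderiv]
          simp
        rw [h4]
        congr 2
      rcases hX i with ⟨h0, h | h⟩ | ⟨h0, h1, h⟩
      · have : π (X i).dir = 0 := Prod.ext h h0
        exact ⟨0, 0, ([], 0), ([], 0), by rw [hd]; simp [this, h0, dirDeriv]⟩
      · have : π (X i).dir = (πg (X i).dir, 0) := Prod.ext rfl h0
        refine ⟨1, 0, (πg (X i).dir :: l, α), ([], 0), ?_⟩
        rw [hd]
        funext z
        simp only [this, h, h0, F, Complex.ofReal_zero, Complex.ofReal_one]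
        simp [fstDerivs]
      · have : π (X i).dir = (0, 1) := Prod.ext h0 h1
        refine ⟨α, 1, (l, α), (l, α + 1), ?_⟩
        rw [hd]
        funext z
        rw [this, dirDeriv_fstDerivs l _ (sndDerivs_smooth α ha), ← sndDerivs_succ]
        simp only [h, h1, F]
        rcases α with _ | α
        · simp
        · simp
          ring
  simpa [F, fstDerivs, sndDerivs, f, π] using key

end SymbolExamples

/-! ### The bistatic distance and its critical points -/

section Bistatic

/-- The distance of the ground point `x` from the point `(s, 0, h)`. -/
def legDist (h s : ℝ) (x : Plane) : ℝ := √((x 0 - s) ^ 2 + x 1 ^ 2 + h ^ 2)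

/-- The derivative of `legDist` at `(s, x)` in the direction `(σ, v)`. -/
def legDeriv (h s : ℝ) (x : Plane) (σ : ℝ) (v : Plane) : ℝ :=
  ((x 0 - s) * (v 0 - σ) + x 1 * v 1) / legDist h s x

/-- The derivative of `bistaticDist` at `(s, x)` in the direction `(σ, v)`. -/
def bistaticDeriv (h s : ℝ) (x : Plane) (σ : ℝ) (v : Plane) : ℝ :=
  legDeriv h s x σ v + legDeriv h (-s) x (-σ) v

theorem bistaticDist_eq (h s : ℝ) (x : Plane) :
    bistaticDist h s x = legDist h s x + legDist h (-s) x := by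
  simp [bistaticDist, legDist]

variable {h : ℝ} (hh : 0 < h)
include hh

theorem legDist_pos (s : ℝ) (x : Plane) : 0 < legDist h s x := by
  unfold legDist
  positivity

theorem legDist_sq (s : ℝ) (x : Plane) :
    legDist h s x ^ 2 = (x 0 - s) ^ 2 + x 1 ^ 2 + h ^ 2 := by
  unfold legDist
  exact Real.sq_sqrt (by positivity)

theorem legDist_smooth : ContDiff ℝ ∞ (fun q : ℝ × Plane => legDist h q.1 q.2) := by
  have h0 : ∀ i : Fin 2, ContDiff ℝ ∞ (fun q : ℝ × Plane => q.2 i) := fun i => by fun_prop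
  refine ContDiff.sqrt ?_ fun q => by positivity
  exact ((((h0 0).sub contDiff_fst).pow 2).add ((h0 1).pow 2)).add contDiff_const

theorem fderiv_legDist (s : ℝ) (x : Plane) (σ : ℝ) (v : Plane) :
    fderiv ℝ (fun q : ℝ × Plane => legDist h q.1 q.2) (s, x) (σ, v) = legDeriv h s x σ v := by
  have h1 := ((legDist_smooth hh).differentiable (by simp) (s, x)).hasFDerivAt
  have h2 : HasDerivAt (fun τ : ℝ => (s + τ * σ, x + τ • v)) (σ, v) 0 := by
    refine HasDerivAt.prodMk ?_ ?_
    · simpa using ((hasDerivAt_id (0 : ℝ)).mul_const σ).const_add s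
    · simpa using ((hasDerivAt_id (0 : ℝ)).smul_const v).const_add x
  have h3 : HasDerivAt (fun τ : ℝ => legDist h (s + τ * σ) (x + τ • v)) _ 0 :=
    HasFDerivAt.comp_hasDerivAt_of_eq (l := fun q : ℝ × Plane => legDist h q.1 q.2) 0 h1 h2
      (by simp)
  have h4 : HasDerivAt (fun τ : ℝ => (x 0 + τ * v 0 - (s + τ * σ)) ^ 2 + (x 1 + τ * v 1) ^ 2
      + h ^ 2) (2 * (x 0 - s) * (v 0 - σ) + 2 * x 1 * v 1) 0 := by
    have e : ∀ c d : ℝ, HasDerivAt (fun τ : ℝ => c + τ * d) d 0 := fun c d => by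
      simpa using ((hasDerivAt_id (0 : ℝ)).mul_const d).const_add c
    refine HasDerivAt.congr_deriv ((((e (x 0) (v 0)).sub (e s σ)).pow 2).add
      ((e (x 1) (v 1)).pow 2) |>.add_const (h ^ 2)) ?_
    simp
  have h5 := h4.sqrt (by simp; positivity)
  have h6 : HasDerivAt (fun τ : ℝ => legDist h (s + τ * σ) (x + τ • v)) (legDeriv h s x σ v) 0 := by
    refine h5.congr_deriv ?_
    have := legDist_pos hh s x
    simp only [zero_mul, add_zero]
    change _ / (2 * legDist h s x) = _
    rw [legDeriv]
    field_simp
  exact h3.unique h6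

theorem bistaticDist_smooth : ContDiff ℝ ∞ (fun q : ℝ × Plane => bistaticDist h q.1 q.2) := by
  have h1 : ContDiff ℝ ∞ (fun q : ℝ × Plane => legDist h (-q.1) q.2) :=
    (legDist_smooth hh).comp (contDiff_fst.neg.prodMk contDiff_snd)
  simp only [bistaticDist_eq]
  exact (legDist_smooth hh).add h1

theorem hasFDerivAt_bistaticDist (s : ℝ) (x : Plane) : ∃ D : ℝ × Plane →L[ℝ] ℝ,
    HasFDerivAt (fun q : ℝ × Plane => bistaticDist h q.1 q.2) D (s, x) ∧
      ∀ σ v, D (σ, v) = bistaticDeriv h s x σ v := by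
  have h1 := ((legDist_smooth hh).differentiable (by simp) (s, x)).hasFDerivAt
  have h2 := ((legDist_smooth hh).differentiable (by simp) (-s, x)).hasFDerivAt
  have h3 : HasFDerivAt (fun q : ℝ × Plane => ((-q.1, q.2) : ℝ × Plane))
      ((-ContinuousLinearMap.fst ℝ ℝ Plane).prod (ContinuousLinearMap.snd ℝ ℝ Plane)) (s, x) :=
    (hasFDerivAt_fst.neg).prodMk hasFDerivAt_snd
  have h4 : HasFDerivAt (fun q : ℝ × Plane => legDist h (-q.1) q.2) _ (s, x) :=
    HasFDerivAt.comp (g := fun q : ℝ × Plane => legDist h q.1 q.2) (s, x) h2 h3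
  refine ⟨_, (h1.add h4).congr_of_eventuallyEq
    (Eventually.of_forall fun q => bistaticDist_eq h q.1 q.2), fun σ v => ?_⟩
  simp [bistaticDeriv, fderiv_legDist hh]

theorem bistaticDeriv_smooth (σ : ℝ) (v : Plane) :
    ContDiff ℝ ∞ (fun q : ℝ × Plane => bistaticDeriv h q.1 q.2 σ v) := by
  have h1 : (fun q : ℝ × Plane => bistaticDeriv h q.1 q.2 σ v) =
      fun q => fderiv ℝ (fun q : ℝ × Plane => bistaticDist h q.1 q.2) q (σ, v) := by
    funext q
    obtain ⟨D, hD, hDv⟩ := hasFDerivAt_bistaticDist hh q.1 q.2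
    rw [← hDv, ← hD.fderiv]
  rw [h1]
  exact ((bistaticDist_smooth hh).fderiv_right (m := ∞) (by simp)).clm_apply contDiff_const

/-- The gradient of the bistatic distance vanishes only under the midpoint of transmitter and
receiver. -/
theorem eq_zero_of_bistaticDeriv_eq_zero {s : ℝ} (hs : 0 < s) {x : Plane}
    (hx : ∀ i : Fin 2, bistaticDeriv h s x 0 (EuclideanSpace.single i 1) = 0) : x = 0 := by
  have hA := legDist_pos hh s x
  have hB := legDist_pos hh (-s) x
  have hA2 := legDist_sq hh s x
  have hB2 := legDist_sq hh (-s) x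
  have h0 := hx 0
  have h1 := hx 1
  simp only [bistaticDeriv, legDeriv] at h0 h1
  generalize legDist h s x = A at *
  generalize legDist h (-s) x = B at *
  simp at h0 h1
  have hx1 : x 1 = 0 := by
    have h2 : x 1 * (1 / A + 1 / B) = 0 := by rw [← h1]; ring
    exact (mul_eq_zero.1 h2).resolve_right (by positivity)
  have hx0 : x 0 = 0 := by
    rw [hx1] at hA2 hB2
    field_simp at h0
    have h2 : ((x 0 - s) * B) ^ 2 = ((x 0 + s) * A) ^ 2 := by
      have : (x 0 - s) * B = -((x 0 + s) * A) := by linarith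
      rw [this]; ring
    rw [mul_pow, mul_pow, hA2, hB2] at h2
    have h3 : h ^ 2 * (4 * s) * x 0 = 0 := by linear_combination -h2
    have h4 : h ^ 2 * (4 * s) ≠ 0 := by positivity
    exact (mul_eq_zero.1 h3).resolve_left h4
  ext i
  fin_cases i <;> simpa

omit hh in
theorem bistaticDist_zero (s : ℝ) : bistaticDist h s 0 = 2 * √(s ^ 2 + h ^ 2) := by
  simp [bistaticDist]
  ring

/-- The bistatic distance and its derivative in `s` determine the point up to the signs of its
coordinates: with `t` the sum and `d` the difference of the two legs, `∂_s R` is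
`(t / s) (4 s² - d²) / (t² - d²)`, which is injective in `d²` because `t > 2 s`. -/
theorem sq_eq_of_bistatic_eq {s : ℝ} (hs : 0 < s) {x y : Plane}
    (hR : bistaticDist h s x = bistaticDist h s y)
    (hD : bistaticDeriv h s x 1 0 = bistaticDeriv h s y 1 0) :
    x 0 ^ 2 = y 0 ^ 2 ∧ x 1 ^ 2 = y 1 ^ 2 := by
  rw [bistaticDist_eq, bistaticDist_eq] at hR
  -- In terms of the legs `A, B` at one point, `∂_s R` is a function of `t = A + B` and `A B`.
  have key : ∀ z : Plane, ∃ A B : ℝ, 0 < A ∧ 0 < B ∧ legDist h s z = A ∧ legDist h (-s) z = B ∧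
      B ^ 2 - A ^ 2 = 4 * s * z 0 ∧ A ^ 2 + B ^ 2 = 2 * (z 0 ^ 2 + z 1 ^ 2 + s ^ 2 + h ^ 2) ∧
      bistaticDeriv h s z 1 0 * (4 * s * (A * B)) =
        (A + B) * (4 * s ^ 2 - (A + B) ^ 2 + 4 * (A * B)) ∧ 4 * s ^ 2 < (A + B) ^ 2 := by
    intro z
    have hA := legDist_pos hh s z
    have hB := legDist_pos hh (-s) z
    have hA2 := legDist_sq hh s z
    have hB2 := legDist_sq hh (-s) z
    have hd : bistaticDeriv h s z 1 0 =
        (s - z 0) / legDist h s z + (s + z 0) / legDist h (-s) z := by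
      simp [bistaticDeriv, legDeriv]
      ring
    generalize legDist h s z = A at *
    generalize legDist h (-s) z = B at *
    refine ⟨A, B, hA, hB, rfl, rfl, by linear_combination hB2 - hA2,
      by linear_combination hA2 + hB2, ?_, ?_⟩
    · rw [hd]
      field_simp
      have h1 : 4 * s * z 0 = B ^ 2 - A ^ 2 := by linear_combination hA2 - hB2
      linear_combination (A - B) * h1
    · have h1 : s - z 0 < A := by
        apply lt_of_pow_lt_pow_left₀ 2 hA.le
        nlinarith [sq_nonneg (z 1), pow_pos hh 2]
      have h2 : s + z 0 < B := by
        apply lt_of_pow_lt_pow_left₀ 2 hB.le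
        nlinarith [sq_nonneg (z 1), pow_pos hh 2]
      nlinarith
  obtain ⟨A, B, hA, hB, eA, eB, h1, h2, h3, h4⟩ := key x
  obtain ⟨A', B', hA', hB', eA', eB', h1', h2', h3', h4'⟩ := key y
  rw [eA, eB, eA', eB'] at hR
  rw [hD] at h3
  have hP : A * B = A' * B' := by
    have h5 : (A + B) * (4 * s ^ 2 - (A + B) ^ 2) * (A * B - A' * B') = 0 := by
      rw [← hR] at h3'
      linear_combination (A' * B') * h3 - (A * B) * h3'
    have h6 : (A + B) * (4 * s ^ 2 - (A + B) ^ 2) ≠ 0 :=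
      mul_ne_zero (by positivity) (by linarith)
    linarith [(mul_eq_zero.1 h5).resolve_left h6]
  have hx0 : x 0 ^ 2 = y 0 ^ 2 := by
    have h5 : (4 * s) ^ 2 * (x 0 ^ 2 - y 0 ^ 2) = 0 := by
      have h6 : (B ^ 2 - A ^ 2) ^ 2 = (B' ^ 2 - A' ^ 2) ^ 2 := by
        have e1 : ∀ A B : ℝ, (B ^ 2 - A ^ 2) ^ 2 = (A + B) ^ 2 * ((A + B) ^ 2 - 4 * (A * B)) :=
          fun A B => by ring
        rw [e1, e1, hR, hP]
      rw [h1, h1'] at h6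
      linear_combination h6
    have h7 : (4 * s) ^ 2 ≠ 0 := by positivity
    linarith [(mul_eq_zero.1 h5).resolve_left h7]
  refine ⟨hx0, ?_⟩
  have h5 : A ^ 2 + B ^ 2 = A' ^ 2 + B' ^ 2 := by
    have e1 : ∀ A B : ℝ, A ^ 2 + B ^ 2 = (A + B) ^ 2 - 2 * (A * B) := fun A B => by ring
    rw [e1, e1, hR, hP]
  rw [h2, h2'] at h5
  linarith

/-- The gradient of the bistatic distance is equivariant under sign changes of the coordinates. -/
theorem bistaticDeriv_sign {σ τ : ℝ} (hσ : σ = 1 ∨ σ = -1) (hτ : τ = 1 ∨ τ = -1) (s : ℝ)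
    {x y : Plane} (h0 : y 0 = σ * x 0) (h1 : y 1 = τ * x 1) :
    bistaticDeriv h s y 0 (EuclideanSpace.single 0 1) =
        σ * bistaticDeriv h s x 0 (EuclideanSpace.single 0 1) ∧
      bistaticDeriv h s y 0 (EuclideanSpace.single 1 1) =
        τ * bistaticDeriv h s x 0 (EuclideanSpace.single 1 1) := by
  have hτ2 : τ ^ 2 = 1 := by rcases hτ with rfl | rfl <;> norm_num
  have hpos := legDist_pos hh s x
  have hpos' := legDist_pos hh (-s) x
  rcases hσ with rfl | rfl
  · have e : ∀ s, legDist h s y = legDist h s x := fun s => by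
      simp [legDist, h0, h1, mul_pow, hτ2]
    simp [bistaticDeriv, legDeriv, e, h0, h1]
    field_simp
  · have e : ∀ s, legDist h s y = legDist h (-s) x := fun s => by
      simp only [legDist, h0, h1, mul_pow, hτ2, one_mul]
      congr 3
      ring
    simp [bistaticDeriv, legDeriv, e, h0, h1]
    constructor
    · field_simp
      ring
    · field_simp
      ring

end Bistatic

/-! ### The space of all variables and the symbols on it -/

section Ambient

/-- A frequency `w` together with a ground point. -/
abbrev FreqPoint : Type := ℝ × Plane

/-- The space of all variables and parameters `((δ, ζ), (p, ((w, y), (w', x))))`: the regularization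
parameter `δ`, the covector `ζ` on `X × X`, the data point `p = (s, t)`, and the integration
variables of the two factors `F V` (`w, y`) and `F U` (`w', x`). -/
abbrev Ambient : Type :=
  (ℝ × (Plane × Plane →L[ℝ] ℝ)) × ((ℝ × ℝ) × (FreqPoint × FreqPoint))

instance isAddHaarMeasure_freqPoint : (volume : Measure FreqPoint).IsAddHaarMeasure :=
  Measure.prod.instIsAddHaarMeasure _ _

instance isAddHaarMeasure_data : (volume : Measure (ℝ × ℝ)).IsAddHaarMeasure :=
  Measure.prod.instIsAddHaarMeasure _ _

instance isAddHaarMeasure_freqPoint_prod :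
    (volume : Measure (FreqPoint × FreqPoint)).IsAddHaarMeasure :=
  Measure.prod.instIsAddHaarMeasure _ _

instance isAddHaarMeasure_all :
    (volume : Measure ((ℝ × ℝ) × (FreqPoint × FreqPoint))).IsAddHaarMeasure :=
  Measure.prod.instIsAddHaarMeasure _ _

/-- The regularization parameter. -/
def coDelta : Ambient →L[ℝ] ℝ :=
  (ContinuousLinearMap.fst ℝ _ _).comp (ContinuousLinearMap.fst ℝ _ _)

/-- The data point and the first pair of frequency and ground point. -/
def coFst : Ambient →L[ℝ] (ℝ × ℝ) × FreqPoint :=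
  ((ContinuousLinearMap.fst ℝ _ _).comp (ContinuousLinearMap.snd ℝ _ _)).prod
    ((ContinuousLinearMap.fst ℝ _ _).comp
      ((ContinuousLinearMap.snd ℝ _ _).comp (ContinuousLinearMap.snd ℝ _ _)))

/-- The data point and the second pair of frequency and ground point. -/
def coSnd : Ambient →L[ℝ] (ℝ × ℝ) × FreqPoint :=
  ((ContinuousLinearMap.fst ℝ _ _).comp (ContinuousLinearMap.snd ℝ _ _)).prod
    ((ContinuousLinearMap.snd ℝ _ _).comp
      ((ContinuousLinearMap.snd ℝ _ _).comp (ContinuousLinearMap.snd ℝ _ _)))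

/-- The data point and the ground point. -/
def dropFreq : (ℝ × ℝ) × FreqPoint →L[ℝ] (ℝ × ℝ) × Plane :=
  (ContinuousLinearMap.fst ℝ _ _).prod
    ((ContinuousLinearMap.snd ℝ _ _).comp (ContinuousLinearMap.snd ℝ _ _))

/-- The frequency. -/
def coFreq : (ℝ × ℝ) × FreqPoint →L[ℝ] ℝ :=
  (ContinuousLinearMap.fst ℝ _ _).comp (ContinuousLinearMap.snd ℝ _ _)

@[simp] theorem coDelta_apply (z : Ambient) : coDelta z = z.1.1 := rfl
@[simp] theorem coFst_apply (z : Ambient) : coFst z = (z.2.1, z.2.2.1) := rfl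
@[simp] theorem coSnd_apply (z : Ambient) : coSnd z = (z.2.1, z.2.2.2) := rfl
@[simp] theorem dropFreq_apply (q : (ℝ × ℝ) × FreqPoint) : dropFreq q = (q.1, q.2.2) := rfl
@[simp] theorem coFreq_apply (q : (ℝ × ℝ) × FreqPoint) : coFreq q = q.2.1 := rfl

/-- The vector field `∂_v`. -/
def constField (v : Ambient) : WeightedField Ambient where
  dir := v
  wt _ := 1
  wt_smooth := contDiff_const
  div := 0
  fderiv_wt _ := by simp

/-- The vector field `ℓ ∂_v`. -/
def linearField (v : Ambient) (ℓ : Ambient →L[ℝ] ℝ) : WeightedField Ambient where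
  dir := v
  wt := ℓ
  wt_smooth := ℓ.contDiff
  div := ℓ v
  fderiv_wt _ := by simp

/-- Names of the integration variables. -/
inductive Var
  | s | t | w | w' | y (i : Fin 2) | x (i : Fin 2)
deriving DecidableEq, Fintype

/-- The fields `∂_s, ∂_t, ∂_x, ∂_y, w ∂_w, w' ∂_w'`. -/
def coordField : Var → WeightedField Ambient
  | .s => constField (0, ((1, 0), 0))
  | .t => constField (0, ((0, 1), 0))
  | .w => linearField (0, (0, ((1, 0), 0))) (coFreq.comp coFst)
  | .w' => linearField (0, (0, (0, (1, 0)))) (coFreq.comp coSnd)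
  | .y i => constField (0, (0, ((0, EuclideanSpace.single i 1), 0)))
  | .x i => constField (0, (0, (0, (0, EuclideanSpace.single i 1))))

variable {Z : Set Ambient}

theorem isSymbol_freq_fst {ρ : Ambient → ℝ} (hρ : ∀ z, |z.2.2.1.1| ≤ ρ z) :
    IsSymbol coordField Z ρ (fun z => ((z.2.2.1.1 : ℝ) : ℂ)) := by
  refine isSymbol_of_eigen (coFreq.comp coFst) ⟨1, fun z _ => by simpa using hρ z⟩ fun i => ?_
  cases i <;> simp [coordField, constField, linearField]

theorem isSymbol_freq_snd {ρ : Ambient → ℝ} (hρ : ∀ z, |z.2.2.2.1| ≤ ρ z) :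
    IsSymbol coordField Z ρ (fun z => ((z.2.2.2.1 : ℝ) : ℂ)) := by
  refine isSymbol_of_eigen (coFreq.comp coSnd) ⟨1, fun z _ => by simpa using hρ z⟩ fun i => ?_
  cases i <;> simp [coordField, constField, linearField]

theorem isSymbol_covector {ρ : Ambient → ℝ} (v : Plane × Plane) (hρ : ∀ z, ‖z.1.2‖ ≤ ρ z) :
    IsSymbol coordField Z ρ (fun z => ((z.1.2 v : ℝ) : ℂ)) := by
  let ζ : Ambient →L[ℝ] (Plane × Plane →L[ℝ] ℝ) :=
    (ContinuousLinearMap.snd ℝ _ _).comp (ContinuousLinearMap.fst ℝ _ _)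
  refine isSymbol_of_eigen ((ContinuousLinearMap.apply ℝ ℝ v).comp ζ)
    ⟨‖v‖, fun z _ => ?_⟩ fun i => ?_
  · calc ‖z.1.2 v‖ ≤ ‖z.1.2‖ * ‖v‖ := z.1.2.le_opNorm v
      _ ≤ ρ z * ‖v‖ := mul_le_mul_of_nonneg_right (hρ z) (norm_nonneg v)
      _ = ‖v‖ * ρ z := mul_comm _ _
  · cases i <;> simp [coordField, constField, linearField, ζ]

variable {L : Set (ℝ × ℝ)} {K : Set Plane}

theorem isSymbol_fst {g : (ℝ × ℝ) × Plane → ℂ} (hg : ContDiff ℝ ∞ g) (hL : IsCompact L)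
    (hK : IsCompact K) (hZ : ∀ z ∈ Z, z.2.1 ∈ L ∧ z.2.2.1.2 ∈ K) :
    IsSymbol coordField Z (fun _ => 1) (fun z => g (z.2.1, z.2.2.1.2)) := by
  refine isSymbol_of_compact (dropFreq.comp coFst) hg (hL.prod hK) (fun z hz => hZ z hz)
    fun i => ?_
  cases i <;> simp [coordField, constField, linearField]

theorem isSymbol_snd {g : (ℝ × ℝ) × Plane → ℂ} (hg : ContDiff ℝ ∞ g) (hL : IsCompact L)
    (hK : IsCompact K) (hZ : ∀ z ∈ Z, z.2.1 ∈ L ∧ z.2.2.2.2 ∈ K) :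
    IsSymbol coordField Z (fun _ => 1) (fun z => g (z.2.1, z.2.2.2.2)) := by
  refine isSymbol_of_compact (dropFreq.comp coSnd) hg (hL.prod hK) (fun z hz => hZ z hz)
    fun i => ?_
  cases i <;> simp [coordField, constField, linearField]

variable {h ε m : ℝ} {a : (ℝ × ℝ) × Plane → ℝ → ℂ}

/-- A natural number bounding the order of the amplitude. -/
def orderBound (m : ℝ) : ℕ := ⌈m + 1 / 2⌉₊

theorem isSymbol_amplitude_fst (ha : IsAmplitude h ε m a) (hL : IsCompact L)
    (hLY : L ⊆ dataSpace) (hK : IsCompact K) (hZ : ∀ z ∈ Z, z.2.1 ∈ L ∧ z.2.2.1.2 ∈ K) :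
    IsSymbol coordField Z (fun z => (1 + |z.2.2.1.1|) ^ orderBound m)
      (fun z => a (z.2.1, z.2.2.1.2) z.2.2.1.1) := by
  refine isSymbol_of_classical (K := L ×ˢ K) (μ := m + 1 / 2) ha.smooth (Nat.le_ceil _)
    (fun α k => ha.symbol α k _ (hL.prod hK) (prod_mono hLY (subset_univ _)))
    (dropFreq.comp coFst) (coFreq.comp coFst) (fun z hz => hZ z hz) fun i => ?_
  cases i <;> simp [coordField, constField, linearField]

theorem isSymbol_amplitude_snd (ha : IsAmplitude h ε m a) (hL : IsCompact L)
    (hLY : L ⊆ dataSpace) (hK : IsCompact K) (hZ : ∀ z ∈ Z, z.2.1 ∈ L ∧ z.2.2.2.2 ∈ K) :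
    IsSymbol coordField Z (fun z => (1 + |z.2.2.2.1|) ^ orderBound m)
      (fun z => a (z.2.1, z.2.2.2.2) z.2.2.2.1) := by
  refine isSymbol_of_classical (K := L ×ˢ K) (μ := m + 1 / 2) ha.smooth (Nat.le_ceil _)
    (fun α k => ha.symbol α k _ (hL.prod hK) (prod_mono hLY (subset_univ _)))
    (dropFreq.comp coSnd) (coFreq.comp coSnd) (fun z hz => hZ z hz) fun i => ?_
  cases i <;> simp [coordField, constField, linearField]

/-- The regularizing factor `exp (-δ w²)`. -/
def gaussFst : Ambient → ℂ := gaussFamily coDelta (coFreq.comp coFst) 0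

/-- The regularizing factor `exp (-δ w'²)`. -/
def gaussSnd : Ambient → ℂ := gaussFamily coDelta (coFreq.comp coSnd) 0

theorem isSymbol_gaussFst {ρ : Ambient → ℝ} (hb : ∀ k, ∃ C : ℝ, ∀ z ∈ Z,
    ‖gaussFamily coDelta (coFreq.comp coFst) k z‖ ≤ C * ρ z) :
    IsSymbol coordField Z ρ gaussFst := by
  refine isSymbol_gauss _ _ hb (fun i => ?_) fun i => ?_ <;>
  cases i <;> simp [coordField, constField, linearField]

theorem isSymbol_gaussSnd {ρ : Ambient → ℝ} (hb : ∀ k, ∃ C : ℝ, ∀ z ∈ Z,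
    ‖gaussFamily coDelta (coFreq.comp coSnd) k z‖ ≤ C * ρ z) :
    IsSymbol coordField Z ρ gaussSnd := by
  refine isSymbol_gauss _ _ hb (fun i => ?_) fun i => ?_ <;>
  cases i <;> simp [coordField, constField, linearField]

/-! #### The phase -/

/-- The phase `w (t - R(s, x))` as a function of `((s, t), (w, x))`. -/
def travelPhase (h : ℝ) (q : (ℝ × ℝ) × FreqPoint) : ℝ :=
  q.2.1 * (q.1.2 - bistaticDist h q.1.1 q.2.2)

/-- The derivative of `travelPhase` at `q` in the direction `v`. -/
def travelPhaseDeriv (h : ℝ) (q v : (ℝ × ℝ) × FreqPoint) : ℝ :=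
  v.2.1 * (q.1.2 - bistaticDist h q.1.1 q.2.2) +
    q.2.1 * (v.1.2 - bistaticDeriv h q.1.1 q.2.2 v.1.1 v.2.2)

theorem travelPhase_smooth (hh : 0 < h) : ContDiff ℝ ∞ (travelPhase h) := by
  have h1 : ContDiff ℝ ∞ (fun q : (ℝ × ℝ) × FreqPoint => bistaticDist h q.1.1 q.2.2) :=
    (bistaticDist_smooth hh).comp
      ((contDiff_fst.comp contDiff_fst).prodMk (contDiff_snd.comp contDiff_snd))
  exact (contDiff_fst.comp contDiff_snd).mul ((contDiff_snd.comp contDiff_fst).sub h1)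

theorem fderiv_travelPhase (hh : 0 < h) (q v : (ℝ × ℝ) × FreqPoint) :
    fderiv ℝ (travelPhase h) q v = travelPhaseDeriv h q v := by
  obtain ⟨D, hD, hDv⟩ := hasFDerivAt_bistaticDist hh q.1.1 q.2.2
  let π : (ℝ × ℝ) × FreqPoint →L[ℝ] ℝ × Plane :=
    ((ContinuousLinearMap.fst ℝ _ _).comp (ContinuousLinearMap.fst ℝ _ _)).prod
      ((ContinuousLinearMap.snd ℝ _ _).comp (ContinuousLinearMap.snd ℝ _ _))
  let τ : (ℝ × ℝ) × FreqPoint →L[ℝ] ℝ :=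
    (ContinuousLinearMap.snd ℝ _ _).comp (ContinuousLinearMap.fst ℝ _ _)
  have h1 : HasFDerivAt (fun q : (ℝ × ℝ) × FreqPoint => bistaticDist h q.1.1 q.2.2) (D.comp π) q :=
    HasFDerivAt.comp (g := fun q : ℝ × Plane => bistaticDist h q.1 q.2) q hD π.hasFDerivAt
  have h2 : HasFDerivAt (travelPhase h) _ q := coFreq.hasFDerivAt.mul (τ.hasFDerivAt.sub h1)
  have h3 : D (π v) = bistaticDeriv h q.1.1 q.2.2 v.1.1 v.2.2 := hDv _ _
  rw [h2.fderiv]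
  simp only [add_apply, smul_apply, sub_apply, smul_eq_mul, ContinuousLinearMap.comp_apply, h3]
  simp [travelPhaseDeriv, τ]
  ring

/-- The data points at which the amplitude may be nonzero stay in a compact set, on which the
minimal travel time `2 √(s² + h²)` is excluded. -/
structure IsAmplitudeSupport (h : ℝ) (a : (ℝ × ℝ) × Plane → ℝ → ℂ) (L : Set (ℝ × ℝ)) : Prop where
  compact : IsCompact L
  subset : L ⊆ dataSpace
  zero : ∀ p, p ∉ L → ∀ x w, a (p, x) w = 0
  ne : ∀ p ∈ L, p.2 ≠ bistaticDist h p.1 0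

theorem IsAmplitude.exists_support (hh : 0 < h) (hε : 0 < ε) (ha : IsAmplitude h ε m a) :
    ∃ L, IsAmplitudeSupport h a L := by
  obtain ⟨L, hL, hLY, hL0⟩ := ha.support
  have hcl : IsClosed {p : ℝ × ℝ | 20 * ε ^ 2 / h ≤ |p.2 - 2 * √(p.1 ^ 2 + h ^ 2)|} :=
    isClosed_le (by fun_prop) (by fun_prop)
  refine ⟨_, hL.inter_right hcl, inter_subset_left.trans hLY, fun p hp x w => ?_, ?_⟩
  · by_cases h1 : p ∈ L
    · exact ha.vanish p.1 p.2 (not_le.1 fun h2 => hp ⟨h1, h2⟩) x w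
    · exact hL0 p h1 x w
  · rintro p ⟨-, hp⟩ heq
    rw [bistaticDist_zero] at heq
    have : 0 < 20 * ε ^ 2 / h := by positivity
    simp only [mem_ofPred_eq, heq, sub_self, abs_zero] at hp
    linarith

/-- Over the support of the amplitude, `t - R(s, y)` and the gradient of `R(s, ·)` at `y` have no
common zero: the gradient vanishes only at `y = 0`, where `R(s, y)` is the excluded travel time. -/
theorem exists_gradient_bound (hh : 0 < h) (hL : IsAmplitudeSupport h a L) (hK : IsCompact K) :
    ∃ c : ℝ, 0 < c ∧ ∀ p ∈ L, ∀ y ∈ K, c ≤ (p.2 - bistaticDist h p.1 y) ^ 2 +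
      ∑ i : Fin 2, bistaticDeriv h p.1 y 0 (EuclideanSpace.single i 1) ^ 2 := by
  have hcont : Continuous (fun q : (ℝ × ℝ) × Plane => (q.1.2 - bistaticDist h q.1.1 q.2) ^ 2 +
      ∑ i : Fin 2, bistaticDeriv h q.1.1 q.2 0 (EuclideanSpace.single i 1) ^ 2) := by
    have hp : Continuous (fun q : (ℝ × ℝ) × Plane => (q.1.1, q.2)) := by fun_prop
    have h1 : Continuous (fun q : (ℝ × ℝ) × Plane => bistaticDist h q.1.1 q.2) :=
      (bistaticDist_smooth hh).continuous.comp hp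
    have h2 : ∀ i : Fin 2, Continuous (fun q : (ℝ × ℝ) × Plane =>
        bistaticDeriv h q.1.1 q.2 0 (EuclideanSpace.single i 1)) := fun i =>
      (bistaticDeriv_smooth hh 0 _).continuous.comp hp
    exact (((continuous_snd.comp continuous_fst).sub h1).pow 2).add
      (continuous_finsetSum _ fun i _ => (h2 i).pow 2)
  have hpos : ∀ q ∈ L ×ˢ K, 0 < (q.1.2 - bistaticDist h q.1.1 q.2) ^ 2 +
      ∑ i : Fin 2, bistaticDeriv h q.1.1 q.2 0 (EuclideanSpace.single i 1) ^ 2 := by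
    rintro ⟨p, y⟩ ⟨hp, -⟩
    have hsum : 0 ≤ ∑ i : Fin 2, bistaticDeriv h p.1 y 0 (EuclideanSpace.single i 1) ^ 2 :=
      Finset.sum_nonneg fun i _ => sq_nonneg _
    refine lt_of_le_of_ne (add_nonneg (sq_nonneg _) hsum) fun h0 => ?_
    have h1 := (add_eq_zero_iff_of_nonneg (sq_nonneg _) hsum).1 h0.symm
    have h2 := (Finset.sum_eq_zero_iff_of_nonneg fun i _ => sq_nonneg _).1 h1.2
    have hy : y = 0 := eq_zero_of_bistaticDeriv_eq_zero hh (hL.subset hp).1 fun i =>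
      pow_eq_zero_iff two_ne_zero |>.1 (h2 i (Finset.mem_univ i))
    refine hL.ne p hp ?_
    rw [hy] at h1
    linarith [pow_eq_zero_iff two_ne_zero |>.1 h1.1]
  obtain ⟨c, hc, hcb⟩ := (hL.compact.prod hK).exists_forall_le' hcont.continuousOn hpos
  exact ⟨c, hc, fun p hp y hy => hcb (p, y) ⟨hp, hy⟩⟩

end Ambient

/-! ### Convergence of the oscillatory integral -/

section Convergence

/-- An integrable majorant of amplitudes of order `-2` supported over `K`. -/
def envelope (K : Set Plane) (u : FreqPoint) : ℝ := ((1 + |u.1|) ^ 2)⁻¹ * K.indicator 1 u.2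

theorem envelope_integrable {K : Set Plane} (hK : IsCompact K) : Integrable (envelope K) := by
  have h1 : Integrable (fun w : ℝ => ((1 + |w|) ^ 2)⁻¹) := by
    have h2 : Integrable (fun w : ℝ => (1 + ‖w‖) ^ (-(2 : ℝ))) :=
      integrable_one_add_norm (by simp)
    refine h2.congr (Eventually.of_forall fun w => ?_)
    have h3 : 0 ≤ 1 + |w| := by positivity
    simp only [Real.norm_eq_abs, Real.rpow_neg h3]
    norm_cast
  have h2 : Integrable (K.indicator (1 : Plane → ℝ)) :=
    (integrable_indicator_iff hK.measurableSet).2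
      (integrableOn_const (hs := hK.measure_lt_top.ne))
  exact h1.mul_prod h2

theorem envelope_nonneg (K : Set Plane) (u : FreqPoint) : 0 ≤ envelope K u :=
  mul_nonneg (by positivity) (indicator_nonneg (fun _ _ => zero_le_one) _)

/-- The inclusion of the variables `(w, y)`. -/
def inclFst : FreqPoint →L[ℝ] Ambient :=
  (ContinuousLinearMap.inr ℝ _ _).comp
    ((ContinuousLinearMap.inr ℝ _ _).comp (ContinuousLinearMap.inl ℝ _ _))

theorem base_add_inclFst (δ : ℝ) (p : ℝ × ℝ) (u : FreqPoint) :
    (((δ, 0), (p, 0)) : Ambient) + inclFst u = ((δ, 0), (p, (u, 0))) := by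
  simp [inclFst]

/-- The weight `1 + |w|`. -/
def weightFst (z : Ambient) : ℝ := 1 + |z.2.2.1.1|

theorem weightFst_pos (z : Ambient) : 0 < weightFst z := by
  unfold weightFst
  positivity

/-- The phase `-w (t - R(s, y))` of `F V`. -/
def phaseFst (h : ℝ) (z : Ambient) : ℝ := -travelPhase h (coFst z)

/-- The fields `∂_y, w ∂_w`. -/
def varsFst : Finset Var := {.w, .y 0, .y 1}

variable {h ε m : ℝ} {a : (ℝ × ℝ) × Plane → ℝ → ℂ} {L : Set (ℝ × ℝ)} {K : Set Plane}

theorem phaseFst_smooth (hh : 0 < h) : ContDiff ℝ ∞ (phaseFst h) :=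
  ((travelPhase_smooth hh).comp coFst.contDiff).neg

theorem hasFDerivAt_travelPhase_comp (hh : 0 < h) (ℓ : Ambient →L[ℝ] (ℝ × ℝ) × FreqPoint)
    (z : Ambient) :
    HasFDerivAt (fun z => travelPhase h (ℓ z)) ((fderiv ℝ (travelPhase h) (ℓ z)).comp ℓ) z :=
  HasFDerivAt.comp (g := travelPhase h) z
    (((travelPhase_smooth hh).differentiable (by simp) (ℓ z)).hasFDerivAt) ℓ.hasFDerivAt

theorem phaseDeriv_phaseFst (hh : 0 < h) (i : Var) (z : Ambient) :
    (coordField i).phaseDeriv (phaseFst h) z =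
      (coordField i).wt z * -travelPhaseDeriv h (coFst z) (coFst (coordField i).dir) := by
  have h1 : HasFDerivAt (phaseFst h) _ z := (hasFDerivAt_travelPhase_comp hh coFst z).neg
  rw [WeightedField.phaseDeriv, h1.fderiv, neg_apply, ContinuousLinearMap.comp_apply,
    fderiv_travelPhase hh]

theorem phaseDeriv_phaseFst_w (hh : 0 < h) (z : Ambient) :
    (coordField .w).phaseDeriv (phaseFst h) z =
      z.2.2.1.1 * -(z.2.1.2 - bistaticDist h z.2.1.1 z.2.2.1.2) := by
  rw [phaseDeriv_phaseFst hh]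
  simp [coordField, linearField, travelPhaseDeriv, bistaticDeriv, legDeriv]

theorem phaseDeriv_phaseFst_y (hh : 0 < h) (i : Fin 2) (z : Ambient) :
    (coordField (.y i)).phaseDeriv (phaseFst h) z =
      z.2.2.1.1 * bistaticDeriv h z.2.1.1 z.2.2.1.2 0 (EuclideanSpace.single i 1) := by
  rw [phaseDeriv_phaseFst hh]
  simp [coordField, constField, travelPhaseDeriv]

/-- The travel time defect `t - R(s, y)` is smooth. -/
theorem defect_smooth (hh : 0 < h) :
    ContDiff ℝ ∞ (fun q : (ℝ × ℝ) × Plane => ((q.1.2 - bistaticDist h q.1.1 q.2 : ℝ) : ℂ)) := by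
  have h1 : ContDiff ℝ ∞ (fun q : (ℝ × ℝ) × Plane => bistaticDist h q.1.1 q.2) :=
    (bistaticDist_smooth hh).comp ((contDiff_fst.comp contDiff_fst).prodMk contDiff_snd)
  exact Complex.ofRealCLM.contDiff.comp ((contDiff_snd.comp contDiff_fst).sub h1)

theorem bistaticDeriv_smooth' (hh : 0 < h) (σ : ℝ) (v : Plane) :
    ContDiff ℝ ∞ (fun q : (ℝ × ℝ) × Plane => ((bistaticDeriv h q.1.1 q.2 σ v : ℝ) : ℂ)) :=
  Complex.ofRealCLM.contDiff.comp ((bistaticDeriv_smooth hh σ v).comp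
    ((contDiff_fst.comp contDiff_fst).prodMk contDiff_snd))

/-- The points over `L` and `K`, where the amplitude of `F V` is supported. -/
def regionFst (L : Set (ℝ × ℝ)) (K : Set Plane) : Set Ambient :=
  {z | z.2.1 ∈ L ∧ z.2.2.1.2 ∈ K}

theorem isClosed_regionFst (hL : IsClosed L) (hK : IsClosed K) : IsClosed (regionFst L K) :=
  (hL.preimage (by fun_prop : Continuous fun z : Ambient => z.2.1)).inter
    (hK.preimage (by fun_prop : Continuous fun z : Ambient => z.2.2.1.2))

theorem isNonstationary_phaseFst (hh : 0 < h) (hL : IsAmplitudeSupport h a L) (hK : IsCompact K) :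
    IsNonstationary coordField varsFst weightFst (regionFst L K) (phaseFst h) where
  smooth := phaseFst_smooth hh
  one_le z := by simp [weightFst]
  wt_le i hi z := by
    have : 0 ≤ |z.2.2.1.1| := abs_nonneg _
    simp only [varsFst, Finset.mem_insert, Finset.mem_singleton] at hi
    rcases hi with rfl | rfl | rfl <;> simp [coordField, constField, linearField, weightFst]
  symbol i hi := by
    have hw : IsSymbol coordField (regionFst L K) weightFst (fun z => ((z.2.2.1.1 : ℝ) : ℂ)) :=
      isSymbol_freq_fst fun z => by simp [weightFst]
    have hy : ∀ j : Fin 2, IsSymbol coordField (regionFst L K) weightFst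
        (fun z => (((coordField (.y j)).phaseDeriv (phaseFst h) z : ℝ) : ℂ)) := by
      intro j
      simp only [phaseDeriv_phaseFst_y hh, Complex.ofReal_mul]
      simpa using hw.mul (isSymbol_fst (bistaticDeriv_smooth' hh 0 (EuclideanSpace.single j 1))
        hL.compact hK fun z hz => hz)
    simp only [varsFst, Finset.mem_insert, Finset.mem_singleton] at hi
    rcases hi with rfl | rfl | rfl
    · simp only [phaseDeriv_phaseFst_w hh, Complex.ofReal_mul, Complex.ofReal_neg]
      simpa using hw.mul (isSymbol_fst (defect_smooth hh) hL.compact hK fun z hz => hz).neg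
    · exact hy 0
    · exact hy 1
  lower := by
    obtain ⟨c, hc, hb⟩ := exists_gradient_bound hh hL hK
    refine ⟨min 1 c / 2, by positivity, fun z hz => ?_⟩
    have h1 := hb _ hz.1 _ hz.2
    have h2 : phaseWeight coordField varsFst (phaseFst h) z = 1 + z.2.2.1.1 ^ 2 *
        ((z.2.1.2 - bistaticDist h z.2.1.1 z.2.2.1.2) ^ 2 +
        ∑ i : Fin 2, bistaticDeriv h z.2.1.1 z.2.2.1.2 0 (EuclideanSpace.single i 1) ^ 2) := by
      rw [phaseWeight, varsFst, Finset.sum_insert (by decide), Finset.sum_insert (by decide),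
        Finset.sum_singleton, phaseDeriv_phaseFst_w hh, phaseDeriv_phaseFst_y hh,
        phaseDeriv_phaseFst_y hh, Fin.sum_univ_two]
      ring
    rw [h2]
    have h3 : min 1 c ≤ 1 := min_le_left _ _
    have h4 : min 1 c ≤ c := min_le_right _ _
    have h5 : 0 < min 1 c := by positivity
    have h6 := sq_abs z.2.2.1.1
    have h7 := sq_nonneg (|z.2.2.1.1| - 1)
    have h8 : z.2.2.1.1 ^ 2 * min 1 c ≤ z.2.2.1.1 ^ 2 * ((z.2.1.2 -
        bistaticDist h z.2.1.1 z.2.2.1.2) ^ 2 + ∑ i : Fin 2,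
          bistaticDeriv h z.2.1.1 z.2.2.1.2 0 (EuclideanSpace.single i 1) ^ 2) :=
      mul_le_mul_of_nonneg_left (h4.trans h1) (sq_nonneg _)
    unfold weightFst
    nlinarith

/-- The amplitude of the regularized integral defining `F V`. -/
def ampFst (a : (ℝ × ℝ) × Plane → ℝ → ℂ) (V : Test Plane) (z : Ambient) : ℂ :=
  gaussFst z * (a (z.2.1, z.2.2.1.2) z.2.2.1.1 * V z.2.2.1.2)

theorem test_smooth (V : Test Plane) : ContDiff ℝ ∞ V := V.contDiff

theorem support_ampFst (hL : IsAmplitudeSupport h a L) (V : Test Plane) :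
    Function.support (ampFst a V) ⊆ regionFst L (tsupport V) := by
  intro z hz
  by_contra hzW
  refine hz ?_
  by_cases h1 : z.2.1 ∈ L
  · have h2 : z.2.2.1.2 ∉ tsupport V := fun h2 => hzW ⟨h1, h2⟩
    simp [ampFst, image_eq_zero_of_notMem_tsupport h2]
  · simp [ampFst, hL.zero _ h1]

theorem isSymbol_ampFst_of_gauss (ha : IsAmplitude h ε m a) (hL : IsAmplitudeSupport h a L)
    (V : Test Plane) {Z : Set Ambient} (hZ : Z ⊆ regionFst L (tsupport V)) {ρ : Ambient → ℝ}
    (hg : IsSymbol coordField Z ρ gaussFst) :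
    IsSymbol coordField Z (fun z => ρ z * weightFst z ^ orderBound m) (ampFst a V) := by
  have hV : ContDiff ℝ ∞ (fun q : (ℝ × ℝ) × Plane => V q.2) := (test_smooth V).comp contDiff_snd
  have h1 := (isSymbol_amplitude_fst (Z := Z) ha hL.compact hL.subset V.hasCompactSupport
    fun z hz => hZ hz).mul
    (isSymbol_fst hV hL.compact V.hasCompactSupport fun z hz => hZ hz)
  have h2 := hg.mul h1
  simp only [mul_one] at h2
  exact h2

theorem norm_le_envelope (G : Ambient → ℂ) (hG : Function.support G ⊆ regionFst L K) {C : ℝ}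
    {c : ℝ × (Plane × Plane →L[ℝ] ℝ)} {p : ℝ × ℝ} {u : FreqPoint}
    (hb : (c, (p, (u, 0))) ∈ regionFst L K →
      ‖G (c, (p, (u, 0)))‖ ≤ C * (weightFst (c, (p, (u, 0))) ^ 2)⁻¹) :
    ‖G (c, (p, (u, 0)))‖ ≤ |C| * envelope K u := by
  by_cases hu : ((c, (p, (u, 0))) : Ambient) ∈ regionFst L K
  · refine (hb hu).trans ?_
    rw [envelope, indicator_of_mem hu.2, Pi.one_apply, mul_one]
    exact mul_le_mul_of_nonneg_right (le_abs_self C) (by positivity)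
  · have h0 : G (c, (p, (u, 0))) = 0 := by
      by_contra h0
      exact hu (hG h0)
    rw [h0, norm_zero]
    exact mul_nonneg (abs_nonneg C) (envelope_nonneg K u)

theorem rapid_ampFst (ha : IsAmplitude h ε m a) (hL : IsAmplitudeSupport h a L)
    (V : Test Plane) {δ : ℝ} (hδ : 0 < δ) (p : ℝ × ℝ) :
    RapidOnSlice inclFst coordField weightFst (regionFst L (tsupport V)) ((δ, 0), (p, 0))
      (ampFst a V) := by
  intro k
  have h1 : ∀ z ∈ affineSlice inclFst (regionFst L (tsupport V)) ((δ, 0), (p, 0)),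
      coDelta z = δ := by
    rintro z ⟨-, u, rfl⟩
    rw [base_add_inclFst]
    rfl
  have h2 := isSymbol_ampFst_of_gauss ha hL V (fun z hz => hz.1) (isSymbol_gaussFst
    (gaussFamily_rapid coDelta (coFreq.comp coFst) hδ h1 (k + orderBound m)))
  refine h2.mono subset_rfl (K := 1) fun z _ => ?_
  have h3 := weightFst_pos z
  have h4 : 1 + |(coFreq.comp coFst) z| = weightFst z := rfl
  rw [h4]
  refine ⟨by positivity, le_of_eq ?_⟩
  rw [pow_add]
  field_simp

theorem regularizedF_eq_integral (ha : IsAmplitude h ε m a) (hh : 0 < h)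
    (hL : IsAmplitudeSupport h a L) (V : Test Plane) {δ : ℝ} (hδ : 0 < δ) (p : ℝ × ℝ) :
    Integrable (fun u : FreqPoint => oscillation (phaseFst h) ((δ, 0), (p, (u, 0))) *
      ampFst a V ((δ, 0), (p, (u, 0)))) ∧
    regularizedF h a V p δ = ∫ u : FreqPoint, oscillation (phaseFst h) ((δ, 0), (p, (u, 0))) *
      ampFst a V ((δ, 0), (p, (u, 0))) := by
  have hint : Integrable (fun u : FreqPoint => oscillation (phaseFst h) ((δ, 0), (p, (u, 0))) *
      ampFst a V ((δ, 0), (p, (u, 0)))) := by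
    obtain ⟨C, hC⟩ := (rapid_ampFst ha hL V hδ p 2).exists_bound
    have hc : Continuous (fun z => oscillation (phaseFst h) z * ampFst a V z) :=
      (oscillation_smooth (phaseFst_smooth hh)).continuous.mul
        (rapid_ampFst ha hL V hδ p 2).smooth.continuous
    refine ((envelope_integrable V.hasCompactSupport).const_mul |C|).mono'
      (hc.comp (by fun_prop)).aestronglyMeasurable (Eventually.of_forall fun u => ?_)
    rw [norm_mul, norm_oscillation, one_mul]
    exact norm_le_envelope (ampFst a V) (support_ampFst hL V)
      (fun hz => hC _ ⟨hz, u, (base_add_inclFst δ p u).symm⟩)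
  refine ⟨hint, ?_⟩
  rw [Measure.volume_eq_prod] at hint ⊢
  rw [integral_prod _ hint, regularizedF]
  congr 1
  funext w
  congr 1
  funext x
  have e1 : gaussFst ((δ, 0), (p, ((w, x), 0))) = Complex.exp ((-δ * w ^ 2 : ℝ) : ℂ) :=
    gaussFamily_zero _ _ _
  have e2 : oscillation (phaseFst h) ((δ, 0), (p, ((w, x), 0))) =
      Complex.exp (-Complex.I * ((w * (p.2 - bistaticDist h p.1 x) : ℝ) : ℂ)) := by
    simp [oscillation, phaseFst, travelPhase]
  simp only [ampFst, e1, e2]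
  ring

theorem integrable_indicator_regionFst (hL : IsClosed L) (hK : IsCompact K) (δ : ℝ) (p : ℝ × ℝ) :
    Integrable (fun u : FreqPoint => (regionFst L K).indicator (fun z => (weightFst z ^ 2)⁻¹)
      ((((δ, 0), (p, 0)) : Ambient) + inclFst u)) := by
  have hw : Continuous fun z : Ambient => (weightFst z ^ 2)⁻¹ := by
    have h1 : Continuous weightFst := by unfold weightFst; fun_prop
    exact (h1.pow 2).inv₀ fun z => (pow_pos (weightFst_pos z) 2).ne'
  have hm : Measurable ((regionFst L K).indicator fun z => (weightFst z ^ 2)⁻¹) :=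
    hw.measurable.indicator (isClosed_regionFst hL hK.isClosed).measurableSet
  refine (envelope_integrable hK).mono'
    (hm.comp (by fun_prop : Continuous _).measurable).aestronglyMeasurable
    (Eventually.of_forall fun u => ?_)
  rw [base_add_inclFst]
  by_cases hu : (((δ, 0), (p, (u, 0))) : Ambient) ∈ regionFst L K
  · rw [indicator_of_mem hu, envelope, indicator_of_mem hu.2, Pi.one_apply, mul_one,
      Real.norm_of_nonneg (by positivity)]
    rfl
  · rw [indicator_of_notMem hu, norm_zero]
    exact envelope_nonneg K u

theorem varsFst_dir_mem_range (i : Var) (hi : i ∈ varsFst) :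
    (coordField i).dir ∈ LinearMap.range (inclFst : FreqPoint →ₗ[ℝ] Ambient) := by
  simp only [varsFst, Finset.mem_insert, Finset.mem_singleton] at hi
  rcases hi with rfl | rfl | rfl
  · exact ⟨(1, 0), rfl⟩
  · exact ⟨(0, EuclideanSpace.single 0 1), rfl⟩
  · exact ⟨(0, EuclideanSpace.single 1 1), rfl⟩

/-- The regularized integrals are bounded uniformly in the data point and in `δ`, and converge as
`δ → 0`: after integration by parts in `(w, y)` the integrand has a `δ`-independent integrable
majorant. -/
theorem regularizedF_bounded_and_converges (hh : 0 < h) (ha : IsAmplitude h ε m a)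
    (hL : IsAmplitudeSupport h a L) (V : Test Plane) :
    (∃ C : ℝ, ∀ p, ∀ δ > 0, ‖regularizedF h a V p δ‖ ≤ C) ∧
      ∀ p, ∃ l, Tendsto (regularizedF h a V p) (𝓝[>] (0 : ℝ)) (𝓝 l) := by
  have hK : IsCompact (tsupport V) := V.hasCompactSupport
  set W := regionFst L (tsupport V) with hW
  set Z : Set Ambient := {z ∈ W | 0 ≤ coDelta z} with hZ
  have hpos := weightFst_pos
  have hA : IsSymbol coordField Z (fun z => weightFst z ^ orderBound m) (ampFst a V) := by
    simpa only [one_mul] using isSymbol_ampFst_of_gauss ha hL V (fun z hz => hz.1)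
      (isSymbol_gaussFst (gaussFamily_bounded coDelta (coFreq.comp coFst) fun z hz => hz.2))
  have hcl : IsClosed W := isClosed_regionFst hL.compact.isClosed hK.isClosed
  obtain ⟨B, hB, hBs, hBi⟩ := exists_amplitude_gain (L := inclFst) (volume : Measure FreqPoint)
    ((isNonstationary_phaseFst hh hL hK).mono fun z (hz : z ∈ Z) => hz.1)
    varsFst_dir_mem_range hcl (fun z => pow_nonneg (hpos z).le _) hA (support_ampFst hL V)
    (orderBound m + 2)
  obtain ⟨C, hC⟩ := hB.exists_bound
  have hBC : ∀ p, ∀ δ ≥ 0, ∀ u : FreqPoint,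
      ‖oscillation (phaseFst h) ((δ, 0), (p, (u, 0))) * B ((δ, 0), (p, (u, 0)))‖ ≤
        |C| * envelope (tsupport V) u := by
    intro p δ hδ u
    rw [norm_mul, norm_oscillation, one_mul]
    refine norm_le_envelope B hBs fun hz => (hC _ ⟨hz, hδ⟩).trans (le_of_eq ?_)
    have := hpos ((δ, 0), (p, (u, 0)))
    rw [pow_add]
    field_simp
  have heq : ∀ p, ∀ δ > 0, regularizedF h a V p δ =
      ∫ u : FreqPoint, oscillation (phaseFst h) ((δ, 0), (p, (u, 0))) *
        B ((δ, 0), (p, (u, 0))) := by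
    intro p δ hδ
    rw [(regularizedF_eq_integral ha hh hL V hδ p).2]
    have h1 := hBi ((δ, 0), (p, 0)) 2 ?_ (rapid_ampFst ha hL V hδ p)
      (integrable_indicator_regionFst hL.compact.isClosed hK δ p)
    · simpa only [base_add_inclFst] using h1
    · rintro z ⟨hz, u, rfl⟩
      refine ⟨hz, ?_⟩
      rw [base_add_inclFst]
      exact hδ.le
  have henv : Integrable fun u => |C| * envelope (tsupport V) u :=
    (envelope_integrable hK).const_mul _
  refine ⟨⟨∫ u, |C| * envelope (tsupport V) u, fun p δ hδ => ?_⟩, fun p => ?_⟩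
  · rw [heq p δ hδ]
    exact norm_integral_le_of_norm_le henv (Eventually.of_forall (hBC p δ hδ.le))
  · have hcont : Continuous fun z => oscillation (phaseFst h) z * B z :=
      (oscillation_smooth (phaseFst_smooth hh)).continuous.mul hB.smooth.continuous
    refine ⟨∫ u : FreqPoint, oscillation (phaseFst h) ((0, 0), (p, (u, 0))) *
        B ((0, 0), (p, (u, 0))), ?_⟩
    have h1 : Tendsto (fun δ : ℝ => ∫ u : FreqPoint,
        oscillation (phaseFst h) ((δ, 0), (p, (u, 0))) * B ((δ, 0), (p, (u, 0))))
        (𝓝[>] (0 : ℝ)) (𝓝 (∫ u : FreqPoint, oscillation (phaseFst h) ((0, 0), (p, (u, 0))) *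
        B ((0, 0), (p, (u, 0))))) := by
      refine tendsto_integral_filter_of_dominated_convergence _ (Eventually.of_forall fun δ =>
        (hcont.comp (by fun_prop)).aestronglyMeasurable) ?_ henv
        (Eventually.of_forall fun u => ?_)
      · filter_upwards [self_mem_nhdsWithin] with δ hδ
        exact Eventually.of_forall (hBC p δ (le_of_lt hδ))
      · have h2 : Continuous fun δ : ℝ => oscillation (phaseFst h) ((δ, 0), (p, (u, 0))) *
            B ((δ, 0), (p, (u, 0))) := hcont.comp (by fun_prop)
        exact h2.continuousAt.tendsto.mono_left nhdsWithin_le_nhds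
    refine h1.congr' ?_
    filter_upwards [self_mem_nhdsWithin] with δ hδ
    exact (heq p δ hδ).symm

theorem regularizedF_eq_zero (hL : IsAmplitudeSupport h a L) (V : Test Plane) {p : ℝ × ℝ}
    (hp : p ∉ L) : regularizedF h a V p = fun _ => 0 := by
  funext δ
  simp [regularizedF, hL.zero p hp]

theorem tendsto_regularizedF (hh : 0 < h) (ha : IsAmplitude h ε m a)
    (hL : IsAmplitudeSupport h a L) (V : Test Plane) (p : ℝ × ℝ) :
    Tendsto (regularizedF h a V p) (𝓝[>] (0 : ℝ)) (𝓝 (opF h a V p)) :=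
  tendsto_nhds_limUnder ((regularizedF_bounded_and_converges hh ha hL V).2 p)

theorem opF_eq_zero (hL : IsAmplitudeSupport h a L) (V : Test Plane) {p : ℝ × ℝ} (hp : p ∉ L) :
    opF h a V p = 0 := by
  rw [opF, regularizedF_eq_zero hL V hp]
  exact tendsto_const_nhds.limUnder_eq

theorem measurable_regularizedF (hh : 0 < h) (ha : IsAmplitude h ε m a)
    (hL : IsAmplitudeSupport h a L) (V : Test Plane) {δ : ℝ} (hδ : 0 < δ) :
    StronglyMeasurable fun p => regularizedF h a V p δ := by
  have h1 : (fun p => regularizedF h a V p δ) = fun p => ∫ u : FreqPoint,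
      oscillation (phaseFst h) ((δ, 0), (p, (u, 0))) * ampFst a V ((δ, 0), (p, (u, 0))) :=
    funext fun p => (regularizedF_eq_integral ha hh hL V hδ p).2
  rw [h1]
  have hc : Continuous (fun z => oscillation (phaseFst h) z * ampFst a V z) :=
    (oscillation_smooth (phaseFst_smooth hh)).continuous.mul
      (rapid_ampFst ha hL V hδ 0 2).smooth.continuous
  refine StronglyMeasurable.integral_prod_right (f := fun (p : ℝ × ℝ) (u : FreqPoint) =>
    oscillation (phaseFst h) ((δ, 0), (p, (u, 0))) * ampFst a V ((δ, 0), (p, (u, 0)))) ?_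
  have h2 : Continuous fun q : (ℝ × ℝ) × FreqPoint =>
      oscillation (phaseFst h) ((δ, 0), (q.1, (q.2, 0))) *
        ampFst a V ((δ, 0), (q.1, (q.2, 0))) := hc.comp (by fun_prop)
  exact h2.stronglyMeasurable

theorem memLp_opF (hh : 0 < h) (ha : IsAmplitude h ε m a) (hL : IsAmplitudeSupport h a L)
    (V : Test Plane) : MemLp (opF h a V) 2 (volume.restrict dataSpace) := by
  obtain ⟨C, hC⟩ := (regularizedF_bounded_and_converges hh ha hL V).1
  have hlim := tendsto_regularizedF hh ha hL V
  have hbound : ∀ p, ‖opF h a V p‖ ≤ C := fun p =>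
    le_of_tendsto (hlim p).norm (by
      filter_upwards [self_mem_nhdsWithin] with δ hδ
      exact hC p δ hδ)
  have hseq : Tendsto (fun n : ℕ => 1 / ((n : ℝ) + 1)) atTop (𝓝[>] (0 : ℝ)) :=
    tendsto_nhdsWithin_iff.2 ⟨tendsto_one_div_add_atTop_nhds_zero_nat,
      Eventually.of_forall fun n => mem_Ioi.2 Nat.one_div_pos_of_nat⟩
  have hmeas : StronglyMeasurable (opF h a V) :=
    stronglyMeasurable_of_tendsto atTop
      (f := fun (n : ℕ) p => regularizedF h a V p (1 / ((n : ℝ) + 1)))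
      (fun n => measurable_regularizedF hh ha hL V Nat.one_div_pos_of_nat)
      (tendsto_pi_nhds.2 fun p => (hlim p).comp hseq)
  have hind : L.indicator (opF h a V) = opF h a V :=
    indicator_eq_self.2 fun p hp => by
      by_contra h0
      exact hp (opF_eq_zero hL V h0)
  have : IsFiniteMeasure ((volume : Measure (ℝ × ℝ)).restrict L) :=
    ⟨by simpa using hL.compact.measure_lt_top⟩
  have h1 : MemLp (opF h a V) 2 (volume.restrict L) :=
    MemLp.of_bound hmeas.aestronglyMeasurable C (Eventually.of_forall hbound)
  have h2 := (memLp_indicator_iff_restrict hL.compact.measurableSet).2 h1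
  rw [hind] at h2
  exact h2.restrict _

end Convergence

/-! ### The phase of the kernel of `F* F` -/

section PairPhase

/-- The weight `1 + |w| + |w'| + ‖ζ‖`. -/
def weightPair (z : Ambient) : ℝ := 1 + |z.2.2.1.1| + |z.2.2.2.1| + ‖z.1.2‖

/-- The phase `-w (t - R(s, y)) + w' (t - R(s, x)) - ζ (x, y)` of the localized Fourier transform
of the kernel of `F* F`. -/
def phasePair (h : ℝ) (z : Ambient) : ℝ :=
  -travelPhase h (coFst z) + travelPhase h (coSnd z) - z.1.2 (z.2.2.2.2, z.2.2.1.2)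

variable {h ε m : ℝ} {a : (ℝ × ℝ) × Plane → ℝ → ℂ} {L : Set (ℝ × ℝ)}

theorem weightPair_pos (z : Ambient) : 0 < weightPair z := by
  unfold weightPair
  positivity

theorem phasePair_hasFDerivAt (hh : 0 < h) (z : Ambient) : ∃ D : Ambient →L[ℝ] ℝ,
    HasFDerivAt (phasePair h) D z ∧ ∀ v, D v = -travelPhaseDeriv h (coFst z) (coFst v) +
      travelPhaseDeriv h (coSnd z) (coSnd v) -
      (z.1.2 (v.2.2.2.2, v.2.2.1.2) + v.1.2 (z.2.2.2.2, z.2.2.1.2)) := by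
  let c : Ambient →L[ℝ] (Plane × Plane →L[ℝ] ℝ) :=
    (ContinuousLinearMap.snd ℝ _ _).comp (ContinuousLinearMap.fst ℝ _ _)
  let d : Ambient →L[ℝ] Plane × Plane :=
    ((ContinuousLinearMap.snd ℝ _ _).comp ((ContinuousLinearMap.snd ℝ _ _).comp coSnd)).prod
      ((ContinuousLinearMap.snd ℝ _ _).comp ((ContinuousLinearMap.snd ℝ _ _).comp coFst))
  have h1 : HasFDerivAt (phasePair h) _ z := ((hasFDerivAt_travelPhase_comp hh coFst z).neg.add
    (hasFDerivAt_travelPhase_comp hh coSnd z)).sub (c.hasFDerivAt.clm_apply d.hasFDerivAt)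
  refine ⟨_, h1, fun v => ?_⟩
  simp only [add_apply, sub_apply, neg_apply, ContinuousLinearMap.comp_apply,
    ContinuousLinearMap.flip_apply, fderiv_travelPhase hh]
  rfl

theorem phasePair_smooth (hh : 0 < h) : ContDiff ℝ ∞ (phasePair h) := by
  have h1 : ContDiff ℝ ∞ (fun z : Ambient => z.1.2 (z.2.2.2.2, z.2.2.1.2)) := by
    have c : ContDiff ℝ ∞ (fun z : Ambient => z.1.2) := contDiff_snd.comp contDiff_fst
    have d : ContDiff ℝ ∞ (fun z : Ambient => (z.2.2.2.2, z.2.2.1.2)) := by fun_prop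
    exact c.clm_apply d
  exact (((travelPhase_smooth hh).comp coFst.contDiff).neg.add
    ((travelPhase_smooth hh).comp coSnd.contDiff)).sub h1

theorem phaseDeriv_phasePair (hh : 0 < h) (i : Var) (z : Ambient) :
    (coordField i).phaseDeriv (phasePair h) z = (coordField i).wt z *
      (-travelPhaseDeriv h (coFst z) (coFst (coordField i).dir) +
      travelPhaseDeriv h (coSnd z) (coSnd (coordField i).dir) -
      (z.1.2 ((coordField i).dir.2.2.2.2, (coordField i).dir.2.2.1.2) +
        (coordField i).dir.1.2 (z.2.2.2.2, z.2.2.1.2))) := by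
  obtain ⟨D, hD, hDv⟩ := phasePair_hasFDerivAt hh z
  rw [WeightedField.phaseDeriv, hD.fderiv, hDv]

theorem bistaticDeriv_zero (s : ℝ) (x : Plane) : bistaticDeriv h s x 0 0 = 0 := by
  simp [bistaticDeriv, legDeriv]

/-- The derivatives of the phase along the coordinate fields, in closed form. -/
def pairGradient (h : ℝ) (z : Ambient) : Var → ℝ
  | .s => z.2.2.1.1 * bistaticDeriv h z.2.1.1 z.2.2.1.2 1 0 -
      z.2.2.2.1 * bistaticDeriv h z.2.1.1 z.2.2.2.2 1 0
  | .t => z.2.2.2.1 - z.2.2.1.1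
  | .w => -(z.2.2.1.1 * (z.2.1.2 - bistaticDist h z.2.1.1 z.2.2.1.2))
  | .w' => z.2.2.2.1 * (z.2.1.2 - bistaticDist h z.2.1.1 z.2.2.2.2)
  | .y i => z.2.2.1.1 * bistaticDeriv h z.2.1.1 z.2.2.1.2 0 (EuclideanSpace.single i 1) -
      z.1.2 (0, EuclideanSpace.single i 1)
  | .x i => -(z.2.2.2.1 * bistaticDeriv h z.2.1.1 z.2.2.2.2 0 (EuclideanSpace.single i 1)) -
      z.1.2 (EuclideanSpace.single i 1, 0)

theorem phaseDeriv_eq_pairGradient (hh : 0 < h) (i : Var) (z : Ambient) :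
    (coordField i).phaseDeriv (phasePair h) z = pairGradient h z i := by
  have h0 : z.1.2 (0, 0) = 0 := map_zero _
  rw [phaseDeriv_phasePair hh]
  cases i <;>
    simp [coordField, constField, linearField, travelPhaseDeriv, pairGradient,
      bistaticDeriv_zero, h0] <;> ring

theorem pairGradient_continuous (hh : 0 < h) (i : Var) :
    Continuous fun z => pairGradient h z i := by
  simp only [← phaseDeriv_eq_pairGradient hh]
  exact (coordField i).wt_smooth.continuous.mul
    (((phasePair_smooth hh).continuous_fderiv (by simp)).clm_apply continuous_const)

theorem isSymbol_pairGradient (hh : 0 < h) (hL : IsCompact L) {Kx Ky : Set Plane}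
    (hKx : IsCompact Kx) (hKy : IsCompact Ky) {Z : Set Ambient}
    (hZ : ∀ z ∈ Z, z.2.1 ∈ L ∧ z.2.2.1.2 ∈ Ky ∧ z.2.2.2.2 ∈ Kx) (i : Var) :
    IsSymbol coordField Z weightPair (fun z => ((pairGradient h z i : ℝ) : ℂ)) := by
  have hw : IsSymbol coordField Z weightPair (fun z => ((z.2.2.1.1 : ℝ) : ℂ)) :=
    isSymbol_freq_fst fun z => by
      unfold weightPair
      linarith [abs_nonneg z.2.2.2.1, norm_nonneg z.1.2]
  have hw' : IsSymbol coordField Z weightPair (fun z => ((z.2.2.2.1 : ℝ) : ℂ)) :=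
    isSymbol_freq_snd fun z => by
      unfold weightPair
      linarith [abs_nonneg z.2.2.1.1, norm_nonneg z.1.2]
  have hζ : ∀ v, IsSymbol coordField Z weightPair (fun z => ((z.1.2 v : ℝ) : ℂ)) := fun v =>
    isSymbol_covector v fun z => by
      unfold weightPair
      linarith [abs_nonneg z.2.2.1.1, abs_nonneg z.2.2.2.1]
  have hy : ∀ {g : (ℝ × ℝ) × Plane → ℂ}, ContDiff ℝ ∞ g → IsSymbol coordField Z weightPair
      (fun z => ((z.2.2.1.1 : ℝ) : ℂ) * g (z.2.1, z.2.2.1.2)) := fun hg => by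
    simpa only [mul_one] using
      hw.mul (isSymbol_fst hg hL hKy fun z hz => ⟨(hZ z hz).1, (hZ z hz).2.1⟩)
  have hx : ∀ {g : (ℝ × ℝ) × Plane → ℂ}, ContDiff ℝ ∞ g → IsSymbol coordField Z weightPair
      (fun z => ((z.2.2.2.1 : ℝ) : ℂ) * g (z.2.1, z.2.2.2.2)) := fun hg => by
    simpa only [mul_one] using
      hw'.mul (isSymbol_snd hg hL hKx fun z hz => ⟨(hZ z hz).1, (hZ z hz).2.2⟩)
  cases i with
  | s => simpa [pairGradient] using
      (hy (bistaticDeriv_smooth' hh 1 0)).sub (hx (bistaticDeriv_smooth' hh 1 0))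
  | t => simpa [pairGradient] using hw'.sub hw
  | w => simpa [pairGradient] using (hy (defect_smooth hh)).neg
  | w' => simpa [pairGradient] using hx (defect_smooth hh)
  | y i => simpa [pairGradient] using (hy (bistaticDeriv_smooth' hh 0 _)).sub (hζ _)
  | x i => simpa [pairGradient] using (hx (bistaticDeriv_smooth' hh 0 _)).neg.sub (hζ _)

theorem isNonstationary_phasePair (hh : 0 < h) (hL : IsCompact L) {Kx Ky : Set Plane}
    (hKx : IsCompact Kx) (hKy : IsCompact Ky) {Z : Set Ambient}
    (hZ : ∀ z ∈ Z, z.2.1 ∈ L ∧ z.2.2.1.2 ∈ Ky ∧ z.2.2.2.2 ∈ Kx) {c : ℝ} (hc : 0 < c)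
    (hlow : ∀ z ∈ Z, c * (z.2.2.1.1 ^ 2 + z.2.2.2.1 ^ 2 + ‖z.1.2‖ ^ 2) ≤
      ∑ i, pairGradient h z i ^ 2) :
    IsNonstationary coordField Finset.univ weightPair Z (phasePair h) where
  smooth := phasePair_smooth hh
  one_le z := by
    unfold weightPair
    linarith [abs_nonneg z.2.2.1.1, abs_nonneg z.2.2.2.1, norm_nonneg z.1.2]
  wt_le i _ z := by
    have h1 := abs_nonneg z.2.2.1.1
    have h2 := abs_nonneg z.2.2.2.1
    have h3 := norm_nonneg z.1.2
    cases i <;> simp [coordField, constField, linearField, weightPair] <;> linarith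
  symbol i _ := by
    simp only [phaseDeriv_eq_pairGradient hh]
    exact isSymbol_pairGradient hh hL hKx hKy hZ i
  lower := by
    refine ⟨min 1 c / 4, by positivity, fun z hz => ?_⟩
    simp only [phaseWeight, phaseDeriv_eq_pairGradient hh]
    have h1 := hlow z hz
    have h3 : min 1 c ≤ 1 := min_le_left _ _
    have h4 : min 1 c ≤ c := min_le_right _ _
    have h5 : 0 < min 1 c := by positivity
    have h6 := sq_abs z.2.2.1.1
    have h7 := sq_abs z.2.2.2.1
    have h8 : min 1 c * (z.2.2.1.1 ^ 2 + z.2.2.2.1 ^ 2 + ‖z.1.2‖ ^ 2) ≤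
        c * (z.2.2.1.1 ^ 2 + z.2.2.2.1 ^ 2 + ‖z.1.2‖ ^ 2) :=
      mul_le_mul_of_nonneg_right h4 (by positivity)
    have h9 : weightPair z ^ 2 ≤ 4 * (1 + (z.2.2.1.1 ^ 2 + z.2.2.2.1 ^ 2 + ‖z.1.2‖ ^ 2)) := by
      rw [← h6, ← h7]
      unfold weightPair
      generalize |z.2.2.1.1| = p
      generalize |z.2.2.2.1| = q
      generalize ‖z.1.2‖ = r
      nlinarith [sq_nonneg (1 - p), sq_nonneg (1 - q), sq_nonneg (1 - r), sq_nonneg (p - q),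
        sq_nonneg (p - r), sq_nonneg (q - r)]
    have h10 := mul_le_mul_of_nonneg_left h9 h5.le
    linarith

/-! #### Critical points and the canonical relations -/

/-- At a critical point of the phase, the covectors are related by `Δ`, `C₁`, `C₂` or `C₃`. -/
theorem mem_relations_of_critical (hh : 0 < h) {s t w : ℝ} (hs : 0 < s) (hw : w ≠ 0)
    {x y ξ η : Plane} (ht : t ≠ bistaticDist h s 0) (hx : t = bistaticDist h s x)
    (hy : t = bistaticDist h s y) (hD : bistaticDeriv h s x 1 0 = bistaticDeriv h s y 1 0)
    (hξ : ∀ i : Fin 2, ξ i = -(w * bistaticDeriv h s x 0 (EuclideanSpace.single i 1)))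
    (hη : ∀ i : Fin 2, η i = -(w * bistaticDeriv h s y 0 (EuclideanSpace.single i 1))) :
    (((x, ξ), (y, η)) : Cot × Cot) ∈ relDelta ∪ relC1 ∪ relC2 ∪ relC3 := by
  have hξ0 : ξ ≠ 0 := by
    rintro rfl
    refine ht (hx.trans ?_)
    rw [eq_zero_of_bistaticDeriv_eq_zero hh hs (x := x) fun i => ?_]
    have h1 := (hξ i).symm
    simpa [hw] using h1
  obtain ⟨h0, h1⟩ := sq_eq_of_bistatic_eq hh hs (hx.symm.trans hy) hD
  have key : ∀ σ τ : ℝ, (σ = 1 ∨ σ = -1) → (τ = 1 ∨ τ = -1) → y 0 = σ * x 0 → y 1 = τ * x 1 →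
      (((x, ξ), (y, η)) : Cot × Cot) ∈ canonicalGraph (signMap σ τ) := by
    intro σ τ hσ hτ e0 e1
    obtain ⟨d0, d1⟩ := bistaticDeriv_sign hh hσ hτ s e0 e1
    have f0 : η 0 = σ * ξ 0 := by rw [hη, hξ, d0]; ring
    have f1 : η 1 = τ * ξ 1 := by rw [hη, hξ, d1]; ring
    refine ⟨hξ0, ?_⟩
    rw [signMap_apply]
    refine Prod.ext ?_ ?_
    · ext i; fin_cases i <;> simpa
    · ext i; fin_cases i <;> simpa
  rw [relDelta, relC1, relC2, relC3, id_eq_signMap, chi1_eq_signMap, chi2_eq_signMap,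
    chi3_eq_signMap]
  rcases sq_eq_sq_iff_eq_or_eq_neg.1 h0.symm with e0 | e0 <;>
    rcases sq_eq_sq_iff_eq_or_eq_neg.1 h1.symm with e1 | e1
  · exact Or.inl (Or.inl (Or.inl (key 1 1 (by simp) (by simp) (by simpa) (by simpa))))
  · exact Or.inl (Or.inl (Or.inr (key 1 (-1) (by simp) (by simp) (by simpa) (by simpa))))
  · exact Or.inl (Or.inr (key (-1) 1 (by simp) (by simp) (by simpa) (by simpa)))
  · exact Or.inr (key (-1) (-1) (by simp) (by simp) (by simpa) (by simpa))

theorem covector_apply_single (ξ η : Plane) (i : Fin 2) :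
    covector ξ η (EuclideanSpace.single i 1, 0) = ξ i ∧
      covector ξ η (0, EuclideanSpace.single i 1) = η i := by
  simp [covector, EuclideanSpace.inner_single_right]

/-- Outside the relations the phase has no critical point over the support of the amplitude,
including the points `r = 0` at infinity of the cone of frequencies. -/
theorem exists_pairGradient_ne_zero (hh : 0 < h) (hL : IsAmplitudeSupport h a L)
    {x y ξ η : Plane}
    (hrel : (((x, ξ), (y, η)) : Cot × Cot) ∉ relDelta ∪ relC1 ∪ relC2 ∪ relC3) {δ w w' r : ℝ}
    {p : ℝ × ℝ} (hp : p ∈ L) (h1 : w ^ 2 + w' ^ 2 + r ^ 2 = 1) (hζ : covector ξ (-η) ≠ 0) :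
    ∃ i, pairGradient h ((δ, r • covector ξ (-η)), (p, ((w, y), (w', x)))) i ≠ 0 := by
  by_contra! h0
  have e_t : w' = w := by simpa [pairGradient, sub_eq_zero] using h0 .t
  subst e_t
  have e_s := h0 .s
  have e_w := h0 .w
  have e_w' := h0 .w'
  have e_y := fun i => h0 (.y i)
  have e_x := fun i => h0 (.x i)
  have c1 := fun i => (covector_apply_single ξ (-η) i).1
  have c2 := fun i => (covector_apply_single ξ (-η) i).2
  simp only [pairGradient, smul_apply, smul_eq_mul, c1, c2, PiLp.neg_apply] at e_s e_w e_w' e_y e_x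
  have hw : w' ≠ 0 := by
    rintro rfl
    have hr : r ≠ 0 := by
      rintro rfl
      norm_num at h1
    have hη0 : η = 0 := by
      ext i
      simpa [hr] using e_y i
    have hξ0 : ξ = 0 := by
      ext i
      simpa [hr] using e_x i
    exact hζ (ContinuousLinearMap.ext fun v => by simp [hη0, hξ0, covector])
  have hy : p.2 = bistaticDist h p.1 y := by
    have := (mul_eq_zero.1 (neg_eq_zero.1 e_w)).resolve_left hw
    linarith
  have hx : p.2 = bistaticDist h p.1 x := by
    have := (mul_eq_zero.1 e_w').resolve_left hw
    linarith
  have hD : bistaticDeriv h p.1 x 1 0 = bistaticDeriv h p.1 y 1 0 := by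
    have : w' * (bistaticDeriv h p.1 y 1 0 - bistaticDeriv h p.1 x 1 0) = 0 := by
      linear_combination e_s
    linarith [(mul_eq_zero.1 this).resolve_left hw]
  have hs : 0 < p.1 := (hL.subset hp).1
  by_cases hr : r = 0
  · refine hL.ne p hp (hx.trans ?_)
    rw [eq_zero_of_bistaticDeriv_eq_zero hh hs (x := x) fun i => ?_]
    have := e_x i
    simpa [hr, hw] using this
  · refine hrel (mem_relations_of_critical hh hs (div_ne_zero hw hr) (hL.ne p hp) hx hy hD
      (fun i => ?_) fun i => ?_)
    · have := e_x i
      field_simp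
      linarith
    · have := e_y i
      field_simp
      linarith

theorem pairGradient_homogeneous (δ δ' τ : ℝ) (ζ : Plane × Plane →L[ℝ] ℝ) (p : ℝ × ℝ) (w w' : ℝ)
    (x y : Plane) (i : Var) :
    pairGradient h ((δ, τ • ζ), (p, ((τ * w, y), (τ * w', x)))) i =
      τ * pairGradient h ((δ', ζ), (p, ((w, y), (w', x)))) i := by
  cases i <;> simp [pairGradient] <;> ring

/-- A data point and a vector of frequencies. -/
abbrev DataFreq : Type := (ℝ × ℝ) × (ℝ × ℝ × ℝ)

/-- A pair of ground points and a covector. -/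
abbrev PairCovector : Type := Plane × Plane × (Plane × Plane →L[ℝ] ℝ)

/-- Outside the relations, the phase is quantitatively nonstationary in a conic neighbourhood, by
compactness of the sphere of frequencies and homogeneity. -/
theorem exists_conic_neighbourhood (hh : 0 < h) (hL : IsAmplitudeSupport h a L)
    {x₀ y₀ ξ η : Plane}
    (hrel : (((x₀, ξ), (y₀, η)) : Cot × Cot) ∉ relDelta ∪ relC1 ∪ relC2 ∪ relC3)
    (hζ : covector ξ (-η) ≠ 0) :
    ∃ U ∈ 𝓝 x₀, ∃ U' ∈ 𝓝 y₀, ∃ Γ ∈ 𝓝 (covector ξ (-η)),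
      (∀ ζ ∈ Γ, ∀ r : ℝ, 0 < r → r • ζ ∈ Γ) ∧ ∃ c : ℝ, 0 < c ∧
        ∀ z : Ambient, z.2.1 ∈ L → z.2.2.1.2 ∈ U' → z.2.2.2.2 ∈ U → z.1.2 ∈ Γ →
          c * (z.2.2.1.1 ^ 2 + z.2.2.2.1 ^ 2 + ‖z.1.2‖ ^ 2) ≤ ∑ i, pairGradient h z i ^ 2 := by
  set ζ₀ := covector ξ (-η) with hζ₀
  let e : DataFreq × PairCovector → Ambient := fun q =>
    ((0, q.1.2.2.2 • q.2.2.2), (q.1.1, ((q.1.2.1, q.2.2.1), (q.1.2.2.1, q.2.1))))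
  have he : Continuous e := by fun_prop
  let G : DataFreq × PairCovector → ℝ := fun q => ∑ i, pairGradient h (e q) i ^ 2
  have hG : Continuous G :=
    continuous_finsetSum _ fun i _ => ((pairGradient_continuous hh i).comp he).pow 2
  let S : Set DataFreq := L ×ˢ {u : ℝ × ℝ × ℝ | u.1 ^ 2 + u.2.1 ^ 2 + u.2.2 ^ 2 = 1}
  have hS : IsCompact S := by
    refine hL.compact.prod (IsCompact.of_isClosed_subset
      ((isCompact_Icc (a := (-1 : ℝ)) (b := 1)).prod ((isCompact_Icc (a := (-1 : ℝ)) (b := 1)).prod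
        (isCompact_Icc (a := (-1 : ℝ)) (b := 1))))
      (isClosed_eq (by fun_prop) continuous_const) ?_)
    rintro ⟨u, v, r⟩ hu
    have hu' : u ^ 2 + v ^ 2 + r ^ 2 = 1 := hu
    have h1 := sq_nonneg u
    have h2 := sq_nonneg v
    have h3 := sq_nonneg r
    exact ⟨abs_le.1 ((sq_le_one_iff_abs_le_one u).1 (by linarith)),
      abs_le.1 ((sq_le_one_iff_abs_le_one v).1 (by linarith)),
      abs_le.1 ((sq_le_one_iff_abs_le_one r).1 (by linarith))⟩
  have hpos : ∀ τ ∈ S, 0 < G (τ, (x₀, y₀, ζ₀)) := by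
    rintro ⟨p, w, w', r⟩ ⟨hp, hu⟩
    obtain ⟨i, hi⟩ := exists_pairGradient_ne_zero hh hL hrel (δ := 0) hp hu hζ
    exact Finset.sum_pos' (fun i _ => sq_nonneg _) ⟨i, Finset.mem_univ i, by positivity⟩
  obtain ⟨c, hc, hcS⟩ := hS.exists_forall_le'
    (hG.comp (by fun_prop : Continuous fun τ : DataFreq =>
      (τ, ((x₀, y₀, ζ₀) : PairCovector)))).continuousOn hpos
  obtain ⟨u, v, -, hv, hSu, hv0, huv⟩ := generalized_tube_lemma hS (isCompact_singleton
    (x := ((x₀, y₀, ζ₀) : PairCovector))) (isOpen_lt (continuous_const (y := c / 2)) hG) (by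
      rintro ⟨τ, q⟩ ⟨hτ, rfl⟩
      have := hcS τ hτ
      change c / 2 < G _
      exact (half_lt_self hc).trans_le this)
  have hvn : v ∈ 𝓝 ((x₀, y₀, ζ₀) : PairCovector) := hv.mem_nhds (hv0 rfl)
  obtain ⟨U, hU, V, hV, hUV⟩ := mem_nhds_prod_iff.1 hvn
  obtain ⟨U', hU', Γ₀, hΓ₀, hUΓ⟩ := mem_nhds_prod_iff.1 hV
  set M := ‖ζ₀‖ + 1 with hM
  have hM1 : 1 ≤ M := by rw [hM]; linarith [norm_nonneg ζ₀]
  refine ⟨U, hU, U', hU', {ζ | ∃ r : ℝ, 0 < r ∧ r • ζ ∈ Γ₀ ∩ Metric.ball ζ₀ 1}, ?_, ?_, ?_⟩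
  · filter_upwards [inter_mem hΓ₀ (Metric.ball_mem_nhds ζ₀ one_pos)] with ζ hζ'
    exact ⟨1, one_pos, by simpa using hζ'⟩
  · rintro ζ ⟨r, hr, hrζ⟩ r' hr'
    refine ⟨r / r', by positivity, ?_⟩
    rwa [smul_smul, div_mul_cancel₀ _ hr'.ne']
  · refine ⟨c / 2 / M ^ 2, by positivity, ?_⟩
    rintro ⟨⟨δ, ζ⟩, p, ⟨w, y⟩, w', x⟩ hp hy hx ⟨r, hr, hrζ, hball⟩
    simp only at hp hy hx
    -- `ζ = ρ θ` with `θ` close to `ζ₀`; the frequencies `(w, w', ρ)` are scaled to the sphere.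
    set θ := r • ζ with hθ
    have hζθ : ζ = r⁻¹ • θ := by rw [hθ, smul_smul, inv_mul_cancel₀ hr.ne', one_smul]
    have hρ : 0 < r⁻¹ := by positivity
    set ρ := r⁻¹
    have hθM : ‖θ‖ ≤ M := by
      have h1 : ‖θ - ζ₀‖ < 1 := by simpa [dist_eq_norm] using hball
      have h2 : ‖θ‖ ≤ ‖θ - ζ₀‖ + ‖ζ₀‖ := by simpa using norm_add_le (θ - ζ₀) ζ₀
      rw [hM]
      linarith
    have hsum : 0 < w ^ 2 + w' ^ 2 + ρ ^ 2 := by positivity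
    set κ := √(w ^ 2 + w' ^ 2 + ρ ^ 2) with hκ
    have hκ0 : 0 < κ := Real.sqrt_pos.2 hsum
    have hκ2 : κ ^ 2 = w ^ 2 + w' ^ 2 + ρ ^ 2 := Real.sq_sqrt hsum.le
    have hmem : ((p, (κ⁻¹ * w, κ⁻¹ * w', κ⁻¹ * ρ)) : DataFreq) ∈ S := by
      refine ⟨hp, ?_⟩
      change (κ⁻¹ * w) ^ 2 + (κ⁻¹ * w') ^ 2 + (κ⁻¹ * ρ) ^ 2 = 1
      field_simp
      linarith
    have hlow : c / 2 < G ((p, (κ⁻¹ * w, κ⁻¹ * w', κ⁻¹ * ρ)), (x, y, θ)) :=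
      huv (mk_mem_prod (hSu hmem) (hUV (mk_mem_prod hx (hUΓ (mk_mem_prod hy hrζ)))))
    have hscale : ∑ i, pairGradient h ((δ, ζ), (p, ((w, y), (w', x)))) i ^ 2 =
        κ ^ 2 * G ((p, (κ⁻¹ * w, κ⁻¹ * w', κ⁻¹ * ρ)), (x, y, θ)) := by
      rw [Finset.mul_sum]
      refine Finset.sum_congr rfl fun i _ => ?_
      have h1 := pairGradient_homogeneous (h := h) 0 δ κ⁻¹ ζ p w w' x y i
      have h2 : e ((p, (κ⁻¹ * w, κ⁻¹ * w', κ⁻¹ * ρ)), (x, y, θ)) =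
          ((0, κ⁻¹ • ζ), (p, ((κ⁻¹ * w, y), (κ⁻¹ * w', x)))) := by
        simp only [e, hζθ, smul_smul]
      rw [h2, h1]
      field_simp
    rw [hscale]
    have hζn : ‖ζ‖ ≤ ρ * M := by
      rw [hζθ, norm_smul, Real.norm_of_nonneg hρ.le]
      gcongr
    have h3 : ‖ζ‖ ^ 2 ≤ ρ ^ 2 * M ^ 2 := by
      rw [← mul_pow]
      exact pow_le_pow_left₀ (norm_nonneg ζ) hζn 2
    have hM2 : 1 ≤ M ^ 2 := one_le_pow₀ hM1
    have h4 : w ^ 2 + w' ^ 2 + ‖ζ‖ ^ 2 ≤ κ ^ 2 * M ^ 2 := by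
      rw [hκ2]
      nlinarith [mul_nonneg (sub_nonneg.2 hM2) (sq_nonneg w),
        mul_nonneg (sub_nonneg.2 hM2) (sq_nonneg w')]
    calc c / 2 / M ^ 2 * (w ^ 2 + w' ^ 2 + ‖ζ‖ ^ 2) ≤ c / 2 / M ^ 2 * (κ ^ 2 * M ^ 2) := by gcongr
      _ = κ ^ 2 * (c / 2) := by field_simp
      _ ≤ _ := by gcongr

end PairPhase

/-! ### Rapid decay of the localized Fourier transform of the kernel -/

section PairIntegral

variable {h ε m : ℝ} {a : (ℝ × ℝ) × Plane → ℝ → ℂ} {L : Set (ℝ × ℝ)}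

/-- The points over `L` and the supports of the two cutoffs. -/
def regionPair (L : Set (ℝ × ℝ)) (Kx Ky : Set Plane) : Set Ambient :=
  {z | z.2.1 ∈ L ∧ z.2.2.1.2 ∈ Ky ∧ z.2.2.2.2 ∈ Kx}

theorem isClosed_regionPair (hL : IsClosed L) {Kx Ky : Set Plane} (hKx : IsClosed Kx)
    (hKy : IsClosed Ky) : IsClosed (regionPair L Kx Ky) :=
  (hL.preimage (by fun_prop : Continuous fun z : Ambient => z.2.1)).inter
    ((hKy.preimage (by fun_prop : Continuous fun z : Ambient => z.2.2.1.2)).inter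
      (hKx.preimage (by fun_prop : Continuous fun z : Ambient => z.2.2.2.2)))

/-- The amplitude of the regularized pairing of `F (ψ e^{-i η ·})` with `F (conj φ e^{i ξ ·})`. -/
def ampPair (a : (ℝ × ℝ) × Plane → ℝ → ℂ) (φ ψ : Test Plane) (z : Ambient) : ℂ :=
  (gaussFst z * gaussSnd z) * ((a (z.2.1, z.2.2.1.2) z.2.2.1.1 *
    (starRingEnd ℂ) (a (z.2.1, z.2.2.2.2) z.2.2.2.1)) * (ψ z.2.2.1.2 * φ z.2.2.2.2))

theorem support_ampPair (hL : IsAmplitudeSupport h a L) (φ ψ : Test Plane) :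
    Function.support (ampPair a φ ψ) ⊆ regionPair L (tsupport φ) (tsupport ψ) := by
  intro z hz
  by_contra hzW
  refine hz ?_
  by_cases h1 : z.2.1 ∈ L
  · by_cases h2 : z.2.2.1.2 ∈ tsupport ψ
    · have h3 : z.2.2.2.2 ∉ tsupport φ := fun h3 => hzW ⟨h1, h2, h3⟩
      simp [ampPair, image_eq_zero_of_notMem_tsupport h3]
    · simp [ampPair, image_eq_zero_of_notMem_tsupport h2]
  · simp [ampPair, hL.zero _ h1]

/-- The weight `1 + |w'|`. -/
def weightSnd (z : Ambient) : ℝ := 1 + |z.2.2.2.1|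

theorem weightSnd_pos (z : Ambient) : 0 < weightSnd z := by
  unfold weightSnd
  positivity

theorem weightFst_le_weightPair (z : Ambient) : weightFst z ≤ weightPair z := by
  unfold weightFst weightPair
  linarith [abs_nonneg z.2.2.2.1, norm_nonneg z.1.2]

theorem weightSnd_le_weightPair (z : Ambient) : weightSnd z ≤ weightPair z := by
  unfold weightSnd weightPair
  linarith [abs_nonneg z.2.2.1.1, norm_nonneg z.1.2]

theorem weightPair_le_mul (z : Ambient) :
    weightPair z ≤ (1 + ‖z.1.2‖) * (weightFst z * weightSnd z) := by
  unfold weightPair weightFst weightSnd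
  have h1 := abs_nonneg z.2.2.1.1
  have h2 := abs_nonneg z.2.2.2.1
  have h3 := norm_nonneg z.1.2
  generalize |z.2.2.1.1| = p at *
  generalize |z.2.2.2.1| = q at *
  generalize ‖z.1.2‖ = r at *
  have h4 := mul_nonneg h1 h2
  nlinarith [mul_nonneg h3 h1, mul_nonneg h3 h2, mul_nonneg h3 h4]

theorem isSymbol_ampPair_of_gauss (ha : IsAmplitude h ε m a) (hL : IsAmplitudeSupport h a L)
    (φ ψ : Test Plane) {Z : Set Ambient} (hZ : Z ⊆ regionPair L (tsupport φ) (tsupport ψ))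
    {ρ ρ' : Ambient → ℝ} (hg : IsSymbol coordField Z ρ gaussFst)
    (hg' : IsSymbol coordField Z ρ' gaussSnd) :
    IsSymbol coordField Z (fun z => (ρ z * ρ' z) *
      (weightFst z ^ orderBound m * weightSnd z ^ orderBound m)) (ampPair a φ ψ) := by
  have hφ : ContDiff ℝ ∞ (fun q : (ℝ × ℝ) × Plane => φ q.2) := (test_smooth φ).comp contDiff_snd
  have hψ : ContDiff ℝ ∞ (fun q : (ℝ × ℝ) × Plane => ψ q.2) := (test_smooth ψ).comp contDiff_snd
  have hy : ∀ z ∈ Z, z.2.1 ∈ L ∧ z.2.2.1.2 ∈ tsupport ψ := fun z hz =>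
    ⟨(hZ hz).1, (hZ hz).2.1⟩
  have hx : ∀ z ∈ Z, z.2.1 ∈ L ∧ z.2.2.2.2 ∈ tsupport φ := fun z hz =>
    ⟨(hZ hz).1, (hZ hz).2.2⟩
  have h1 := isSymbol_amplitude_fst ha hL.compact hL.subset ψ.hasCompactSupport hy
  have h2 := (isSymbol_amplitude_snd ha hL.compact hL.subset φ.hasCompactSupport hx).conj
  have h3 := (isSymbol_fst hψ hL.compact ψ.hasCompactSupport hy).mul
    (isSymbol_snd hφ hL.compact φ.hasCompactSupport hx)
  have h4 := (hg.mul hg').mul ((h1.mul h2).mul h3)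
  simp only [mul_one] at h4
  exact h4

/-- The inclusion of all integration variables. -/
def inclPair : (ℝ × ℝ) × (FreqPoint × FreqPoint) →L[ℝ] Ambient := ContinuousLinearMap.inr ℝ _ _

theorem base_add_inclPair (c : ℝ × (Plane × Plane →L[ℝ] ℝ))
    (u : (ℝ × ℝ) × (FreqPoint × FreqPoint)) : ((c, 0) : Ambient) + inclPair u = (c, u) := by
  simp [inclPair]

theorem rapid_ampPair (ha : IsAmplitude h ε m a) (hL : IsAmplitudeSupport h a L)
    (φ ψ : Test Plane) {δ : ℝ} (hδ : 0 < δ) (ζ : Plane × Plane →L[ℝ] ℝ) :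
    RapidOnSlice inclPair coordField weightPair (regionPair L (tsupport φ) (tsupport ψ))
      ((δ, ζ), 0) (ampPair a φ ψ) := by
  intro k
  have h1 : ∀ z ∈ affineSlice inclPair (regionPair L (tsupport φ) (tsupport ψ)) ((δ, ζ), 0),
      z.1 = (δ, ζ) := by
    rintro z ⟨-, u, rfl⟩
    rw [base_add_inclPair]
  have h2 := isSymbol_ampPair_of_gauss ha hL φ ψ (fun z hz => hz.1)
    (isSymbol_gaussFst (gaussFamily_rapid coDelta (coFreq.comp coFst) hδ
      (fun z hz => congrArg Prod.fst (h1 z hz)) (k + orderBound m)))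
    (isSymbol_gaussSnd (gaussFamily_rapid coDelta (coFreq.comp coSnd) hδ
      (fun z hz => congrArg Prod.fst (h1 z hz)) (k + orderBound m)))
  refine h2.mono subset_rfl (K := (1 + ‖ζ‖) ^ k) fun z hz => ?_
  have h3 := weightFst_pos z
  have h4 := weightSnd_pos z
  have h5 := weightPair_pos z
  have h6 : 1 + |(coFreq.comp coFst) z| = weightFst z := rfl
  have h7 : 1 + |(coFreq.comp coSnd) z| = weightSnd z := rfl
  rw [h6, h7]
  refine ⟨by positivity, ?_⟩
  have h8 : weightPair z ^ k ≤ (1 + ‖ζ‖) ^ k * (weightFst z ^ k * weightSnd z ^ k) := by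
    rw [← mul_pow, ← mul_pow]
    have h9 := weightPair_le_mul z
    rw [h1 z hz] at h9
    exact pow_le_pow_left₀ h5.le h9 k
  calc (weightFst z ^ (k + orderBound m))⁻¹ * (weightSnd z ^ (k + orderBound m))⁻¹ *
        (weightFst z ^ orderBound m * weightSnd z ^ orderBound m)
      = (weightFst z ^ k * weightSnd z ^ k)⁻¹ := by
        rw [pow_add, pow_add]
        field_simp
    _ ≤ (1 + ‖ζ‖) ^ k * (weightPair z ^ k)⁻¹ := by
        rw [← div_eq_mul_inv, le_div_iff₀ (by positivity), inv_mul_le_iff₀ (by positivity)]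
        linarith

/-- An integrable majorant of amplitudes of order `-4` supported over `L` and the cutoffs. -/
def envelopePair (L : Set (ℝ × ℝ)) (Kx Ky : Set Plane)
    (u : (ℝ × ℝ) × (FreqPoint × FreqPoint)) : ℝ :=
  L.indicator 1 u.1 * (envelope Ky u.2.1 * envelope Kx u.2.2)

theorem envelopePair_integrable (hL : IsCompact L) {Kx Ky : Set Plane} (hKx : IsCompact Kx)
    (hKy : IsCompact Ky) : Integrable (envelopePair L Kx Ky) := by
  have h1 : Integrable (L.indicator (1 : ℝ × ℝ → ℝ)) :=
    (integrable_indicator_iff hL.measurableSet).2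
      (integrableOn_const (hs := hL.measure_lt_top.ne))
  exact h1.mul_prod ((envelope_integrable hKy).mul_prod (envelope_integrable hKx))

theorem envelopePair_nonneg (Kx Ky : Set Plane) (u : (ℝ × ℝ) × (FreqPoint × FreqPoint)) :
    0 ≤ envelopePair L Kx Ky u :=
  mul_nonneg (indicator_nonneg (fun _ _ => zero_le_one) _)
    (mul_nonneg (envelope_nonneg _ _) (envelope_nonneg _ _))

theorem inv_weightPair_le_envelopePair {Kx Ky : Set Plane} {c : ℝ × (Plane × Plane →L[ℝ] ℝ)}
    {u : (ℝ × ℝ) × (FreqPoint × FreqPoint)} (hu : (c, u) ∈ regionPair L Kx Ky) :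
    (weightPair (c, u) ^ 4)⁻¹ ≤ envelopePair L Kx Ky u := by
  have h3 := weightFst_pos (c, u)
  have h4 := weightSnd_pos (c, u)
  have h5 : envelopePair L Kx Ky u = (weightFst (c, u) ^ 2 * weightSnd (c, u) ^ 2)⁻¹ := by
    rw [envelopePair, indicator_of_mem hu.1, envelope, envelope, indicator_of_mem hu.2.1,
      indicator_of_mem hu.2.2]
    simp only [Pi.one_apply, mul_one, one_mul, mul_inv]
    rfl
  rw [h5]
  refine inv_anti₀ (by positivity) ?_
  calc weightFst (c, u) ^ 2 * weightSnd (c, u) ^ 2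
      ≤ weightPair (c, u) ^ 2 * weightPair (c, u) ^ 2 := by
        gcongr
        · exact weightFst_le_weightPair _
        · exact weightSnd_le_weightPair _
    _ = weightPair (c, u) ^ 4 := by ring

theorem integrable_indicator_regionPair (hL : IsCompact L) {Kx Ky : Set Plane}
    (hKx : IsCompact Kx) (hKy : IsCompact Ky) (c : ℝ × (Plane × Plane →L[ℝ] ℝ)) :
    Integrable (fun u : (ℝ × ℝ) × (FreqPoint × FreqPoint) => (regionPair L Kx Ky).indicator
      (fun z => (weightPair z ^ 4)⁻¹) (((c, 0) : Ambient) + inclPair u)) := by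
  have hw : Continuous fun u : (ℝ × ℝ) × (FreqPoint × FreqPoint) =>
      (weightPair (c, u) ^ 4)⁻¹ := by
    have h1 : Continuous fun u : (ℝ × ℝ) × (FreqPoint × FreqPoint) => weightPair (c, u) := by
      unfold weightPair
      fun_prop
    exact (h1.pow 4).inv₀ fun u => (pow_pos (weightPair_pos (c, u)) 4).ne'
  have hcl : IsClosed ((fun u : (ℝ × ℝ) × (FreqPoint × FreqPoint) => ((c, u) : Ambient)) ⁻¹'
      regionPair L Kx Ky) :=
    (isClosed_regionPair hL.isClosed hKx.isClosed hKy.isClosed).preimage (by fun_prop)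
  have hm := hw.measurable.indicator hcl.measurableSet
  simp only [base_add_inclPair]
  refine (envelopePair_integrable hL hKx hKy).mono' hm.aestronglyMeasurable
    (Eventually.of_forall fun u => ?_)
  by_cases hu : ((c, u) : Ambient) ∈ regionPair L Kx Ky
  · rw [indicator_of_mem (by exact hu),
      Real.norm_of_nonneg (inv_nonneg.2 (pow_pos (weightPair_pos _) 4).le)]
    exact inv_weightPair_le_envelopePair hu
  · rw [indicator_of_notMem (by exact hu), norm_zero]
    exact envelopePair_nonneg _ _ _

theorem coordField_dir_mem_range (i : Var) :
    (coordField i).dir ∈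
      LinearMap.range (inclPair : (ℝ × ℝ) × (FreqPoint × FreqPoint) →ₗ[ℝ] Ambient) := by
  refine ⟨(coordField i).dir.2, Prod.ext ?_ rfl⟩
  cases i <;> rfl

/-- Rapid decay of the regularized pairing, uniformly in `δ`, on a cone where the phase is
nonstationary. -/
theorem pair_integral_rapid (hh : 0 < h) (ha : IsAmplitude h ε m a)
    (hL : IsAmplitudeSupport h a L) (φ ψ : Test Plane) {Γ : Set (Plane × Plane →L[ℝ] ℝ)} {c : ℝ}
    (hc : 0 < c) (hlow : ∀ z ∈ regionPair L (tsupport φ) (tsupport ψ), z.1.2 ∈ Γ →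
      c * (z.2.2.1.1 ^ 2 + z.2.2.2.1 ^ 2 + ‖z.1.2‖ ^ 2) ≤ ∑ i, pairGradient h z i ^ 2) (N : ℕ) :
    ∃ C : ℝ, ∀ ζ ∈ Γ, ∀ δ > 0, (1 + ‖ζ‖) ^ N * ‖∫ u : (ℝ × ℝ) × (FreqPoint × FreqPoint),
      oscillation (phasePair h) ((δ, ζ), u) * ampPair a φ ψ ((δ, ζ), u)‖ ≤ C := by
  have hKx : IsCompact (tsupport φ) := φ.hasCompactSupport
  have hKy : IsCompact (tsupport ψ) := ψ.hasCompactSupport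
  set W := regionPair L (tsupport φ) (tsupport ψ) with hW
  set Z : Set Ambient := {z ∈ W | 0 ≤ coDelta z ∧ z.1.2 ∈ Γ} with hZ
  have hΦ : IsNonstationary coordField Finset.univ weightPair Z (phasePair h) :=
    isNonstationary_phasePair hh hL.compact hKx hKy (fun z hz => hz.1) hc
      fun z hz => hlow z hz.1 hz.2.2
  set M := orderBound m
  have hA : IsSymbol coordField Z (fun z => weightPair z ^ (2 * M)) (ampPair a φ ψ) := by
    refine (isSymbol_ampPair_of_gauss ha hL φ ψ (fun z (hz : z ∈ Z) => hz.1)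
      (isSymbol_gaussFst (gaussFamily_bounded coDelta (coFreq.comp coFst) fun z hz => hz.2.1))
      (isSymbol_gaussSnd (gaussFamily_bounded coDelta (coFreq.comp coSnd)
        fun z hz => hz.2.1))).mono subset_rfl (K := 1) fun z _ => ?_
    have h3 := weightFst_pos z
    have h4 := weightSnd_pos z
    have h5 := weightPair_pos z
    refine ⟨by positivity, ?_⟩
    rw [one_mul, one_mul, one_mul, two_mul, pow_add]
    gcongr
    · exact weightFst_le_weightPair z
    · exact weightSnd_le_weightPair z
  obtain ⟨B, hB, hBs, hBi⟩ := exists_amplitude_gain (L := inclPair)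
    (volume : Measure ((ℝ × ℝ) × (FreqPoint × FreqPoint))) hΦ
    (fun i _ => coordField_dir_mem_range i)
    (isClosed_regionPair hL.compact.isClosed hKx.isClosed hKy.isClosed)
    (fun z => pow_nonneg (weightPair_pos z).le _) hA (support_ampPair hL φ ψ) (2 * M + (4 + N))
  obtain ⟨C, hC⟩ := hB.exists_bound
  refine ⟨∫ u, |C| * envelopePair L (tsupport φ) (tsupport ψ) u, fun ζ hζ δ hδ => ?_⟩
  have hslice : affineSlice inclPair W ((δ, ζ), 0) ⊆ Z := by
    rintro z ⟨hz, u, rfl⟩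
    refine ⟨hz, ?_⟩
    rw [base_add_inclPair]
    exact ⟨hδ.le, hζ⟩
  have heq := hBi ((δ, ζ), 0) 4 hslice (rapid_ampPair ha hL φ ψ hδ ζ)
    (integrable_indicator_regionPair hL.compact hKx hKy _)
  simp only [base_add_inclPair] at heq
  rw [heq]
  have hζN : (0 : ℝ) < (1 + ‖ζ‖) ^ N := by positivity
  have hbound : ∀ u : (ℝ × ℝ) × (FreqPoint × FreqPoint),
      ‖oscillation (phasePair h) ((δ, ζ), u) * B ((δ, ζ), u)‖ ≤
        ((1 + ‖ζ‖) ^ N)⁻¹ * (|C| * envelopePair L (tsupport φ) (tsupport ψ) u) := by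
    intro u
    rw [norm_mul, norm_oscillation, one_mul]
    by_cases hu : (((δ, ζ), u) : Ambient) ∈ W
    · have h1 := hC ((δ, ζ), u) ⟨hu, hδ.le, hζ⟩
      have hp := weightPair_pos ((δ, ζ), u)
      have h2 : 1 + ‖ζ‖ ≤ weightPair ((δ, ζ), u) := by
        unfold weightPair
        linarith [abs_nonneg u.2.1.1, abs_nonneg u.2.2.1]
      refine h1.trans ?_
      calc C * (weightPair ((δ, ζ), u) ^ (2 * M) * (weightPair ((δ, ζ), u) ^ (2 * M + (4 + N)))⁻¹)
          = C * ((weightPair ((δ, ζ), u) ^ N)⁻¹ * (weightPair ((δ, ζ), u) ^ 4)⁻¹) := by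
            rw [pow_add, pow_add]
            field_simp
        _ ≤ |C| * (((1 + ‖ζ‖) ^ N)⁻¹ * envelopePair L (tsupport φ) (tsupport ψ) u) := by
            have h3 : (weightPair ((δ, ζ), u) ^ N)⁻¹ ≤ ((1 + ‖ζ‖) ^ N)⁻¹ :=
              inv_anti₀ hζN (pow_le_pow_left₀ (by positivity) h2 N)
            have h4 := inv_weightPair_le_envelopePair hu
            refine mul_le_mul (le_abs_self C) (mul_le_mul h3 h4 (by positivity) (by positivity))
              (by positivity) (abs_nonneg C)
        _ = _ := by ring
    · have h0 : B ((δ, ζ), u) = 0 := by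
        by_contra h0
        exact hu (hBs h0)
      rw [h0, norm_zero]
      exact mul_nonneg (by positivity) (mul_nonneg (abs_nonneg C) (envelopePair_nonneg _ _ _))
  have hint := (envelopePair_integrable hL.compact hKx hKy).const_mul |C|
  have h1 := norm_integral_le_of_norm_le (hint.const_mul ((1 + ‖ζ‖) ^ N)⁻¹)
    (Eventually.of_forall hbound)
  rw [integral_const_mul] at h1
  calc (1 + ‖ζ‖) ^ N * ‖∫ u, oscillation (phasePair h) ((δ, ζ), u) * B ((δ, ζ), u)‖
      ≤ (1 + ‖ζ‖) ^ N * (((1 + ‖ζ‖) ^ N)⁻¹ *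
          ∫ u, |C| * envelopePair L (tsupport φ) (tsupport ψ) u) := by gcongr
    _ = _ := by field_simp

/-! #### The pairing as an oscillatory integral -/

/-- The restriction of a covector on `X × X` to the first factor. -/
def covFst (ζ : Plane × Plane →L[ℝ] ℝ) : Plane →L[ℝ] ℝ :=
  ζ.comp (ContinuousLinearMap.inl ℝ Plane Plane)

/-- The restriction of a covector on `X × X` to the second factor. -/
def covSnd (ζ : Plane × Plane →L[ℝ] ℝ) : Plane →L[ℝ] ℝ :=
  ζ.comp (ContinuousLinearMap.inr ℝ Plane Plane)

theorem cov_apply (ζ : Plane × Plane →L[ℝ] ℝ) (x y : Plane) :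
    ζ (x, y) = covFst ζ x + covSnd ζ y := by
  rw [covFst, covSnd, ContinuousLinearMap.comp_apply, ContinuousLinearMap.comp_apply, ← map_add]
  simp

@[simp] theorem modulate_apply {E : Type*} [NormedAddCommGroup E] [NormedSpace ℝ E] (χ : Test E)
    (ζ : E →L[ℝ] ℝ) (x : E) :
    modulate χ ζ x = χ x * Complex.exp (-Complex.I * (ζ x : ℂ)) := rfl

@[simp] theorem conjTest_apply {E : Type*} [NormedAddCommGroup E] [NormedSpace ℝ E] (χ : Test E)
    (x : E) : conjTest χ x = (starRingEnd ℂ) (χ x) := rfl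

@[simp] theorem tensor_apply (φ ψ : Test Plane) (z : Plane × Plane) :
    tensor φ ψ z = φ z.1 * ψ z.2 := rfl

theorem modulate_tensor (φ ψ : Test Plane) (ζ : Plane × Plane →L[ℝ] ℝ) :
    modulate (tensor φ ψ) ζ =
      tensor (conjTest (conjTest (modulate φ (covFst ζ)))) (modulate ψ (covSnd ζ)) := by
  ext ⟨x, y⟩
  simp only [modulate_apply, tensor_apply, conjTest_apply, Complex.conj_conj]
  rw [cov_apply, Complex.ofReal_add, mul_add, Complex.exp_add]
  ring

theorem integrand_mul_conj (φ ψ : Test Plane) (ζ : Plane × Plane →L[ℝ] ℝ) (δ : ℝ) (p : ℝ × ℝ)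
    (u : FreqPoint × FreqPoint) :
    (oscillation (phaseFst h) ((δ, 0), (p, (u.1, 0))) *
        ampFst a (modulate ψ (covSnd ζ)) ((δ, 0), (p, (u.1, 0)))) *
      (starRingEnd ℂ) (oscillation (phaseFst h) ((δ, 0), (p, (u.2, 0))) *
        ampFst a (conjTest (modulate φ (covFst ζ))) ((δ, 0), (p, (u.2, 0)))) =
      oscillation (phasePair h) ((δ, ζ), (p, u)) * ampPair a φ ψ ((δ, ζ), (p, u)) := by
  have e1 : oscillation (phasePair h) ((δ, ζ), (p, u)) =
      oscillation (phaseFst h) ((δ, 0), (p, (u.1, 0))) *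
        (starRingEnd ℂ) (oscillation (phaseFst h) ((δ, 0), (p, (u.2, 0)))) *
          (Complex.exp (-Complex.I * (covFst ζ u.2.2 : ℂ)) *
            Complex.exp (-Complex.I * (covSnd ζ u.1.2 : ℂ))) := by
    simp only [oscillation, ← Complex.exp_conj, map_mul, Complex.conj_I, Complex.conj_ofReal,
      ← Complex.exp_add]
    congr 1
    simp only [phasePair, phaseFst, coFst_apply, coSnd_apply, cov_apply]
    push_cast
    ring
  have e2 : gaussFst ((δ, 0), (p, (u.1, 0))) = gaussFst ((δ, ζ), (p, u)) := rfl
  have e3 : (starRingEnd ℂ) (gaussFst ((δ, 0), (p, (u.2, 0)))) = gaussSnd ((δ, ζ), (p, u)) :=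
    Complex.conj_ofReal _
  rw [e1]
  simp only [ampFst, ampPair, map_mul, e2, e3, modulate_apply, conjTest_apply, Complex.conj_conj]
  ring

theorem setIntegral_regularizedF (hh : 0 < h) (ha : IsAmplitude h ε m a)
    (hL : IsAmplitudeSupport h a L) (φ ψ : Test Plane) (ζ : Plane × Plane →L[ℝ] ℝ) {δ : ℝ}
    (hδ : 0 < δ) :
    ∫ p in dataSpace, regularizedF h a (modulate ψ (covSnd ζ)) p δ *
        (starRingEnd ℂ) (regularizedF h a (conjTest (modulate φ (covFst ζ))) p δ) =
      ∫ u : (ℝ × ℝ) × (FreqPoint × FreqPoint),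
        oscillation (phasePair h) ((δ, ζ), u) * ampPair a φ ψ ((δ, ζ), u) := by
  have hint : Integrable (fun u : (ℝ × ℝ) × (FreqPoint × FreqPoint) =>
      oscillation (phasePair h) ((δ, ζ), u) * ampPair a φ ψ ((δ, ζ), u)) := by
    have h1 := rapid_ampPair ha hL φ ψ hδ ζ
    have hosc := (oscillation_smooth (phasePair_smooth hh)).continuous
    have h2 := integrable_slice (L := inclPair) (c := ((δ, ζ), 0)) (Λ := weightPair) (r := 4)
      (volume : Measure ((ℝ × ℝ) × (FreqPoint × FreqPoint)))
      (G := fun z => oscillation (phasePair h) z * ampPair a φ ψ z)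
      (hosc.mul (h1 0).smooth.continuous)
      ((Function.support_mul_subset_right _ _).trans (support_ampPair hL φ ψ))
      (by simpa [norm_oscillation] using (h1 4).exists_bound)
      (integrable_indicator_regionPair hL.compact φ.hasCompactSupport ψ.hasCompactSupport _)
    simpa only [base_add_inclPair] using h2
  rw [setIntegral_eq_integral_of_forall_compl_eq_zero fun p hp => ?_]
  · rw [Measure.volume_eq_prod] at hint
    refine Eq.trans ?_ (integral_prod _ hint).symm
    congr 1
    funext p
    rw [(regularizedF_eq_integral ha hh hL _ hδ p).2, (regularizedF_eq_integral ha hh hL _ hδ p).2,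
      ← integral_conj, ← integral_prod_mul, ← Measure.volume_eq_prod]
    congr 1
    funext u
    exact integrand_mul_conj φ ψ ζ δ p u
  · rw [regularizedF_eq_zero hL _ fun h1 => hp (hL.subset h1), zero_mul]

/-- The pairing `⟨F V, F U⟩` is the limit of its regularizations. -/
theorem tendsto_setIntegral_regularizedF (hh : 0 < h) (ha : IsAmplitude h ε m a)
    (hL : IsAmplitudeSupport h a L) (U V : Test Plane) :
    Tendsto (fun δ => ∫ p in dataSpace, regularizedF h a V p δ *
        (starRingEnd ℂ) (regularizedF h a U p δ)) (𝓝[>] (0 : ℝ))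
      (𝓝 (∫ p in dataSpace, opF h a V p * (starRingEnd ℂ) (opF h a U p))) := by
  obtain ⟨C, hC⟩ := (regularizedF_bounded_and_converges hh ha hL V).1
  obtain ⟨C', hC'⟩ := (regularizedF_bounded_and_converges hh ha hL U).1
  refine tendsto_integral_filter_of_dominated_convergence
    (L.indicator fun _ => |C| * |C'|) ?_ ?_ ?_ (Eventually.of_forall fun p => ?_)
  · filter_upwards [self_mem_nhdsWithin] with δ hδ
    exact ((measurable_regularizedF hh ha hL V hδ).mul
      (Complex.continuous_conj.comp_stronglyMeasurable
        (measurable_regularizedF hh ha hL U hδ))).aestronglyMeasurable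
  · filter_upwards [self_mem_nhdsWithin] with δ hδ
    refine Eventually.of_forall fun p => ?_
    by_cases hp : p ∈ L
    · rw [indicator_of_mem hp, norm_mul, RCLike.norm_conj]
      exact mul_le_mul ((hC p δ hδ).trans (le_abs_self C)) ((hC' p δ hδ).trans (le_abs_self C'))
        (norm_nonneg _) (abs_nonneg C)
    · rw [indicator_of_notMem hp, regularizedF_eq_zero hL V hp]
      simp
  · exact ((integrable_indicator_iff hL.compact.measurableSet).2
      (integrableOn_const (hs := hL.compact.measure_lt_top.ne))).restrict
  · exact (tendsto_regularizedF hh ha hL V p).mul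
      ((Complex.continuous_conj.tendsto _).comp (tendsto_regularizedF hh ha hL U p))

/-! #### The wavefront set of the kernel -/

theorem exists_cutoff {x : Plane} {U : Set Plane} (hU : U ∈ 𝓝 x) :
    ∃ φ : Test Plane, φ x ≠ 0 ∧ tsupport φ ⊆ U := by
  obtain ⟨f, hfU, hfc, hfs, -, hfx⟩ := exists_contDiff_tsupport_subset (n := ⊤) hU
  have h1 : tsupport (fun y => (f y : ℂ)) ⊆ tsupport f :=
    closure_mono fun y hy h0 => hy (by simp [h0])
  refine ⟨⟨fun y => (f y : ℂ), Complex.ofRealCLM.contDiff.comp hfs,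
    hfc.comp_left (g := fun r : ℝ => (r : ℂ)) (by simp), fun _ _ => trivial⟩, ?_, h1.trans hfU⟩
  change ((f x : ℝ) : ℂ) ≠ 0
  rw [hfx]
  simp

theorem twistedWavefrontSet_subset (hh : 0 < h) (hε : 0 < ε) (ha : IsAmplitude h ε m a)
    {K : Distr (Plane × Plane)} (hK : IsNormalKernel h a K) :
    twistedWavefrontSet K ⊆ relDelta ∪ relC1 ∪ relC2 ∪ relC3 := by
  rintro ⟨⟨x₀, ξ⟩, y₀, η⟩ ⟨hζ, hsing⟩
  by_contra hrel
  refine hsing ?_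
  obtain ⟨L, hL⟩ := ha.exists_support hh hε
  obtain ⟨U, hU, U', hU', Γ, hΓ, hcone, c, hc, hlow⟩ := exists_conic_neighbourhood hh hL hrel hζ
  obtain ⟨φ, hφ, hφU⟩ := exists_cutoff hU
  obtain ⟨ψ, hψ, hψU⟩ := exists_cutoff hU'
  refine ⟨tensor φ ψ, mul_ne_zero hφ hψ, Γ, hΓ, hcone, fun N => ?_⟩
  obtain ⟨C, hC⟩ := pair_integral_rapid hh ha hL φ ψ hc
    (fun z hz hzΓ => hlow z hz.1 (hψU hz.2.1) (hφU hz.2.2) hzΓ) N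
  refine ⟨C, fun ζ hζΓ => ?_⟩
  rw [modulate_tensor, hK]
  refine le_of_tendsto (((tendsto_setIntegral_regularizedF hh ha hL _ _).norm).const_mul _) ?_
  filter_upwards [self_mem_nhdsWithin] with δ hδ
  rw [setIntegral_regularizedF hh ha hL φ ψ ζ hδ]
  exact hC ζ hζΓ δ hδ

end PairIntegral

end CommonMidpoint

end

theorem proposition5p1 (h ε m : ℝ) (hh : 0 < h) (hε : 0 < ε)
    (a : (ℝ × ℝ) × Plane → ℝ → ℂ) (ha : IsAmplitude h ε m a) :
    -- the oscillatory integrals defining `F` converge, and `F` maps test functions to `L²(Y)`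
    (∀ V : Test Plane,
      (∀ p ∈ dataSpace, Tendsto (regularizedF h a V p) (𝓝[>] (0 : ℝ)) (𝓝 (opF h a V p))) ∧
      MemLp (opF h a V) 2 (volume.restrict dataSpace)) ∧
    -- the wavefront set of the kernel of `F* F`
    (∀ K : Distr (Plane × Plane), IsNormalKernel h a K →
      twistedWavefrontSet K ⊆ relDelta ∪ relC1 ∪ relC2 ∪ relC3) ∧
    (IsLagrangian relDelta ∧ IsLagrangian relC1 ∧ IsLagrangian relC2 ∧ IsLagrangian relC3) ∧
    (IntersectCleanlyInCodim 2 relDelta relC1 ∧ IntersectCleanlyInCodim 2 relDelta relC2 ∧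
      IntersectCleanlyInCodim 2 relC1 relC3 ∧ IntersectCleanlyInCodim 2 relC2 relC3) ∧
    (relDelta ∩ relC3 = ∅ ∧ relC1 ∩ relC2 = ∅) := by
  obtain ⟨L, hL⟩ := ha.exists_support hh hε
  exact ⟨fun V => ⟨fun p _ => tendsto_regularizedF hh ha hL V p, memLp_opF hh ha hL V⟩,
    fun _ hK => twistedWavefrontSet_subset hh hε ha hK, canonical_relations_geometry⟩
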